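/- **Conventions.** The alphabet of a language $L$ is the set $\Sigma$ of letters that occur in words of $L$. The quotients of $L$ are the languages $w^{-1}L=\{x\mid wx\in L\}$ with $w\in\Sigma^*$, and the complexity $\kappa(L)$ is the number of distinct quotients of $L$; this convention is also used for the results of operations, each with its own alphabet. A DFA is minimal if all its states are reachable and no two distinct states accept the same language. The syntactic semigroup of $L$ is $\Sigma^+/{\approx}$, where $x\approx y$ iff $uxv\in L\Leftrightarrow uyv\in L$ for all $u,v\in\Sigma^*$. The atoms of $L$ are the classes of the equivalence on $\Sigma^*$ that relates $x$ and $y$ iff $ux\in L\Leftrightarrow uy\in L$ for all $u\in\Sigma^*$; equivalently, they are the non-empty sets $A_S=\bigcap_{K\in S}K\cap\bigcap_{K\notin S}(\Sigma^*\setminus K)$, where $S$ is a set of quotients of $L$ and $K$ runs over the quotients of $L$. For $n\ge 3$ let $\mathcal D_n(a,b,c,d)$ be the DFA over $\{a,b,c,d\}$ with states $Q_n=\{0,\dots,n-1\}$, initial state $0$, only final state $n-1$, in which $a$ acts as the cycle $(0,1,\dots,n-1)$, $b$ as the transposition $(0,1)$, $c$ sends $n-1$ to $0$ and fixes all other states,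 and $d$ acts as the identity. Let $L_n=L_n(a,b,c,d)$ be its language. For a partial injective map $\pi$ of the letters, the dialect $L_n(\pi(a),\pi(b),\pi(c),\pi(d))$ is obtained from $L_n$ by deleting the words that contain a letter at which $\pi$ is undefined (written $-$) and replacing each letter $x$ by $\pi(x)$; final dashes are omitted. **Theorem (Most Complex Regular Languages).** For each $n\ge3$ the DFA $\mathcal D_n(a,b,c,d)$ is minimal and $L_n(a,b,c,d)$ has complexity $n$. The stream $(L_n(a,b,c,d)\mid n\ge3)$ with the dialect streams $(L_n(a,b,-,c)\mid n\ge 3)$ and $(L_n(b,a,-,d)\mid n\ge3)$ is most complex in the class of regular languages. In detail: the languages $L_n(a,b,c,d)$, $L_n(a,b,c)$, $L_n(a,b,-,c)$, $L_n(b,a,-,d)$, $L_n(a,b)$, $L_n(b,a)$, $L_n(a)$ are regular of complexity $n$, and for all $m,n\ge 3$: 1. The syntactic semigroup of $L_n(a,b,c)$ has cardinality $n^n$. 2. Each quotient of $L_n(a)$ has complexity $n$. 3. The reverse of $L_n(a,b,c)$ has complexity $2^n$, and $L_n(a,b,c)$ has $2^n$ atoms. 4. For each set $S$ of quotients of $L_n(a,b,c)$,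 the set $A_S$ is an atom, of complexity $$\kappa(A_S)=\begin{cases}2^n-1 & \text{if } |S|\in\{0,n\},\\ 1+\sum_{x=1}^{|S|}\sum_{y=1}^{n-|S|}\binom nx\binom{n-x}{y} & \text{if } 0<|S|<n.\end{cases}$$ 5. The star of $L_n(a,b)$ has complexity $2^{n-1}+2^{n-2}$. 6. The product $L_m(a,b,-,c)\,L_n(b,a,-,d)$ has complexity $m2^n+2^{n-1}$. 7. The union and the symmetric difference of $L_m(a,b,-,c)$ and $L_n(b,a,-,d)$ have complexity $mn+m+n+1$; the difference $L_m(a,b,-,c)\setminus L_n(b,a)$ has complexity $mn+m$; and the intersection $L_m(a,b)\cap L_n(b,a)$ has complexity $mn$. Items 1–5 hold for $L_n(a,b,c,d)$ as well, and the difference and the intersection in item 7 have the same complexities for $L_m(a,b,-,c)$ and $L_n(b,a,-,d)$. All these values are maximal: for $m,n\ge3$, every regular language $L$ of complexity $n$ has a syntactic semigroup of cardinality at most $n^n$, quotients of complexity at most $n$, a reverse of complexity at most $2^n$, at most $2^n$ atoms, atoms $A_S$ of complexity at most the value in item 4, and a star of complexity at most $2^{n-1}+2^{n-2}$; and if moreover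 $L'$ is a regular language of complexity $m$, over an alphabet that may differ from that of $L$, then $\kappa(L'L)\le m2^n+2^{n-1}$, $\kappa(L'\cup L)$ and $\kappa(L'\oplus L)$ are at most $mn+m+n+1$, $\kappa(L'\setminus L)\le mn+m$ and $\kappa(L'\cap L)\le mn$. The number of four letters is the smallest possible: if $L'$ and $L$ are regular languages of the same complexity $n\ge3$ and $\kappa(L'\cup L)=n^2+2n+1$, then $L'$ and $L$ together use at least four letters. -/

import Mathlib

open scoped Computability

namespace MostComplex

section General

variable {α : Type*}

/-- The alphabet of a language: the letters that occur in some word of it. -/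
def alphabet (L : Language α) : Set α :=
  {x | ∃ u v : List α, u ++ x :: v ∈ L}

/-- The language `Γ*` of all words over the set of letters `Γ`. -/
def words (Γ : Set α) : Language α :=
  {w : List α | ∀ x ∈ w, x ∈ Γ}

/-- The left quotients `w⁻¹L` of `L` by the words `w` over the alphabet of `L` itself. -/
def quotients (L : Language α) : Set (Language α) :=
  {K | ∃ w ∈ words (alphabet L), K = L.leftQuotient w}

/-- Quotient (state) complexity of a language: the number of its left quotients by words over
its own alphabet. -/
noncomputable def complexity (L : Language α) : ℕ∞ :=
  (quotients L).encard

/-- A (complete) DFA is minimal if every state is reachable and no two distinct states are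
equivalent. -/
def IsMinimal {σ : Type*} (M : DFA α σ) : Prop :=
  (∀ q : σ, ∃ w : List α, M.eval w = q) ∧
    ∀ p q : σ, M.acceptsFrom p = M.acceptsFrom q → p = q

/-- The word over `α` spelled by an element of the free semigroup `Σ⁺`, with `Σ` the alphabet
of `L`. -/
def spell {L : Language α} (w : FreeSemigroup (alphabet L)) : List α :=
  (w.head :: w.tail).map Subtype.val

theorem spell_mul {L : Language α} (x y : FreeSemigroup (alphabet L)) :
    spell (x * y) = spell x ++ spell y := by
  simp [spell]

theorem spell_mem_words {L : Language α} (x : FreeSemigroup (alphabet L)) :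
    spell x ∈ words (alphabet L) := by
  intro l hl
  obtain ⟨t, -, rfl⟩ := List.mem_map.1 hl
  exact t.2

theorem append_mem_words {Γ : Set α} {u v : List α} (hu : u ∈ words Γ) (hv : v ∈ words Γ) :
    u ++ v ∈ words Γ := by
  intro l hl
  rcases List.mem_append.1 hl with h | h
  · exact hu l h
  · exact hv l h

/-- The syntactic congruence of `L` on `Σ⁺`, with `Σ` the alphabet of `L`. -/
def syntacticCon (L : Language α) : Con (FreeSemigroup (alphabet L)) where
  r x y := ∀ u ∈ words (alphabet L), ∀ v ∈ words (alphabet L),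
    (u ++ spell x ++ v ∈ L ↔ u ++ spell y ++ v ∈ L)
  iseqv :=
    { refl := fun _ _ _ _ _ => Iff.rfl
      symm := fun h u hu v hv => (h u hu v hv).symm
      trans := fun h k u hu v hv => (h u hu v hv).trans (k u hu v hv) }
  mul' := by
    intro x x' y y' hx hy u hu v hv
    have h1 := hx u hu (spell y ++ v) (append_mem_words (spell_mem_words y) hv)
    have h2 := hy (u ++ spell x') (append_mem_words hu (spell_mem_words x')) v hv
    simp only [spell_mul, List.append_assoc] at h1 h2 ⊢
    exact h1.trans h2

/-- The syntactic semigroup of `L`, a quotient of `Σ⁺`. -/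
abbrev SyntacticSemigroup (L : Language α) : Type _ :=
  (syntacticCon L).Quotient

/-- The atoms of `L`: the classes of the left congruence on `Σ*` that relates `x` and `y` if
`ux ∈ L ↔ uy ∈ L` for all `u ∈ Σ*`, with `Σ` the alphabet of `L`. -/
def atoms (L : Language α) : Set (Language α) :=
  {A | ∃ x ∈ words (alphabet L),
    A = {y : List α | y ∈ words (alphabet L) ∧
      ∀ u ∈ words (alphabet L), (u ++ x ∈ L ↔ u ++ y ∈ L)}}

/-- For a set `S` of quotients of `L`, the intersection `A_S` (within `Σ*`) of the quotients
in `S` and of the complements of the quotients not in `S`. -/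
def atomOf (L : Language α) (S : Set (Language α)) : Language α :=
  {x : List α | x ∈ words (alphabet L) ∧ ∀ K ∈ quotients L, (x ∈ K ↔ K ∈ S)}

/-- The image of `L` under the substitution that sends a letter `x` to `{π x}` if `π x` is
defined, and to the empty set otherwise. -/
def dialect {β : Type*} (π : α → Option β) (L : Language α) : Language β :=
  {w : List β | ∃ u ∈ L, List.Forall₂ (fun x y => π x = some y) u w}

end General

/-- The maximal complexity of an atom `A_S` of a language of complexity `n`, where `s = |S|`. -/
def atomBound (n s : ℕ) : ℕ :=
  if s = 0 ∨ s = n then 2 ^ n - 1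
  else 1 + ∑ x ∈ Finset.Icc 1 s, ∑ y ∈ Finset.Icc 1 (n - s), n.choose x * (n - x).choose y

/-- The four letters `a, b, c, d`. -/
inductive Letter : Type
  | a
  | b
  | c
  | d

/-- The DFA `D_n(a,b,c,d)` with states `0, …, n-1`, initial state `0`, final state `n-1`, and
`a : (0,…,n-1)`, `b : (0,1)`, `c : (n-1 → 0)`, `d : identity`. -/
def witnessDFA (n : ℕ) (hn : 3 ≤ n) : DFA Letter (Fin n) where
  step q l :=
    match l with
    | .a => finRotate n q
    | .b => Equiv.swap (⟨0, by omega⟩ : Fin n) ⟨1, by omega⟩ q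
    | .c => if q = ⟨n - 1, by omega⟩ then ⟨0, by omega⟩ else q
    | .d => q
  start := ⟨0, by omega⟩
  accept := {⟨n - 1, by omega⟩}

/-- The partial map of letters `a ↦ x, b ↦ y, c ↦ z, d ↦ t`; `none` means undefined. -/
def letterMap (x y z t : Option Letter) : Letter → Option Letter
  | .a => x
  | .b => y
  | .c => z
  | .d => t

/-- The dialect `L_n(x,y,z,t)` of the language `L_n(a,b,c,d)` of `D_n(a,b,c,d)`. -/
def witness (n : ℕ) (hn : 3 ≤ n) (x y z t : Option Letter) : Language Letter :=
  dialect (letterMap x y z t) (witnessDFA n hn).accepts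

end MostComplex

open MostComplex

open scoped Computability

/-! A language of complexity `n` is the same thing as a minimal automaton with `n` states over the
alphabet of the language (`Presents`, `exists_presents`). Every upper bound labels the quotients of
the result by configurations of a subset or product automaton and counts the possible labels. Every
lower bound shows, for the witnesses, that all these configurations are reached and pairwise
distinguishable.

For semigroup, reversal and atoms the point is that `a`, `b` generate the symmetric group and `c`
has rank `n - 1`, so words induce all transformations of the states (`full_of_letters`). Hence any
set of states is exactly the set from which some word is accepted. This gives `2 ^ n` quotients of
the reverse and `2 ^ n` atoms. A quotient of an atom is governed by the images of a set of states
and of its complement: either they are disjoint and otherwise arbitrary within the size limits, or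
they meet and the quotient is empty.

For the star, the configurations are the non-empty sets that contain the initial state whenever they
contain the final one. The empty set satisfies the same implication but is never reached; its place
in the count is taken by the star itself, which differs from the other quotients because it contains
the empty word without having read anything. Reachability is an induction on size and then on the
sum of the elements (`exists_word_starStep`).

For binary operations over different alphabets each automaton is completed by a sink `none`, entered
on foreign letters; this is where the additional terms of the bounds come from. In the witnesses `c`
is foreign to the second factor and the identity in the first, and `d` conversely, so each of them
switches one factor off and exposes the other. The letters `a` and `b` act as cycle and
transposition with exchanged roles, so both components can be steered independently
(`exists_word_pair`). For the product, the set component is enlarged by passing the first factor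
around its cycle and rearranged by words that fix its state `0` (`prodReachable_zero`).

Four letters are needed because the sinks demand a private letter on each side, and a single shared
letter moves the pair of states along one orbit, which cannot cover all pairs
(`exists_pair_not_mem_orbit`). -/

namespace MostComplex


/-! ### Automata over the alphabet of a language, and counting of quotients. -/

section Runs

variable {α σ : Type*}

/-- The language of the words over `Γ` that lead from `q` to a state in `F`. -/
def runLang (Γ : Set α) (δ : σ → α → σ) (F : Set σ) (q : σ) : Language α :=
  {w : List α | w ∈ words Γ ∧ w.foldl δ q ∈ F}

theorem mem_runLang {Γ : Set α} {δ : σ → α → σ} {F : Set σ} {q : σ} {w : List α} :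
    w ∈ runLang Γ δ F q ↔ w ∈ words Γ ∧ w.foldl δ q ∈ F :=
  Iff.rfl

theorem mem_words {Γ : Set α} {w : List α} : w ∈ words Γ ↔ ∀ x ∈ w, x ∈ Γ :=
  Iff.rfl

@[simp]
theorem nil_mem_words {Γ : Set α} : [] ∈ words Γ := by
  simp [mem_words]

@[simp]
theorem append_mem_words_iff {Γ : Set α} {u v : List α} :
    u ++ v ∈ words Γ ↔ u ∈ words Γ ∧ v ∈ words Γ := by
  simp only [mem_words, List.mem_append]
  grind

@[simp]
theorem cons_mem_words_iff {Γ : Set α} {x : α} {v : List α} :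
    x :: v ∈ words Γ ↔ x ∈ Γ ∧ v ∈ words Γ := by
  simp [mem_words]

@[simp]
theorem reverse_mem_words_iff {Γ : Set α} {v : List α} :
    v.reverse ∈ words Γ ↔ v ∈ words Γ := by
  simp [mem_words]

theorem words_mono {Γ Δ : Set α} (h : Γ ⊆ Δ) {w : List α} (hw : w ∈ words Γ) : w ∈ words Δ :=
  fun x hx => h (hw x hx)

theorem replicate_mem_words {Γ : Set α} {x : α} (h : x ∈ Γ) (k : ℕ) :
    List.replicate k x ∈ words Γ := by
  intro y hy
  rw [List.eq_of_mem_replicate hy]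
  exact h

theorem mem_words_alphabet {L : Language α} {w : List α} (h : w ∈ L) : w ∈ words (alphabet L) := by
  intro x hx
  obtain ⟨u, v, rfl⟩ := List.append_of_mem hx
  exact ⟨u, v, h⟩

theorem alphabet_subset {Γ : Set α} {L : Language α} (h : ∀ w ∈ L, w ∈ words Γ) :
    alphabet L ⊆ Γ := by
  rintro x ⟨u, v, hx⟩
  exact h _ hx x (by simp)

theorem alphabet_mono {K L : Language α} (h : ∀ w ∈ K, w ∈ L) : alphabet K ⊆ alphabet L :=
  alphabet_subset fun w hw => mem_words_alphabet (h w hw)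

theorem alphabet_runLang_subset (Γ : Set α) (δ : σ → α → σ) (F : Set σ) (q : σ) :
    alphabet (runLang Γ δ F q) ⊆ Γ :=
  alphabet_subset fun _ hw => hw.1

theorem leftQuotient_runLang {Γ : Set α} {δ : σ → α → σ} {F : Set σ} {q : σ} {w : List α}
    (hw : w ∈ words Γ) : (runLang Γ δ F q).leftQuotient w = runLang Γ δ F (w.foldl δ q) := by
  ext v
  simp [Language.mem_leftQuotient, mem_runLang, hw]

/-- Every state can be reached from every state by a word over `Γ`. -/
def StronglyConnected (Γ : Set α) (δ : σ → α → σ) : Prop :=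
  ∀ p q : σ, ∃ w ∈ words Γ, w.foldl δ p = q

theorem StronglyConnected.alphabet_runLang {Γ : Set α} {δ : σ → α → σ}
    (h : StronglyConnected Γ δ) {F : Set σ} (hF : F.Nonempty) (q : σ) :
    alphabet (runLang Γ δ F q) = Γ := by
  refine (alphabet_runLang_subset _ _ _ _).antisymm fun x hx => ?_
  obtain ⟨f, hf⟩ := hF
  obtain ⟨w, hw, e⟩ := h (δ q x) f
  exact ⟨[], w, by simp [hx, hw], by simpa [e] using hf⟩

theorem le_complexity {ι : Type*} {L : Language α} (g : ι → Language α)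
    (hg : Function.Injective g)
    (h : ∀ i, ∃ w ∈ words (alphabet L), L.leftQuotient w = g i) :
    ENat.card ι ≤ complexity L := by
  rw [complexity, ← Set.encard_univ, ← hg.encard_image, Set.image_univ]
  refine Set.encard_le_encard ?_
  rintro _ ⟨i, rfl⟩
  obtain ⟨w, hw, e⟩ := h i
  exact ⟨w, hw, e.symm⟩

theorem le_complexity_of_finset {ι : Type*} {L : Language α} (T : Finset ι) (g : ι → Language α)
    (hg : Set.InjOn g T)
    (h : ∀ i ∈ T, ∃ w ∈ words (alphabet L), L.leftQuotient w = g i) :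
    (T.card : ℕ∞) ≤ complexity L := by
  have := le_complexity (L := L) (fun i : T => g i) (fun i j e => Subtype.ext (hg i.2 j.2 e))
    (fun i => h i i.2)
  simpa using this

theorem complexity_le_of_finset {ι : Type*} {L : Language α} (T : Finset ι) (g : ι → Language α)
    (h : ∀ w ∈ words (alphabet L), ∃ i ∈ T, L.leftQuotient w = g i) :
    complexity L ≤ (T.card : ℕ∞) := by
  rw [← Set.encard_coe_eq_coe_finsetCard]
  refine le_trans (Set.encard_le_encard ?_) (Set.encard_image_le g T)
  rintro _ ⟨w, hw, rfl⟩
  obtain ⟨i, hi, e⟩ := h w hw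
  exact ⟨i, hi, e.symm⟩

/-- `L` is the language of the minimal automaton with transition map `δ`, final states `F` and
initial state `s` over the alphabet of `L`. -/
structure Presents (L : Language α) (δ : σ → α → σ) (F : Set σ) (s : σ) : Prop where
  eq : L = runLang (alphabet L) δ F s
  reach : ∀ q, ∃ w ∈ words (alphabet L), w.foldl δ s = q
  inj : Function.Injective (runLang (alphabet L) δ F)

namespace Presents

variable {L : Language α} {δ : σ → α → σ} {F : Set σ} {s : σ}

theorem mem_iff (P : Presents L δ F s) {w : List α} :
    w ∈ L ↔ w ∈ words (alphabet L) ∧ w.foldl δ s ∈ F := by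
  conv_lhs => rw [P.eq]
  exact mem_runLang

theorem leftQuotient (P : Presents L δ F s) {w : List α} (hw : w ∈ words (alphabet L)) :
    L.leftQuotient w = runLang (alphabet L) δ F (w.foldl δ s) := by
  conv_lhs => rw [P.eq]
  exact leftQuotient_runLang hw

theorem quotients_eq (P : Presents L δ F s) :
    quotients L = Set.range (runLang (alphabet L) δ F) := by
  ext K
  constructor
  · rintro ⟨w, hw, rfl⟩
    exact ⟨_, (P.leftQuotient hw).symm⟩
  · rintro ⟨q, rfl⟩
    obtain ⟨w, hw, rfl⟩ := P.reach q
    exact ⟨w, hw, (P.leftQuotient hw).symm⟩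

theorem complexity_eq {n : ℕ} {δ : Fin n → α → Fin n} {F : Set (Fin n)} {s : Fin n}
    (P : Presents L δ F s) : complexity L = n := by
  rw [complexity, P.quotients_eq, ← Set.image_univ, P.inj.encard_image, Set.encard_univ]
  simp

/-- Quotients by words that use a foreign letter are empty, so the set of all left quotients exceeds
the quotients over the alphabet by at most one; the Myhill–Nerode criterion applies. -/
theorem isRegular [Finite σ] (P : Presents L δ F s) : L.IsRegular := by
  refine Language.IsRegular.of_finite_range_leftQuotient
    (((Set.finite_range (runLang (alphabet L) δ F)).insert 0).subset ?_)
  rintro _ ⟨w, rfl⟩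
  by_cases hw : w ∈ words (alphabet L)
  · exact Or.inr ⟨_, (P.leftQuotient hw).symm⟩
  · refine Or.inl ?_
    ext v
    simp only [Language.mem_leftQuotient, Language.notMem_zero, iff_false]
    intro h
    exact hw (append_mem_words_iff.1 (mem_words_alphabet h)).1

theorem eq_of_forall (P : Presents L δ F s) {p q : σ}
    (h : ∀ w ∈ words (alphabet L), w.foldl δ p ∈ F ↔ w.foldl δ q ∈ F) : p = q := by
  refine P.inj ?_
  ext w
  rw [mem_runLang, mem_runLang]
  exact and_congr_right fun hw => h w hw

theorem final_nonempty [Nontrivial σ] (P : Presents L δ F s) : F.Nonempty := by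
  by_contra h
  rw [Set.not_nonempty_iff_eq_empty] at h
  obtain ⟨p, q, hpq⟩ := exists_pair_ne σ
  exact hpq (P.eq_of_forall (by simp [h]))

theorem final_compl_nonempty [Nontrivial σ] (P : Presents L δ F s) : Fᶜ.Nonempty := by
  by_contra h
  rw [Set.not_nonempty_iff_eq_empty, Set.compl_empty_iff] at h
  obtain ⟨p, q, hpq⟩ := exists_pair_ne σ
  exact hpq (P.eq_of_forall (by simp [h]))

end Presents

theorem quotients_leftQuotient_mem {L K : Language α} (hK : K ∈ quotients L) {x : α}
    (hx : x ∈ alphabet L) : K.leftQuotient [x] ∈ quotients L := by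
  obtain ⟨w, hw, rfl⟩ := hK
  exact ⟨w ++ [x], by simp [hw, hx], (Language.leftQuotient_append _ _ _).symm⟩

/-- A language with `n` quotients is presented by an automaton with `n` states. -/
theorem exists_presents {L : Language α} {n : ℕ} (h : complexity L = (n : ℕ∞)) :
    ∃ (δ : Fin n → α → Fin n) (F : Set (Fin n)) (s : Fin n), Presents L δ F s := by
  classical
  have hfin : (quotients L).Finite := Set.finite_of_encard_eq_coe h
  have hcard : Nat.card (quotients L) = n := by
    rw [Nat.card_coe_set_eq, Set.ncard, ← complexity, h]
    rfl
  have : Finite (quotients L) := hfin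
  let e : quotients L ≃ Fin n := Finite.equivFinOfCardEq hcard
  -- The states are the quotients. The self-loop on foreign letters is a default value: `runLang`
  -- only admits words over the alphabet.
  let δ : Fin n → α → Fin n := fun i x =>
    if hx : x ∈ alphabet L then e ⟨_, quotients_leftQuotient_mem (e.symm i).2 hx⟩ else i
  have hδ : ∀ w ∈ words (alphabet L), ∀ i,
      (e.symm (w.foldl δ i)).1 = (e.symm i).1.leftQuotient w := by
    intro w
    induction w with
    | nil => intro _ i; rfl
    | cons x w ih =>
      intro hw i
      rw [cons_mem_words_iff] at hw
      rw [List.foldl_cons, ih hw.2]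
      have : x :: w = [x] ++ w := rfl
      rw [this, Language.leftQuotient_append]
      simp [δ, hw.1]
  have hL : L ∈ quotients L := ⟨[], by simp, rfl⟩
  have hrun : ∀ i, runLang (alphabet L) δ {i | [] ∈ (e.symm i).1} i = (e.symm i).1 := by
    intro i
    ext w
    rw [mem_runLang]
    constructor
    · rintro ⟨hw, h⟩
      rw [Set.mem_ofPred_eq, hδ w hw, Language.mem_leftQuotient, List.append_nil] at h
      exact h
    · intro h
      obtain ⟨v, hv, e'⟩ := (e.symm i).2
      have hw : w ∈ words (alphabet L) := by
        rw [e', Language.mem_leftQuotient] at h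
        exact (append_mem_words_iff.1 (mem_words_alphabet h)).2
      refine ⟨hw, ?_⟩
      rw [Set.mem_ofPred_eq, hδ w hw, Language.mem_leftQuotient, List.append_nil]
      exact h
  refine ⟨δ, {i | [] ∈ (e.symm i).1}, e ⟨L, hL⟩, ?_, ?_, ?_⟩
  · rw [hrun]
    simp
  · intro q
    obtain ⟨w, hw, e'⟩ := (e.symm q).2
    refine ⟨w, hw, e.symm.injective (Subtype.ext ?_)⟩
    rw [hδ w hw, e']
    simp
  · intro i j hij
    simp only [hrun] at hij
    exact e.symm.injective (Subtype.ext hij)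

end Runs


/-! ### Quotients, syntactic semigroup, reversal and number of atoms. -/

section Unary

variable {α : Type*} {n : ℕ} {L : Language α} {δ : Fin n → α → Fin n} {F : Set (Fin n)} {s : Fin n}

/-- Every transformation of the states is induced by a word over `Γ`. -/
def Full (Γ : Set α) (δ : Fin n → α → Fin n) : Prop :=
  ∀ f : Fin n → Fin n, ∃ w ∈ words Γ, ∀ q, w.foldl δ q = f q

theorem Presents.complexity_quotient_le (P : Presents L δ F s) {K : Language α}
    (hK : K ∈ quotients L) : complexity K ≤ n := by
  rw [P.quotients_eq] at hK
  obtain ⟨q, rfl⟩ := hK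
  have := complexity_le_of_finset (L := runLang (alphabet L) δ F q) Finset.univ
    (runLang (alphabet L) δ F) (fun w hw =>
      ⟨_, Finset.mem_univ _, leftQuotient_runLang
        (words_mono (alphabet_runLang_subset _ _ _ _) hw)⟩)
  simpa using this

/-- Strong connectivity is used twice: a quotient keeps the full alphabet, and from its state every
other state is still reached. -/
theorem Presents.complexity_quotient (P : Presents L δ F s)
    (hc : StronglyConnected (alphabet L) δ) (hF : F.Nonempty) {K : Language α}
    (hK : K ∈ quotients L) : complexity K = n := by
  refine le_antisymm (P.complexity_quotient_le hK) ?_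
  rw [P.quotients_eq] at hK
  obtain ⟨q, rfl⟩ := hK
  have := le_complexity (L := runLang (alphabet L) δ F q) (runLang (alphabet L) δ F) P.inj
    (fun i => by
      obtain ⟨w, hw, e⟩ := hc q i
      refine ⟨w, ?_, ?_⟩
      · rwa [hc.alphabet_runLang hF]
      · rw [leftQuotient_runLang hw, e])
  simpa using this

/-! ### Syntactic semigroup -/

/-- Left contexts reach every state and right contexts separate distinct states, so congruent words
are those inducing the same transformation. -/
theorem Presents.syntacticCon_iff (P : Presents L δ F s) {x y : FreeSemigroup (alphabet L)} :
    syntacticCon L x y ↔ (fun q => (spell x).foldl δ q) = fun q => (spell y).foldl δ q := by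
  change (∀ u ∈ words (alphabet L), ∀ v ∈ words (alphabet L),
    (u ++ spell x ++ v ∈ L ↔ u ++ spell y ++ v ∈ L)) ↔ _
  have hx := spell_mem_words x
  have hy := spell_mem_words y
  constructor
  · intro h
    funext q
    obtain ⟨u, hu, rfl⟩ := P.reach q
    refine P.eq_of_forall fun v hv => ?_
    have := h u hu v hv
    rw [P.mem_iff, P.mem_iff] at this
    simpa [hu, hv, hx, hy] using this
  · intro h u hu v hv
    have := congrFun h (u.foldl δ s)
    rw [P.mem_iff, P.mem_iff]
    simp only [append_mem_words_iff, hu, hv, hx, hy, List.foldl_append, true_and, this]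

/-- The action of the syntactic semigroup on the states. -/
noncomputable def Presents.action (P : Presents L δ F s) :
    SyntacticSemigroup L → Fin n → Fin n :=
  Quotient.lift (fun x q => (spell x).foldl δ q) fun _ _ h => P.syntacticCon_iff.1 h

theorem Presents.action_injective (P : Presents L δ F s) : Function.Injective P.action := by
  intro x y
  induction x using Quotient.inductionOn
  induction y using Quotient.inductionOn
  intro h
  exact Quotient.sound (P.syntacticCon_iff.2 h)

theorem card_transformations (n : ℕ) : ENat.card (Fin n → Fin n) = ((n ^ n : ℕ) : ℕ∞) := by
  simp [ENat.card_eq_coe_fintype_card]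

theorem Presents.card_syntacticSemigroup_le (P : Presents L δ F s) :
    ENat.card (SyntacticSemigroup L) ≤ ((n ^ n : ℕ) : ℕ∞) := by
  rw [← card_transformations]
  exact ENat.card_le_card_of_injective P.action_injective

theorem exists_spell {w : List α} (hw : w ∈ words (alphabet L)) (h : w ≠ []) :
    ∃ x : FreeSemigroup (alphabet L), spell x = w := by
  cases w with
  | nil => exact absurd rfl h
  | cons a w =>
    obtain ⟨ha, hw⟩ := cons_mem_words_iff.1 hw
    have hr : w ∈ Set.range (List.map (Subtype.val : alphabet L → α)) := by
      rw [Set.range_list_map_coe]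
      exact hw
    obtain ⟨l, rfl⟩ := hr
    exact ⟨⟨⟨a, ha⟩, l⟩, rfl⟩

/-- The syntactic semigroup excludes the empty word, which matters for the identity. Factoring `f`
through a transposition and its inverse forces a non-empty first word, since the transposition is
not the identity. -/
theorem Full.exists_ne_nil [Nontrivial (Fin n)] {Γ : Set α} (h : Full Γ δ) (f : Fin n → Fin n) :
    ∃ w ∈ words Γ, w ≠ [] ∧ ∀ q, w.foldl δ q = f q := by
  obtain ⟨p, q, hpq⟩ := exists_pair_ne (Fin n)
  obtain ⟨u, hu, e⟩ := h (Equiv.swap p q)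
  obtain ⟨v, hv, e'⟩ := h (f ∘ Equiv.swap p q)
  refine ⟨u ++ v, by simp [hu, hv], ?_, by simp [e, e']⟩
  rintro h0
  rw [List.append_eq_nil_iff] at h0
  have := e p
  rw [h0.1] at this
  exact hpq (by simpa using this)

theorem Presents.card_syntacticSemigroup [Nontrivial (Fin n)] (P : Presents L δ F s)
    (h : Full (alphabet L) δ) : ENat.card (SyntacticSemigroup L) = ((n ^ n : ℕ) : ℕ∞) := by
  rw [← card_transformations]
  refine ENat.card_congr (Equiv.ofBijective P.action ⟨P.action_injective, fun f => ?_⟩)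
  obtain ⟨w, hw, h0, e⟩ := h.exists_ne_nil f
  obtain ⟨x, rfl⟩ := exists_spell hw h0
  exact ⟨Quotient.mk _ x, funext e⟩

/-! ### Reversal -/

/-- The quotients of the reverse of a language, indexed by sets of states. -/
def revLang (Γ : Set α) (δ : Fin n → α → Fin n) (s : Fin n) (T : Finset (Fin n)) : Language α :=
  {w : List α | w ∈ words Γ ∧ w.reverse.foldl δ s ∈ T}

theorem mem_revLang {Γ : Set α} {T : Finset (Fin n)} {w : List α} :
    w ∈ revLang Γ δ s T ↔ w ∈ words Γ ∧ w.reverse.foldl δ s ∈ T :=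
  Iff.rfl

theorem alphabet_reverse (L : Language α) : alphabet L.reverse = alphabet L := by
  have h : ∀ L : Language α, alphabet L.reverse ⊆ alphabet L := fun L =>
    alphabet_subset fun w hw => by
      have := mem_words_alphabet (Language.mem_reverse.1 hw)
      simpa using this
  refine (h L).antisymm ?_
  simpa using h L.reverse

open Classical in
/-- The set of states from which `w` leads to a final state. -/
noncomputable def acceptingStates (δ : Fin n → α → Fin n) (F : Set (Fin n)) (w : List α) :
    Finset (Fin n) :=
  Finset.univ.filter fun q => w.foldl δ q ∈ F

@[simp]
theorem mem_acceptingStates {w : List α} {q : Fin n} :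
    q ∈ acceptingStates δ F w ↔ w.foldl δ q ∈ F := by
  simp [acceptingStates]

/-- Reading `w` in the reverse leaves open only whether the reversed continuation leads into the set
of states from which `w.reverse` is accepted; hence quotients are indexed by sets of states. -/
theorem Presents.leftQuotient_reverse (P : Presents L δ F s) {w : List α}
    (hw : w ∈ words (alphabet L)) :
    L.reverse.leftQuotient w = revLang (alphabet L) δ s (acceptingStates δ F w.reverse) := by
  ext v
  rw [Language.mem_leftQuotient, Language.mem_reverse, P.mem_iff, mem_revLang]
  simp [hw]

theorem Presents.complexity_reverse_le (P : Presents L δ F s) :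
    complexity L.reverse ≤ ((2 ^ n : ℕ) : ℕ∞) := by
  have := complexity_le_of_finset (L := L.reverse) (Finset.univ : Finset (Finset (Fin n)))
    (revLang (alphabet L) δ s) (fun w hw => by
      rw [alphabet_reverse] at hw
      exact ⟨_, Finset.mem_univ _, P.leftQuotient_reverse hw⟩)
  simpa using this

/-- Use a transformation that sends `T` to one final state and everything else to one non-final
state. The lower bounds for reversal and atoms rest on this. -/
theorem Full.exists_acceptingStates {Γ : Set α} (h : Full Γ δ) (hF : F.Nonempty)
    (hF' : Fᶜ.Nonempty) (T : Finset (Fin n)) :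
    ∃ w ∈ words Γ, acceptingStates δ F w = T := by
  obtain ⟨f, hf⟩ := hF
  obtain ⟨g, hg⟩ := hF'
  obtain ⟨w, hw, e⟩ := h (fun q => if q ∈ T then f else g)
  refine ⟨w, hw, ?_⟩
  ext q
  rw [mem_acceptingStates, e]
  split_ifs with hq
  · simp [hf, hq]
  · simpa [hq] using hg

theorem Presents.complexity_reverse [Nontrivial (Fin n)] (P : Presents L δ F s)
    (h : Full (alphabet L) δ) : complexity L.reverse = ((2 ^ n : ℕ) : ℕ∞) := by
  refine le_antisymm P.complexity_reverse_le ?_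
  have := le_complexity (L := L.reverse) (revLang (alphabet L) δ s) (fun T T' hT => by
      ext q
      obtain ⟨w, hw, rfl⟩ := P.reach q
      have : w.reverse ∈ revLang (alphabet L) δ s T ↔ w.reverse ∈ revLang (alphabet L) δ s T' := by
        rw [hT]
      simpa [mem_revLang, hw] using this) (fun T => by
      obtain ⟨w, hw, e⟩ := h.exists_acceptingStates P.final_nonempty P.final_compl_nonempty T
      refine ⟨w.reverse, by simpa [alphabet_reverse] using hw, ?_⟩
      rw [P.leftQuotient_reverse (by simpa using hw), List.reverse_reverse, e])
  simpa using this

/-! ### Atoms -/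

/-- The words over `Γ` that lead from the states in `X` to final states, and from the states in
`Y` to non-final states. -/
def pairLang (Γ : Set α) (δ : Fin n → α → Fin n) (F : Set (Fin n)) (X Y : Finset (Fin n)) :
    Language α :=
  {w : List α | w ∈ words Γ ∧ (∀ q ∈ X, w.foldl δ q ∈ F) ∧ ∀ q ∈ Y, w.foldl δ q ∉ F}

theorem mem_pairLang {Γ : Set α} {X Y : Finset (Fin n)} {w : List α} :
    w ∈ pairLang Γ δ F X Y ↔
      w ∈ words Γ ∧ (∀ q ∈ X, w.foldl δ q ∈ F) ∧ ∀ q ∈ Y, w.foldl δ q ∉ F :=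
  Iff.rfl

theorem mem_pairLang_compl {Γ : Set α} {T : Finset (Fin n)} {w : List α} :
    w ∈ pairLang Γ δ F T Tᶜ ↔ w ∈ words Γ ∧ acceptingStates δ F w = T := by
  rw [mem_pairLang]
  refine and_congr_right fun _ => ?_
  constructor
  · rintro ⟨h1, h2⟩
    ext q
    rw [mem_acceptingStates]
    exact ⟨fun h => by_contra fun hq => h2 q (by simpa using hq) h, h1 q⟩
  · rintro rfl
    simp

/-- Since every state is reached, left contexts test acceptance from each state: the class of `x`
depends only on the set of states from which `x` is accepted. -/
theorem Presents.atom_eq (P : Presents L δ F s) {x : List α} (hx : x ∈ words (alphabet L)) :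
    ({y : List α | y ∈ words (alphabet L) ∧
      ∀ u ∈ words (alphabet L), (u ++ x ∈ L ↔ u ++ y ∈ L)} : Language α) =
      pairLang (alphabet L) δ F (acceptingStates δ F x) (acceptingStates δ F x)ᶜ := by
  refine Language.ext fun y => Iff.trans (and_congr_right fun hy => ?_) mem_pairLang_compl.symm
  constructor
  · intro h
    ext q
    obtain ⟨u, hu, rfl⟩ := P.reach q
    have := h u hu
    rw [P.mem_iff, P.mem_iff] at this
    simpa [hu, hx, hy] using this.symm
  · intro h u hu
    have : u.foldl δ s ∈ acceptingStates δ F x ↔ u.foldl δ s ∈ acceptingStates δ F y := by rw [h]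
    rw [P.mem_iff, P.mem_iff]
    simpa [hu, hx, hy] using this

theorem Presents.atoms_eq (P : Presents L δ F s) :
    atoms L = {A | ∃ x ∈ words (alphabet L), A =
      pairLang (alphabet L) δ F (acceptingStates δ F x) (acceptingStates δ F x)ᶜ} := by
  ext A
  constructor
  · rintro ⟨x, hx, rfl⟩
    exact ⟨x, hx, P.atom_eq hx⟩
  · rintro ⟨x, hx, rfl⟩
    exact ⟨x, hx, (P.atom_eq hx).symm⟩

theorem Presents.encard_atoms_le (P : Presents L δ F s) :
    (atoms L).encard ≤ ((2 ^ n : ℕ) : ℕ∞) := by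
  have h : atoms L ⊆ Set.range fun T => pairLang (alphabet L) δ F T Tᶜ := by
    rw [P.atoms_eq]
    rintro _ ⟨x, -, rfl⟩
    exact ⟨_, rfl⟩
  refine (Set.encard_le_encard h).trans ?_
  rw [← Set.image_univ]
  refine (Set.encard_image_le _ _).trans ?_
  simp [Set.encard_univ]

theorem Full.pairLang_compl_injective {Γ : Set α} (h : Full Γ δ) (hF : F.Nonempty)
    (hF' : Fᶜ.Nonempty) : Function.Injective fun T => pairLang Γ δ F T Tᶜ := by
  intro T T' hT
  obtain ⟨w, hw, e⟩ := h.exists_acceptingStates hF hF' T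
  have h1 : w ∈ pairLang Γ δ F T Tᶜ := mem_pairLang_compl.2 ⟨hw, e⟩
  rw [show pairLang Γ δ F T Tᶜ = pairLang Γ δ F T' T'ᶜ from hT] at h1
  exact e.symm.trans (mem_pairLang_compl.1 h1).2

theorem Presents.encard_atoms [Nontrivial (Fin n)] (P : Presents L δ F s)
    (h : Full (alphabet L) δ) : (atoms L).encard = ((2 ^ n : ℕ) : ℕ∞) := by
  have e : atoms L = Set.range fun T => pairLang (alphabet L) δ F T Tᶜ := by
    rw [P.atoms_eq]
    ext A
    constructor
    · rintro ⟨x, -, rfl⟩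
      exact ⟨_, rfl⟩
    · rintro ⟨T, rfl⟩
      obtain ⟨w, hw, e⟩ := h.exists_acceptingStates P.final_nonempty P.final_compl_nonempty T
      exact ⟨w, hw, by rw [e]⟩
  rw [e, ← Set.image_univ, (h.pairLang_compl_injective P.final_nonempty
    P.final_compl_nonempty).encard_image]
  simp [Set.encard_univ]

open Classical in
/-- The states whose languages belong to a set `S` of languages. -/
noncomputable def statesOf (Γ : Set α) (δ : Fin n → α → Fin n) (F : Set (Fin n))
    (S : Set (Language α)) : Finset (Fin n) :=
  Finset.univ.filter fun q => runLang Γ δ F q ∈ S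

theorem Presents.card_statesOf (P : Presents L δ F s) {S : Set (Language α)}
    (hS : S ⊆ quotients L) : (statesOf (alphabet L) δ F S).card = S.ncard := by
  have : S = runLang (alphabet L) δ F '' (statesOf (alphabet L) δ F S) := by
    ext K
    constructor
    · intro hK
      have := hS hK
      rw [P.quotients_eq] at this
      obtain ⟨q, rfl⟩ := this
      exact ⟨q, by simpa [statesOf] using hK, rfl⟩
    · rintro ⟨q, hq, rfl⟩
      simpa [statesOf] using hq
  conv_rhs => rw [this]
  rw [Set.ncard_image_of_injective _ P.inj, Set.ncard_coe_finset]

theorem Presents.atomOf_eq (P : Presents L δ F s) (S : Set (Language α)) :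
    atomOf L S = pairLang (alphabet L) δ F (statesOf (alphabet L) δ F S)
      (statesOf (alphabet L) δ F S)ᶜ := by
  ext x
  rw [mem_pairLang_compl]
  change (x ∈ words (alphabet L) ∧ ∀ K ∈ quotients L, (x ∈ K ↔ K ∈ S)) ↔ _
  refine and_congr_right fun hx => ?_
  rw [P.quotients_eq, Set.forall_mem_range, Finset.ext_iff]
  simp [statesOf, mem_runLang, hx]

theorem Presents.atomOf_mem_atoms [Nontrivial (Fin n)] (P : Presents L δ F s)
    (h : Full (alphabet L) δ) (S : Set (Language α)) : atomOf L S ∈ atoms L := by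
  rw [P.atomOf_eq, P.atoms_eq]
  obtain ⟨w, hw, e⟩ := h.exists_acceptingStates P.final_nonempty P.final_compl_nonempty
    (statesOf (alphabet L) δ F S)
  exact ⟨w, hw, by rw [e]⟩

theorem leftQuotient_pairLang {Γ : Set α} {X Y : Finset (Fin n)} {w : List α}
    (hw : w ∈ words Γ) : (pairLang Γ δ F X Y).leftQuotient w =
      pairLang Γ δ F (X.image fun q => w.foldl δ q) (Y.image fun q => w.foldl δ q) := by
  ext v
  simp [Language.mem_leftQuotient, mem_pairLang, hw]

end Unary


/-! ### Complexity of atoms. -/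

section AtomComplexity

/-- The pairs of disjoint non-empty sets of at most `k` and at most `l` states. -/
def disjointPairs (n k l : ℕ) : Finset (Finset (Fin n) × Finset (Fin n)) :=
  Finset.univ.filter fun p => Disjoint p.1 p.2 ∧ p.1.card ∈ Finset.Icc 1 k ∧
    p.2.card ∈ Finset.Icc 1 l

theorem card_disjointPairs (n k l : ℕ) : (disjointPairs n k l).card =
    ∑ x ∈ Finset.Icc 1 k, ∑ y ∈ Finset.Icc 1 l, n.choose x * (n - x).choose y := by
  rw [Finset.card_eq_sum_card_fiberwise (f := fun p => (p.1.card, p.2.card))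
    (t := Finset.Icc 1 k ×ˢ Finset.Icc 1 l), Finset.sum_product]
  · refine Finset.sum_congr rfl fun x hx => Finset.sum_congr rfl fun y hy => ?_
    have : (disjointPairs n k l).filter (fun p => (p.1.card, p.2.card) = (x, y)) =
        ((Finset.univ : Finset (Fin n)).powersetCard x).biUnion fun X =>
          (Xᶜ.powersetCard y).image fun Y => (X, Y) := by
      ext ⟨X, Y⟩
      simp only [disjointPairs, Finset.mem_filter, Finset.mem_univ, true_and, Prod.mk.injEq,
        Finset.mem_biUnion, Finset.mem_powersetCard, Finset.mem_image, Finset.subset_univ]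
      constructor
      · rintro ⟨⟨h1, -, -⟩, h2, h3⟩
        exact ⟨X, h2, Y, ⟨h1.symm.le_compl_right, h3⟩, rfl, rfl⟩
      · rintro ⟨X', h2, Y', ⟨h1, h3⟩, rfl, rfl⟩
        refine ⟨⟨(Finset.subset_compl_iff_disjoint_right.1 h1).symm, ?_, ?_⟩, h2, h3⟩
        · rwa [h2]
        · rwa [h3]
    rw [this, Finset.card_biUnion]
    · rw [Finset.sum_congr rfl (g := fun _ => (n - x).choose y), Finset.sum_const,
        Finset.card_powersetCard, Finset.card_univ, Fintype.card_fin, smul_eq_mul]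
      intro X hX
      rw [Finset.card_image_of_injective _ (Prod.mk_right_injective X), Finset.card_powersetCard,
        Finset.card_compl, (Finset.mem_powersetCard.1 hX).2, Fintype.card_fin]
    · intro X _ X' _ hne
      rw [Function.onFun, Finset.disjoint_left]
      simp only [Finset.mem_image, not_exists, not_and]
      rintro _ ⟨Y, -, rfl⟩ Y' - h
      exact hne (Prod.mk.inj h).1.symm
  · intro p hp
    exact Finset.mem_product.2 (Finset.mem_filter.1 hp).2.2

open Classical in
/-- The indices of the quotients of an atom: pairs of disjoint sets of states, of at most `k` and
at most `l` elements, and `none` for the empty quotient. -/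
noncomputable def atomIndex (n k l : ℕ) : Finset (Option (Finset (Fin n) × Finset (Fin n))) :=
  Finset.univ.filter fun o => match o with
    | none => k ≠ 0 ∧ l ≠ 0
    | some (X, Y) => Disjoint X Y ∧ X.card ≤ k ∧ Y.card ≤ l ∧ (k ≠ 0 → X.Nonempty) ∧
        (l ≠ 0 → Y.Nonempty)

theorem none_mem_atomIndex {n k l : ℕ} : none ∈ atomIndex n k l ↔ k ≠ 0 ∧ l ≠ 0 := by
  simp [atomIndex]

theorem some_mem_atomIndex {n k l : ℕ} {X Y : Finset (Fin n)} :
    some (X, Y) ∈ atomIndex n k l ↔ Disjoint X Y ∧ X.card ≤ k ∧ Y.card ≤ l ∧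
      (k ≠ 0 → X.Nonempty) ∧ (l ≠ 0 → Y.Nonempty) := by
  simp [atomIndex]

theorem card_filter_nonempty (n : ℕ) :
    ((Finset.univ : Finset (Finset (Fin n))).filter Finset.Nonempty).card = 2 ^ n - 1 := by
  have : (Finset.univ : Finset (Finset (Fin n))).filter Finset.Nonempty =
      Finset.univ.erase ∅ := by
    ext X
    simp [Finset.nonempty_iff_ne_empty]
  rw [this, Finset.card_erase_of_mem (Finset.mem_univ _)]
  simp

/-- For `k = 0` or `k = n` one component is forced to be empty, so the images never meet and `none`
is excluded; the other component is any non-empty set. Otherwise `none` contributes the summand `1`.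
-/
theorem card_atomIndex {n k : ℕ} (hn : 0 < n) (hk : k ≤ n) :
    (atomIndex n k (n - k)).card = atomBound n k := by
  rw [atomBound]
  rcases Nat.eq_zero_or_pos k with rfl | hk0
  · rw [if_pos (Or.inl rfl), ← card_filter_nonempty, ← Finset.card_image_of_injective _
      (f := fun Y : Finset (Fin n) => some ((∅ : Finset (Fin n)), Y)) (fun Y Y' h => by simpa using h)]
    congr 1
    ext o
    rcases o with _ | ⟨X, Y⟩
    · simp [none_mem_atomIndex]
    · rw [some_mem_atomIndex]
      have := Finset.card_le_univ Y
      simp only [Fintype.card_fin] at this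
      simp only [Finset.mem_image, Finset.mem_filter, Finset.mem_univ, true_and, Option.some.injEq,
        Prod.mk.injEq, nonpos_iff_eq_zero, Finset.card_eq_zero]
      constructor
      · rintro ⟨-, rfl, -, -, h⟩
        exact ⟨Y, h (by omega), rfl, rfl⟩
      · rintro ⟨Y', h, rfl, rfl⟩
        exact ⟨by simp, rfl, by omega, by simp, fun _ => h⟩
  · rcases hk.eq_or_lt with rfl | hkn
    · rw [if_pos (Or.inr rfl), ← card_filter_nonempty, ← Finset.card_image_of_injective _
        (f := fun X : Finset (Fin k) => some (X, (∅ : Finset (Fin k))))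
        (fun Y Y' h => by simpa using h)]
      congr 1
      ext o
      rcases o with _ | ⟨X, Y⟩
      · simp [none_mem_atomIndex]
      · rw [some_mem_atomIndex]
        have := Finset.card_le_univ X
        simp only [Fintype.card_fin] at this
        simp only [Finset.mem_image, Finset.mem_filter, Finset.mem_univ, true_and,
          Option.some.injEq, Prod.mk.injEq, Nat.sub_self, nonpos_iff_eq_zero, Finset.card_eq_zero]
        constructor
        · rintro ⟨-, -, rfl, h, -⟩
          exact ⟨X, h (by omega), rfl, rfl⟩
        · rintro ⟨X', h, rfl, rfl⟩
          exact ⟨by simp, this, rfl, fun _ => h, by simp⟩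
    · rw [if_neg (by omega), ← card_disjointPairs, add_comm, ← Finset.card_insertNone]
      congr 1
      ext o
      rcases o with _ | ⟨X, Y⟩
      · simp only [none_mem_atomIndex, Finset.none_mem_insertNone, iff_true]
        omega
      · rw [some_mem_atomIndex, Finset.some_mem_insertNone, disjointPairs]
        simp only [Finset.mem_filter, Finset.mem_univ, true_and, Finset.mem_Icc,
          Finset.one_le_card]
        have h1 : k ≠ 0 := by omega
        have h2 : n - k ≠ 0 := by omega
        simp only [ne_eq, h1, h2, not_false_eq_true, true_implies]
        tauto

variable {α : Type*} {n : ℕ} {L : Language α} {δ : Fin n → α → Fin n} {F : Set (Fin n)} {s : Fin n}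

/-- The quotients of an atom, indexed as in `atomIndex`. -/
def atomQuotient (Γ : Set α) (δ : Fin n → α → Fin n) (F : Set (Fin n)) :
    Option (Finset (Fin n) × Finset (Fin n)) → Language α
  | none => 0
  | some (X, Y) => pairLang Γ δ F X Y

theorem pairLang_eq_zero {Γ : Set α} {X Y : Finset (Fin n)} (h : ¬Disjoint X Y) :
    pairLang Γ δ F X Y = 0 := by
  obtain ⟨q, hX, hY⟩ := Finset.not_disjoint_iff.1 h
  ext w
  simp only [Language.notMem_zero, iff_false]
  rintro ⟨-, h1, h2⟩
  exact h2 q hY (h1 q hX)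

/-- A word replaces `T` and its complement by their images, which are no larger and stay non-empty
if they were; once the images meet, the conditions contradict each other and the quotient is empty.
-/
theorem complexity_pairLang_le (hn : 0 < n) (Γ : Set α) (δ : Fin n → α → Fin n)
    (F : Set (Fin n)) (T : Finset (Fin n)) :
    complexity (pairLang Γ δ F T Tᶜ) ≤ ((atomBound n T.card : ℕ) : ℕ∞) := by
  have hT : T.card ≤ n := by simpa using Finset.card_le_univ T
  rw [← card_atomIndex hn hT]
  refine complexity_le_of_finset _ (atomQuotient Γ δ F) fun w hw => ?_
  have hw' : w ∈ words Γ := words_mono (alphabet_subset fun v hv => hv.1) hw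
  rw [leftQuotient_pairLang hw']
  by_cases hd : Disjoint (T.image fun q => w.foldl δ q) (Tᶜ.image fun q => w.foldl δ q)
  · refine ⟨some (_, _), some_mem_atomIndex.2 ⟨hd, Finset.card_image_le, ?_, ?_, ?_⟩, rfl⟩
    · refine Finset.card_image_le.trans ?_
      simp [Finset.card_compl]
    · intro h
      exact (Finset.card_pos.1 (Nat.pos_of_ne_zero h)).image _
    · intro h
      refine (Finset.card_pos.1 ?_).image _
      rw [Finset.card_compl, Fintype.card_fin]
      exact Nat.pos_of_ne_zero h
  · refine ⟨none, none_mem_atomIndex.2 ?_, pairLang_eq_zero hd⟩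
    obtain ⟨q, hX, hY⟩ := Finset.not_disjoint_iff.1 hd
    have h1 := Finset.card_pos.2 (Finset.image_nonempty.1 ⟨q, hX⟩)
    have h2 := Finset.card_pos.2 (Finset.image_nonempty.1 ⟨q, hY⟩)
    rw [Finset.card_compl, Fintype.card_fin] at h2
    omega

/-- A constant letter would merge `T` with its complement and might not occur in the atom. A letter
that separates `p` and `q` does occur: first send `T` to `p` and the rest to `q`, and after the
letter send the two images to a final and a non-final state. -/
theorem Full.alphabet_pairLang {Γ : Set α} (h : Full Γ δ) (hF : F.Nonempty) (hF' : Fᶜ.Nonempty)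
    (hc : ∀ x ∈ Γ, ∃ p q, δ p x ≠ δ q x) (T : Finset (Fin n)) :
    alphabet (pairLang Γ δ F T Tᶜ) = Γ := by
  refine (alphabet_subset fun v hv => hv.1).antisymm fun x hx => ?_
  obtain ⟨p, q, hpq⟩ := hc x hx
  obtain ⟨f, hf⟩ := hF
  obtain ⟨g, hg⟩ := hF'
  obtain ⟨u, hu, eu⟩ := h fun i => if i ∈ T then p else q
  obtain ⟨v, hv, ev⟩ := h fun i => if i = δ p x then f else g
  refine ⟨u, v, mem_pairLang.2 ⟨by simp [hu, hv, hx], ?_, ?_⟩⟩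
  · intro i hi
    simp [eu, ev, hi, hf]
  · intro i hi
    rw [Finset.mem_compl] at hi
    simpa [eu, ev, hi, hpq.symm] using hg

theorem exists_image_eq {ι : Type*} [DecidableEq ι] {T X : Finset ι} (h : X.card ≤ T.card)
    (hX : T.Nonempty → X.Nonempty) : ∃ f : ι → ι, T.image f = X := by
  classical
  rcases T.eq_empty_or_nonempty with rfl | hT
  · refine ⟨id, ?_⟩
    have : X = ∅ := by simpa using h
    simp [this]
  · obtain ⟨x₀, hx₀⟩ := hX hT
    have : Nonempty X := ⟨⟨x₀, hx₀⟩⟩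
    -- A left inverse of an embedding of `X` into `T` maps `T` onto `X`.
    obtain ⟨e⟩ := Function.Embedding.nonempty_of_card_le (α := X) (β := T) (by simpa using h)
    refine ⟨fun q => if hq : q ∈ T then (Function.invFun e ⟨q, hq⟩).1 else q, ?_⟩
    ext y
    rw [Finset.mem_image]
    constructor
    · rintro ⟨q, hq, rfl⟩
      simp [hq]
    · intro hy
      refine ⟨(e ⟨y, hy⟩).1, (e ⟨y, hy⟩).2, ?_⟩
      simp [Function.leftInverse_invFun e.injective ⟨y, hy⟩]

/-- The words in `pairLang` for `(X, Y)` realize as accepting sets exactly the `Z` that contain `X`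
and avoid `Y`. So `X` and the complement of `Y` are recovered as the smallest and the largest such
set, and disjointness makes the language non-empty. -/
theorem Full.atomQuotient_injOn {Γ : Set α} (h : Full Γ δ) (hF : F.Nonempty)
    (hF' : Fᶜ.Nonempty) (k l : ℕ) : Set.InjOn (atomQuotient Γ δ F) (atomIndex n k l) := by
  have mem : ∀ X Y : Finset (Fin n), Disjoint X Y → ∀ Z, X ⊆ Z → Disjoint Y Z →
      ∃ w ∈ pairLang Γ δ F X Y, acceptingStates δ F w = Z := by
    intro X Y _ Z h1 h2
    obtain ⟨w, hw, e⟩ := h.exists_acceptingStates hF hF' Z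
    refine ⟨w, mem_pairLang.2 ⟨hw, fun q hq => ?_, fun q hq hq' => ?_⟩, e⟩
    · rw [← mem_acceptingStates, e]
      exact h1 hq
    · rw [← mem_acceptingStates, e] at hq'
      exact Finset.disjoint_left.1 h2 hq hq'
  have sub : ∀ X Y X' Y' : Finset (Fin n), Disjoint X Y →
      pairLang Γ δ F X Y = pairLang Γ δ F X' Y' → X' ⊆ X ∧ Y' ⊆ Y := by
    intro X Y X' Y' hd e
    constructor
    · obtain ⟨w, hw, ew⟩ := mem X Y hd X subset_rfl hd.symm
      rw [e] at hw
      intro q hq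
      rw [← ew, mem_acceptingStates]
      exact hw.2.1 q hq
    · obtain ⟨w, hw, ew⟩ := mem X Y hd Yᶜ hd.le_compl_right disjoint_compl_right
      rw [e] at hw
      intro q hq
      by_contra hY
      rw [← Finset.mem_compl, ← ew, mem_acceptingStates] at hY
      exact hw.2.2 q hq hY
  have ne : ∀ X Y : Finset (Fin n), Disjoint X Y → pairLang Γ δ F X Y ≠ 0 := by
    intro X Y hd h0
    obtain ⟨w, hw, -⟩ := mem X Y hd X subset_rfl hd.symm
    rw [h0] at hw
    exact hw
  rintro (_ | ⟨X, Y⟩) hi (_ | ⟨X', Y'⟩) hj e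
  · rfl
  · exact absurd e.symm (ne _ _ (some_mem_atomIndex.1 hj).1)
  · exact absurd e (ne _ _ (some_mem_atomIndex.1 hi).1)
  · have hd := (some_mem_atomIndex.1 hi).1
    have hd' := (some_mem_atomIndex.1 hj).1
    have h1 := sub _ _ _ _ hd e
    have h2 := sub _ _ _ _ hd' e.symm
    rw [h2.1.antisymm h1.1, h2.2.antisymm h1.2]

theorem Full.complexity_pairLang (hn : 0 < n) {Γ : Set α} (h : Full Γ δ) (hF : F.Nonempty)
    (hF' : Fᶜ.Nonempty) (hc : ∀ x ∈ Γ, ∃ p q, δ p x ≠ δ q x) (T : Finset (Fin n)) :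
    complexity (pairLang Γ δ F T Tᶜ) = ((atomBound n T.card : ℕ) : ℕ∞) := by
  refine le_antisymm (complexity_pairLang_le hn _ _ _ _) ?_
  have hT : T.card ≤ n := by simpa using Finset.card_le_univ T
  have hTc : Tᶜ.card = n - T.card := by simp [Finset.card_compl]
  rw [← card_atomIndex hn hT]
  refine le_complexity_of_finset _ (atomQuotient Γ δ F) (h.atomQuotient_injOn hF hF' _ _) ?_
  rw [h.alphabet_pairLang hF hF' hc]
  rintro (_ | ⟨X, Y⟩) hi
  · rw [none_mem_atomIndex, ← hTc, ← Nat.pos_iff_ne_zero, ← Nat.pos_iff_ne_zero,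
      Finset.card_pos, Finset.card_pos] at hi
    obtain ⟨⟨p, hp⟩, q, hq⟩ := hi
    -- A constant transformation merges `T` and its complement, which produces the empty quotient.
    obtain ⟨w, hw, e⟩ := h fun _ => p
    refine ⟨w, hw, ?_⟩
    rw [leftQuotient_pairLang hw]
    refine pairLang_eq_zero (Finset.not_disjoint_iff.2 ⟨p, ?_, ?_⟩)
    · exact Finset.mem_image.2 ⟨p, hp, e p⟩
    · exact Finset.mem_image.2 ⟨q, hq, e q⟩
  · obtain ⟨-, h1, h2, h3, h4⟩ := some_mem_atomIndex.1 hi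
    rw [← hTc] at h2 h4
    obtain ⟨f, hf⟩ := exists_image_eq h1 fun ⟨q, hq⟩ => h3 (Finset.card_ne_zero_of_mem hq)
    obtain ⟨g, hg⟩ := exists_image_eq h2 fun ⟨q, hq⟩ => h4 (Finset.card_ne_zero_of_mem hq)
    obtain ⟨w, hw, e⟩ := h fun q => if q ∈ T then f q else g q
    refine ⟨w, hw, ?_⟩
    rw [leftQuotient_pairLang hw, atomQuotient, ← hf, ← hg]
    congr 1
    · refine Finset.image_congr fun q hq => ?_
      rw [Finset.mem_coe] at hq
      simp [e, hq]
    · refine Finset.image_congr fun q hq => ?_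
      rw [Finset.mem_coe, Finset.mem_compl] at hq
      simp [e, hq]

theorem Presents.complexity_atomOf_le (hn : 0 < n) (P : Presents L δ F s)
    {S : Set (Language α)} (hS : S ⊆ quotients L) :
    complexity (atomOf L S) ≤ ((atomBound n S.ncard : ℕ) : ℕ∞) := by
  rw [P.atomOf_eq, ← P.card_statesOf hS]
  exact complexity_pairLang_le hn _ _ _ _

theorem Presents.complexity_atomOf [Nontrivial (Fin n)] (P : Presents L δ F s)
    (h : Full (alphabet L) δ) (hc : ∀ x ∈ alphabet L, ∃ p q, δ p x ≠ δ q x)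
    {S : Set (Language α)} (hS : S ⊆ quotients L) :
    complexity (atomOf L S) = ((atomBound n S.ncard : ℕ) : ℕ∞) := by
  rw [P.atomOf_eq, ← P.card_statesOf hS]
  exact h.complexity_pairLang (Fin.pos s) P.final_nonempty P.final_compl_nonempty hc _

end AtomComplexity


/-! ### Subset construction for the star and its upper bound. -/

section Star

variable {α : Type*} {n : ℕ} {L : Language α} {δ : Fin n → α → Fin n} {F : Set (Fin n)} {s : Fin n}

theorem cons_mem_kstar_iff {K : Language α} {x : α} {y : List α} :
    x :: y ∈ K∗ ↔ ∃ u v, y = u ++ v ∧ x :: u ∈ K ∧ v ∈ K∗ := by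
  constructor
  · intro h
    rw [Language.mem_kstar_iff_exists_nonempty] at h
    obtain ⟨_ | ⟨t, l⟩, hS, h⟩ := h
    · simp at hS
    · obtain ⟨ht, ht'⟩ := h t (by simp)
      cases t with
      | nil => exact absurd rfl ht'
      | cons z u =>
        simp only [List.flatten_cons, List.cons_append, List.cons.injEq] at hS
        obtain ⟨rfl, rfl⟩ := hS
        exact ⟨u, l.flatten, rfl, ht, Language.mem_kstar.2 ⟨l, rfl, fun z hz => (h z (by simp [hz])).1⟩⟩
  · rintro ⟨u, v, rfl, hu, hv⟩
    obtain ⟨l, rfl, hl⟩ := Language.mem_kstar.1 hv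
    exact Language.mem_kstar.2 ⟨(x :: u) :: l, by simp, by simpa [hu] using hl⟩

theorem append_mem_kstar {K : Language α} {u v : List α} (hu : u ∈ K) (hv : v ∈ K∗) :
    u ++ v ∈ K∗ := by
  obtain ⟨l, rfl, hl⟩ := Language.mem_kstar.1 hv
  exact Language.mem_kstar.2 ⟨u :: l, by simp, by simpa [hu] using hl⟩

theorem alphabet_kstar (K : Language α) : alphabet K∗ = alphabet K := by
  refine (alphabet_subset fun w hw => ?_).antisymm (alphabet_mono fun w hw => ?_)
  · obtain ⟨l, rfl, hl⟩ := Language.mem_kstar.1 hw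
    intro x hx
    obtain ⟨t, ht, hx⟩ := List.mem_flatten.1 hx
    exact mem_words_alphabet (hl t ht) x hx
  · simpa using append_mem_kstar hw (Language.nil_mem_kstar K)

/-- The words that lead from a state in `S` to acceptance by the automaton for the star. -/
def starLang (Γ : Set α) (δ : Fin n → α → Fin n) (F : Set (Fin n)) (s : Fin n)
    (S : Finset (Fin n)) : Language α :=
  {y : List α | ∃ q ∈ S, ∃ u v, y = u ++ v ∧ u ∈ runLang Γ δ F q ∧ v ∈ (runLang Γ δ F s)∗}

theorem mem_starLang {Γ : Set α} {S : Finset (Fin n)} {y : List α} :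
    y ∈ starLang Γ δ F s S ↔
      ∃ q ∈ S, ∃ u v, y = u ++ v ∧ u ∈ runLang Γ δ F q ∧ v ∈ (runLang Γ δ F s)∗ :=
  Iff.rfl

open Classical in
/-- The subset construction for the star. -/
noncomputable def starStep (δ : Fin n → α → Fin n) (F : Set (Fin n)) (s : Fin n)
    (S : Finset (Fin n)) (x : α) : Finset (Fin n) :=
  if ∃ q ∈ S, δ q x ∈ F then insert s (S.image fun q => δ q x) else S.image fun q => δ q x

theorem mem_starStep {S : Finset (Fin n)} {x : α} {r : Fin n} :
    r ∈ starStep δ F s S x ↔ (∃ q ∈ S, δ q x = r) ∨ r = s ∧ ∃ q ∈ S, δ q x ∈ F := by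
  rw [starStep]
  split_ifs with h
  · simp only [Finset.mem_insert, Finset.mem_image, h, and_true]
    exact or_comm
  · simp only [Finset.mem_image, h, and_false, or_false]

/-- A set of states that contains the initial state if it contains a final state. -/
def StarValid (F : Set (Fin n)) (s : Fin n) (S : Finset (Fin n)) : Prop :=
  S.Nonempty ∧ ((∃ q ∈ S, q ∈ F) → s ∈ S)

theorem starValid_singleton : StarValid F s {s} :=
  ⟨⟨s, by simp⟩, fun _ => by simp⟩

theorem StarValid.starStep {S : Finset (Fin n)} (h : StarValid F s S) (x : α) :
    StarValid F s (starStep δ F s S x) := by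
  obtain ⟨q, hq⟩ := h.1
  refine ⟨⟨δ q x, mem_starStep.2 (Or.inl ⟨q, hq, rfl⟩)⟩, ?_⟩
  rintro ⟨r, hr, hrF⟩
  rw [mem_starStep] at hr ⊢
  rcases hr with ⟨q, hq, rfl⟩ | ⟨-, h⟩
  · exact Or.inr ⟨rfl, q, hq, hrF⟩
  · exact Or.inr ⟨rfl, h⟩

theorem StarValid.foldl {S : Finset (Fin n)} (h : StarValid F s S) (w : List α) :
    StarValid F s (w.foldl (MostComplex.starStep δ F s) S) := by
  induction w generalizing S with
  | nil => exact h
  | cons x w ih => exact ih (h.starStep x)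

/-- If the current factor ends before `x`, then `S` contains a final state and, by validity, also
`s`; reading `x` as the start of a new factor is therefore a step from a state of `S`. -/
theorem cons_mem_starLang {Γ : Set α} {S : Finset (Fin n)} (hS : StarValid F s S) {x : α}
    (hx : x ∈ Γ) {y : List α} :
    x :: y ∈ starLang Γ δ F s S ↔ y ∈ starLang Γ δ F s (starStep δ F s S x) := by
  rw [mem_starLang, mem_starLang]
  constructor
  · rintro ⟨q, hq, u, v, e, hu, hv⟩
    cases u with
    | nil =>
      rw [List.nil_append] at e
      subst e
      obtain ⟨u, v, rfl, hu', hv⟩ := cons_mem_kstar_iff.1 hv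
      refine ⟨δ s x, mem_starStep.2 (Or.inl ⟨s, hS.2 ⟨q, hq, hu.2⟩, rfl⟩), u, v, rfl, ?_, hv⟩
      rw [mem_runLang] at hu' ⊢
      exact ⟨(cons_mem_words_iff.1 hu'.1).2, hu'.2⟩
    | cons z u =>
      rw [List.cons_append, List.cons.injEq] at e
      obtain ⟨rfl, rfl⟩ := e
      refine ⟨δ q x, mem_starStep.2 (Or.inl ⟨q, hq, rfl⟩), u, v, rfl, ?_, hv⟩
      rw [mem_runLang] at hu ⊢
      exact ⟨(cons_mem_words_iff.1 hu.1).2, hu.2⟩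
  · rintro ⟨r, hr, u, v, rfl, hu, hv⟩
    rcases mem_starStep.1 hr with ⟨q, hq, rfl⟩ | ⟨rfl, q, hq, hqF⟩
    · refine ⟨q, hq, x :: u, v, rfl, ?_, hv⟩
      exact ⟨cons_mem_words_iff.2 ⟨hx, hu.1⟩, hu.2⟩
    · exact ⟨q, hq, [x], u ++ v, rfl, ⟨by simpa using hx, hqF⟩, append_mem_kstar hu hv⟩

theorem append_mem_starLang {Γ : Set α} {S : Finset (Fin n)} (hS : StarValid F s S)
    {w : List α} (hw : w ∈ words Γ) {y : List α} :
    w ++ y ∈ starLang Γ δ F s S ↔ y ∈ starLang Γ δ F s (w.foldl (starStep δ F s) S) := by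
  induction w generalizing S with
  | nil => rfl
  | cons x w ih =>
    rw [cons_mem_words_iff] at hw
    rw [List.cons_append, cons_mem_starLang hS hw.1, ih (hS.starStep x) hw.2]
    rfl

/-- The star and the configuration `{s}` agree on non-empty words only: the star always contains the
empty word, the configuration does so only if `s` is final. Hence the star needs an initial state of
its own. -/
theorem cons_mem_kstar_iff_starLang {Γ : Set α} {x : α} {y : List α} :
    x :: y ∈ (runLang Γ δ F s)∗ ↔ x :: y ∈ starLang Γ δ F s {s} := by
  rw [cons_mem_kstar_iff, mem_starLang]
  constructor
  · rintro ⟨u, v, rfl, hu, hv⟩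
    exact ⟨s, by simp, x :: u, v, rfl, hu, hv⟩
  · rintro ⟨q, hq, u, v, e, hu, hv⟩
    rw [Finset.mem_singleton] at hq
    subst hq
    have := append_mem_kstar hu hv
    rw [← e] at this
    exact cons_mem_kstar_iff.1 this

theorem Presents.leftQuotient_kstar (P : Presents L δ F s) {w : List α}
    (hw : w ∈ words (alphabet L)) (h0 : w ≠ []) :
    L∗.leftQuotient w = starLang (alphabet L) δ F s (w.foldl (starStep δ F s) {s}) := by
  ext y
  rw [← append_mem_starLang starValid_singleton hw, Language.mem_leftQuotient]
  cases w with
  | nil => exact absurd rfl h0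
  | cons x w =>
    rw [List.cons_append, ← cons_mem_kstar_iff_starLang, ← P.eq]

/-- There are `2 ^ (n - 1)` sets containing `s`, and `2 ^ (n - 2)` sets containing neither `s` nor
`f`, the empty set among the latter. -/
theorem card_filter_imp {f s : Fin n} (h : f ≠ s) :
    ((Finset.univ : Finset (Finset (Fin n))).filter fun S => f ∈ S → s ∈ S).card =
      2 ^ (n - 1) + 2 ^ (n - 2) := by
  have e : ((Finset.univ : Finset (Finset (Fin n))).filter fun S => f ∈ S → s ∈ S) =
      (Finset.univ.erase s).powerset.image (insert s) ∪
        ((Finset.univ.erase s).erase f).powerset := by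
    ext S
    simp only [Finset.mem_filter, Finset.mem_univ, true_and, Finset.mem_union, Finset.mem_image,
      Finset.mem_powerset]
    constructor
    · intro hS
      by_cases hs : s ∈ S
      · exact Or.inl ⟨S.erase s, Finset.erase_subset_erase _ (Finset.subset_univ _),
          Finset.insert_erase hs⟩
      · refine Or.inr fun q hq => ?_
        simp only [Finset.mem_erase, Finset.mem_univ, and_true]
        exact ⟨fun e => hs (hS (e ▸ hq)), fun e => hs (e ▸ hq)⟩
    · rintro (⟨S, -, rfl⟩ | hS) hf
      · simp
      · exact absurd (hS hf) (by simp)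
  rw [e, Finset.card_union_of_disjoint, Finset.card_image_of_injOn, Finset.card_powerset,
    Finset.card_powerset, Finset.card_erase_of_mem, Finset.card_erase_of_mem, Finset.card_erase_of_mem, Finset.card_univ,
    Fintype.card_fin]
  · rfl
  · simp
  · simpa using h
  · simp
  · intro S hS T hT e
    simp only [Finset.coe_powerset, Set.mem_preimage, Set.mem_powerset_iff, Finset.coe_subset] at hS hT
    have hS' : s ∉ S := fun h => by simpa using hS h
    have hT' : s ∉ T := fun h => by simpa using hT h
    rw [← Finset.erase_insert hS', ← Finset.erase_insert hT']
    exact congrArg (fun X => Finset.erase X s) e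
  · rw [Finset.disjoint_left]
    rintro _ hS hS'
    obtain ⟨S, -, rfl⟩ := Finset.mem_image.1 hS
    have := Finset.mem_powerset.1 hS' (Finset.mem_insert_self s S)
    simp at this

theorem Presents.complexity_kstar_le (hn : 3 ≤ n) (P : Presents L δ F s) :
    complexity L∗ ≤ ((2 ^ (n - 1) + 2 ^ (n - 2) : ℕ) : ℕ∞) := by
  by_cases hF : ∃ f ∈ F, f ≠ s
  · obtain ⟨f, hf, hfs⟩ := hF
    rw [← card_filter_imp hfs]
    refine complexity_le_of_finset _
      -- Reached configurations are non-empty, so the index `∅` is free to encode the quotient by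
      -- the empty word.
      (fun S => if S = ∅ then L∗ else starLang (alphabet L) δ F s S) fun w hw => ?_
    rw [alphabet_kstar] at hw
    by_cases h0 : w = []
    · exact ⟨∅, by simp, by simp [h0]⟩
    · have hv := (starValid_singleton (F := F) (s := s)).foldl (δ := δ) w
      refine ⟨w.foldl (starStep δ F s) {s}, ?_, ?_⟩
      · simp only [Finset.mem_filter, Finset.mem_univ, true_and]
        exact fun h => hv.2 ⟨f, h, hf⟩
      · simp only [hv.1.ne_empty, if_false]
        exact P.leftQuotient_kstar hw h0
  -- If no state other than `s` is final, the set never grows beyond a singleton, and there are at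
  -- most `n + 1` quotients.
  · push Not at hF
    have hs : ∀ w : List α, ∃ q, w.foldl (starStep δ F s) {s} = {q} := by
      intro w
      have : ∀ p, ∃ q, w.foldl (starStep δ F s) {p} = {q} := by
        induction w with
        | nil => exact fun p => ⟨p, rfl⟩
        | cons x w ih =>
          intro p
          have : starStep δ F s {p} x = {δ p x} := by
            ext r
            rw [mem_starStep]
            simp only [Finset.mem_singleton, exists_eq_left]
            constructor
            · rintro (h | ⟨rfl, h⟩)
              · exact h.symm
              · exact (hF _ h).symm
            · exact fun h => Or.inl h.symm
          rw [List.foldl_cons, this]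
          exact ih _
      exact this s
    have := complexity_le_of_finset (L := L∗) (Finset.univ : Finset (Option (Fin n)))
      (fun o => o.elim L∗ fun q => starLang (alphabet L) δ F s {q}) (fun w hw => by
        rw [alphabet_kstar] at hw
        by_cases h0 : w = []
        · exact ⟨none, by simp, by simp [h0]⟩
        · obtain ⟨q, hq⟩ := hs w
          refine ⟨some q, by simp, ?_⟩
          rw [P.leftQuotient_kstar hw h0, hq]
          rfl)
    refine this.trans ?_
    simp only [Finset.card_univ, Fintype.card_option, Fintype.card_fin]
    norm_cast
    obtain ⟨k, rfl⟩ := Nat.exists_eq_add_of_le hn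
    have h2 : 3 + k - 2 = k + 1 := by omega
    have h1 : 3 + k - 1 = k + 2 := by omega
    rw [h1, h2, pow_succ, pow_succ]
    have := Nat.lt_two_pow_self (n := k)
    omega

end Star


/-! ### Completed automata: upper bounds for boolean operations and product, and the need for four
letters. -/

section Boolean

variable {α σ : Type*}

open Classical in
/-- The transitions of an automaton over `Γ`, completed by the empty state `none`. -/
noncomputable def optStep (Γ : Set α) (δ : σ → α → σ) (o : Option σ) (x : α) : Option σ :=
  if x ∈ Γ then o.map fun q => δ q x else none

/-- The language of a state of the completed automaton. -/
def optLang (Γ : Set α) (δ : σ → α → σ) (F : Set σ) (o : Option σ) : Language α :=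
  o.elim 0 (runLang Γ δ F)

variable {Γ : Set α} {δ : σ → α → σ} {F : Set σ}

@[simp]
theorem optLang_some {q : σ} : optLang Γ δ F (some q) = runLang Γ δ F q := rfl

@[simp]
theorem notMem_optLang_none {w : List α} : w ∉ optLang Γ δ F none := id

theorem cons_mem_optLang {o : Option σ} {x : α} {y : List α} :
    x :: y ∈ optLang Γ δ F o ↔ y ∈ optLang Γ δ F (optStep Γ δ o x) := by
  rw [optStep]
  cases o with
  | none => split_ifs <;> exact Iff.rfl
  | some q =>
    split_ifs with h
    · simp [mem_runLang, h]
    · simp [mem_runLang, h]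

theorem leftQuotient_optLang (o : Option σ) (w : List α) :
    (optLang Γ δ F o).leftQuotient w = optLang Γ δ F (w.foldl (optStep Γ δ) o) := by
  induction w generalizing o with
  | nil => rfl
  | cons x w ih =>
    rw [List.foldl_cons, ← ih]
    ext y
    rw [Language.mem_leftQuotient, Language.mem_leftQuotient, List.cons_append, cons_mem_optLang]

theorem foldl_optStep_some {q : σ} {w : List α} (hw : w ∈ words Γ) :
    w.foldl (optStep Γ δ) (some q) = some (w.foldl δ q) := by
  induction w generalizing q with
  | nil => rfl
  | cons x w ih =>
    rw [cons_mem_words_iff] at hw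
    rw [List.foldl_cons, List.foldl_cons, ← ih hw.2]
    simp [optStep, hw.1]

@[simp]
theorem optStep_none {x : α} : optStep Γ δ none x = none := by
  simp [optStep]

@[simp]
theorem foldl_optStep_none {w : List α} : w.foldl (optStep Γ δ) none = none := by
  induction w with
  | nil => rfl
  | cons x w ih => rw [List.foldl_cons, optStep_none, ih]

theorem foldl_optStep_eq_none {o : Option σ} {w : List α} (hw : w ∉ words Γ) :
    w.foldl (optStep Γ δ) o = none := by
  induction w generalizing o with
  | nil => simp at hw
  | cons x w ih =>
    rw [List.foldl_cons]
    by_cases hx : x ∈ Γ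
    · exact ih fun h => hw (by simp [hx, h])
    · simp [optStep, hx]

theorem Presents.leftQuotient_eq_optLang {L : Language α} {s : σ} (P : Presents L δ F s)
    (w : List α) :
    L.leftQuotient w = optLang (alphabet L) δ F (w.foldl (optStep (alphabet L) δ) (some s)) := by
  rw [← leftQuotient_optLang, optLang_some, ← P.eq]

/-- A minimal automaton may already have a state with empty language, which would coincide with the
added sink; the hypothesis that every state leads to a final one rules this out. -/
theorem Presents.optLang_injective {L : Language α} {s : σ} (P : Presents L δ F s)
    (h : ∀ q, ∃ w ∈ words (alphabet L), w.foldl δ q ∈ F) :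
    Function.Injective (optLang (alphabet L) δ F) := by
  have h0 : ∀ q, optLang (alphabet L) δ F (some q) ≠ optLang (alphabet L) δ F none := by
    intro q e
    obtain ⟨w, hw, hF⟩ := h q
    have : w ∈ optLang (alphabet L) δ F (some q) := ⟨hw, hF⟩
    rw [e] at this
    exact this
  rintro (_ | p) (_ | q) e
  · rfl
  · exact absurd e.symm (h0 q)
  · exact absurd e (h0 p)
  · rw [P.inj e]

variable {m n : ℕ} {L' L : Language α} {δ' : Fin m → α → Fin m} {δ : Fin n → α → Fin n}
  {F' : Set (Fin m)} {F : Set (Fin n)} {s' : Fin m} {s : Fin n}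

theorem alphabet_sup (L' L : Language α) : alphabet (L' ⊔ L) = alphabet L' ∪ alphabet L := by
  refine (alphabet_subset fun w hw => ?_).antisymm (Set.union_subset (alphabet_mono fun w hw => ?_)
    (alphabet_mono fun w hw => ?_))
  · rcases hw with h | h
    · exact words_mono Set.subset_union_left (mem_words_alphabet h)
    · exact words_mono Set.subset_union_right (mem_words_alphabet h)
  · exact Or.inl hw
  · exact Or.inr hw

theorem complexity_sup_le (P' : Presents L' δ' F' s') (P : Presents L δ F s) :
    complexity (L' ⊔ L) ≤ ((m * n + m + n + 1 : ℕ) : ℕ∞) := by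
  have := complexity_le_of_finset (L := L' ⊔ L)
    (Finset.univ : Finset (Option (Fin m) × Option (Fin n)))
    (fun t => optLang (alphabet L') δ' F' t.1 ⊔ optLang (alphabet L) δ F t.2) (fun w _ =>
      ⟨(_, _), Finset.mem_univ _, by
        change L'.leftQuotient w ⊔ L.leftQuotient w = _
        rw [P'.leftQuotient_eq_optLang, P.leftQuotient_eq_optLang]⟩)
  refine this.trans (le_of_eq ?_)
  simp only [Finset.card_univ, Fintype.card_prod, Fintype.card_option, Fintype.card_fin]
  congr 1
  ring

theorem complexity_symmDiff_le (P' : Presents L' δ' F' s') (P : Presents L δ F s) :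
    complexity (symmDiff L' L) ≤ ((m * n + m + n + 1 : ℕ) : ℕ∞) := by
  have := complexity_le_of_finset (L := symmDiff L' L)
    (Finset.univ : Finset (Option (Fin m) × Option (Fin n)))
    (fun t => symmDiff (optLang (alphabet L') δ' F' t.1) (optLang (alphabet L) δ F t.2)) (fun w _ =>
      ⟨(_, _), Finset.mem_univ _, by
        change symmDiff (L'.leftQuotient w) (L.leftQuotient w) = _
        rw [P'.leftQuotient_eq_optLang, P.leftQuotient_eq_optLang]⟩)
  refine this.trans (le_of_eq ?_)
  simp only [Finset.card_univ, Fintype.card_prod, Fintype.card_option, Fintype.card_fin]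
  congr 1
  ring

/-- Quotients are taken over the alphabet of the difference, which lies inside that of `L'`. So the
first component never enters its sink, whereas the second may. -/
theorem complexity_sdiff_le (P' : Presents L' δ' F' s') (P : Presents L δ F s) :
    complexity (L' \ L) ≤ ((m * n + m : ℕ) : ℕ∞) := by
  have := complexity_le_of_finset (L := L' \ L)
    (Finset.univ : Finset (Fin m × Option (Fin n)))
    (fun t => runLang (alphabet L') δ' F' t.1 \ optLang (alphabet L) δ F t.2) (fun w hw =>
      ⟨(_, _), Finset.mem_univ _, by
        change L'.leftQuotient w \ L.leftQuotient w = _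
        rw [P'.leftQuotient (words_mono (alphabet_mono fun v hv => hv.1) hw),
          P.leftQuotient_eq_optLang]⟩)
  refine this.trans (le_of_eq ?_)
  simp only [Finset.card_univ, Fintype.card_prod, Fintype.card_option, Fintype.card_fin]
  congr 1

theorem complexity_inf_le (P' : Presents L' δ' F' s') (P : Presents L δ F s) :
    complexity (L' ⊓ L) ≤ ((m * n : ℕ) : ℕ∞) := by
  have := complexity_le_of_finset (L := L' ⊓ L)
    (Finset.univ : Finset (Fin m × Fin n))
    (fun t => runLang (alphabet L') δ' F' t.1 ⊓ runLang (alphabet L) δ F t.2) (fun w hw =>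
      ⟨(_, _), Finset.mem_univ _, by
        change L'.leftQuotient w ⊓ L.leftQuotient w = _
        rw [P'.leftQuotient (words_mono (alphabet_mono fun v hv => hv.1) hw),
          P.leftQuotient (words_mono (alphabet_mono fun v hv => hv.2) hw)]⟩)
  refine this.trans (le_of_eq ?_)
  simp only [Finset.card_univ, Fintype.card_prod, Fintype.card_fin]

/-! ### Two alphabets with fewer than four letters in total -/

/-- If the joint orbit covered all pairs, both components would be periodic with minimal period `n`.
Then whenever the first returns to `a`, the second is back at `b`, and `(a, q)` with `q ≠ b` is
missed. -/
theorem exists_pair_not_mem_orbit (hn : 2 ≤ n) (f g : Fin n → Fin n) (a b : Fin n) :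
    ∃ p q, ∀ k, ¬(f^[k] a = p ∧ g^[k] b = q) := by
  by_contra! h
  have : Nontrivial (Fin n) := Fin.nontrivial_iff_two_le.2 hn
  have key : ∀ (f g : Fin n → Fin n) (a b : Fin n), (∀ p q, ∃ k, f^[k] a = p ∧ g^[k] b = q) →
      Function.minimalPeriod f a = n := by
    intro f g a b h
    obtain ⟨q, hq⟩ := exists_ne b
    obtain ⟨k, hk, hk'⟩ := h a q
    have hk0 : 0 < k := Nat.pos_of_ne_zero fun h0 => hq (by rw [← hk', h0]; rfl)
    have hp : 0 < Function.minimalPeriod f a :=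
      Function.minimalPeriod_pos_of_mem_periodicPts ⟨k, hk0, hk⟩
    have hb : Function.Bijective fun i : Fin (Function.minimalPeriod f a) => f^[i] a := by
      constructor
      · intro i j e
        exact Fin.ext (Function.iterate_injOn_Iio_minimalPeriod i.2 j.2 e)
      · intro p
        obtain ⟨k, hk, -⟩ := h p b
        refine ⟨⟨k % Function.minimalPeriod f a, Nat.mod_lt _ hp⟩, ?_⟩
        rw [← hk]
        exact Function.iterate_mod_minimalPeriod_eq
    simpa using Fintype.card_of_bijective hb
  have hf := key f g a b h
  have hg := key g f b a fun p q => by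
    obtain ⟨k, h1, h2⟩ := h q p
    exact ⟨k, h2, h1⟩
  obtain ⟨q, hq⟩ := exists_ne b
  obtain ⟨k, hk, hk'⟩ := h a q
  have h1 : Function.minimalPeriod f a ∣ k := Function.IsPeriodicPt.minimalPeriod_dvd hk
  rw [hf, ← hg] at h1
  exact hq (hk'.symm.trans ((Function.isPeriodicPt_minimalPeriod g b).trans_dvd h1))

theorem exists_iterate_of_subsingleton {Γ : Set α} (h : Γ.Subsingleton) (δ' : Fin m → α → Fin m)
    (δ : Fin n → α → Fin n) : ∃ (f : Fin m → Fin m) (g : Fin n → Fin n), ∀ w ∈ words Γ,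
      ∃ k, (∀ p, w.foldl δ' p = f^[k] p) ∧ ∀ q, w.foldl δ q = g^[k] q := by
  rcases Γ.eq_empty_or_nonempty with rfl | ⟨x, hx⟩
  · refine ⟨id, id, fun w hw => ⟨0, ?_⟩⟩
    cases w with
    | nil => simp
    | cons x w => exact absurd (hw x (by simp)) (by simp)
  · refine ⟨fun p => δ' p x, fun q => δ q x, fun w hw => ⟨w.length, ?_⟩⟩
    induction w with
    | nil => simp
    | cons y w ih =>
      rw [cons_mem_words_iff] at hw
      rw [h hw.1 hx]
      simp [ih hw.2]

/-- The bound requires every pair of completed states to be reached. Pairs with exactly one sink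
force a private letter on each side. With fewer than four letters at most one is shared, and the
pairs without sinks are then reached only by its powers. -/
theorem four_le_encard_alphabet {L' L : Language α} {δ' δ : Fin n → α → Fin n}
    {F' F : Set (Fin n)} {s' s : Fin n} (hn : 2 ≤ n) (P' : Presents L' δ' F' s')
    (P : Presents L δ F s)
    (h : complexity (L' ⊔ L) = ((n * n + n + n + 1 : ℕ) : ℕ∞)) :
    4 ≤ (alphabet L' ∪ alphabet L).encard := by
  by_contra hlt
  have hmiss : ∃ t : Option (Fin n) × Option (Fin n), ∀ w ∈ words (alphabet L' ∪ alphabet L),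
      (w.foldl (optStep (alphabet L') δ') (some s'),
        w.foldl (optStep (alphabet L) δ) (some s)) ≠ t := by
    by_cases h1 : alphabet L' ⊆ alphabet L
    · refine ⟨(some s', none), fun w hw e => ?_⟩
      rw [Set.union_eq_self_of_subset_left h1] at hw
      rw [foldl_optStep_some hw] at e
      simp at e
    by_cases h2 : alphabet L ⊆ alphabet L'
    · refine ⟨(none, some s), fun w hw e => ?_⟩
      rw [Set.union_eq_self_of_subset_right h2] at hw
      rw [foldl_optStep_some hw] at e
      simp at e
    obtain ⟨x, hx', hx⟩ := Set.not_subset.1 h1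
    obtain ⟨y, hy, hy'⟩ := Set.not_subset.1 h2
    have hsub : (alphabet L' ∩ alphabet L).Subsingleton := by
      intro a ha b hb
      by_contra hab
      refine hlt ?_
      have h4 : ({x, y, a, b} : Set α).encard = 4 := by
        rw [Set.encard_insert_of_notMem, Set.encard_insert_of_notMem, Set.encard_pair hab]
        · norm_num
        · rintro (rfl | rfl)
          · exact hy' ha.1
          · exact hy' hb.1
        · rintro (rfl | rfl | rfl)
          · exact hx hy
          · exact hx ha.2
          · exact hx hb.2
      rw [← h4]
      refine Set.encard_le_encard ?_
      rintro z (rfl | rfl | rfl | rfl)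
      · exact Or.inl hx'
      · exact Or.inr hy
      · exact Or.inl ha.1
      · exact Or.inl hb.1
    obtain ⟨f, g, hfg⟩ := exists_iterate_of_subsingleton hsub δ' δ
    obtain ⟨p, q, hpq⟩ := exists_pair_not_mem_orbit hn f g s' s
    refine ⟨(some p, some q), fun w hw e => ?_⟩
    rw [Prod.mk.injEq] at e
    have hw' : w ∈ words (alphabet L') := by
      by_contra hw'
      rw [foldl_optStep_eq_none hw'] at e
      simp at e
    have hw'' : w ∈ words (alphabet L) := by
      by_contra hw'
      rw [foldl_optStep_eq_none hw'] at e
      simp at e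
    rw [foldl_optStep_some hw', foldl_optStep_some hw'', Option.some.injEq, Option.some.injEq] at e
    obtain ⟨k, h1, h2⟩ := hfg w fun z hz => ⟨hw' z hz, hw'' z hz⟩
    exact hpq k ⟨(h1 s').symm.trans e.1, (h2 s).symm.trans e.2⟩
  obtain ⟨t, ht⟩ := hmiss
  have := complexity_le_of_finset (L := L' ⊔ L) (Finset.univ.erase t)
    (fun t => optLang (alphabet L') δ' F' t.1 ⊔ optLang (alphabet L) δ F t.2) (fun w hw =>
      ⟨(_, _), Finset.mem_erase.2 ⟨ht w (by rwa [alphabet_sup] at hw), Finset.mem_univ _⟩, by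
        change L'.leftQuotient w ⊔ L.leftQuotient w = _
        rw [P'.leftQuotient_eq_optLang, P.leftQuotient_eq_optLang]⟩)
  rw [h, Finset.card_erase_of_mem (Finset.mem_univ _)] at this
  simp only [Finset.card_univ, Fintype.card_prod, Fintype.card_option, Fintype.card_fin,
    Nat.cast_le] at this
  have e : (n + 1) * (n + 1) = n * n + n + n + 1 := by ring
  omega

/-! ### Product -/

open Classical in
/-- The subset construction for the product. -/
noncomputable def prodStep (Γ' : Set α) (δ' : Fin m → α → Fin m) (F' : Set (Fin m)) (Γ : Set α)
    (δ : Fin n → α → Fin n) (s : Fin n) (t : Option (Fin m) × Finset (Fin n)) (x : α) :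
    Option (Fin m) × Finset (Fin n) :=
  (optStep Γ' δ' t.1 x,
    (if x ∈ Γ then t.2.image fun q => δ q x else ∅) ∪
      if ∃ p ∈ F', optStep Γ' δ' t.1 x = some p then {s} else ∅)

/-- The language of a state of the automaton for the product. -/
def prodLang (Γ' : Set α) (δ' : Fin m → α → Fin m) (F' : Set (Fin m)) (Γ : Set α)
    (δ : Fin n → α → Fin n) (F : Set (Fin n)) (s : Fin n)
    (t : Option (Fin m) × Finset (Fin n)) : Language α :=
  {y : List α | y ∈ optLang Γ' δ' F' t.1 * runLang Γ δ F s ∨ ∃ q ∈ t.2, y ∈ runLang Γ δ F q}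

theorem mem_prodLang {Γ' Γ : Set α} {t : Option (Fin m) × Finset (Fin n)} {y : List α} :
    y ∈ prodLang Γ' δ' F' Γ δ F s t ↔
      y ∈ optLang Γ' δ' F' t.1 * runLang Γ δ F s ∨ ∃ q ∈ t.2, y ∈ runLang Γ δ F q :=
  Iff.rfl

theorem mem_prodStep_snd {Γ' Γ : Set α} {t : Option (Fin m) × Finset (Fin n)} {x : α} {r : Fin n} :
    r ∈ (prodStep Γ' δ' F' Γ δ s t x).2 ↔ (x ∈ Γ ∧ ∃ q ∈ t.2, δ q x = r) ∨
      r = s ∧ ∃ p ∈ F', optStep Γ' δ' t.1 x = some p := by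
  simp only [prodStep, Finset.mem_union]
  split_ifs with h1 h2 h2 <;> simp only [Finset.mem_image, Finset.mem_singleton, h1, h2, true_and,
    and_true, false_and, and_false, Finset.notMem_empty]

/-- A state of the automaton for the product that contains the initial state of the second factor
if its first component is final. -/
def ProdValid (F' : Set (Fin m)) (s : Fin n) (t : Option (Fin m) × Finset (Fin n)) : Prop :=
  ∀ p ∈ F', t.1 = some p → s ∈ t.2

theorem prodValid_prodStep {Γ' Γ : Set α} (t : Option (Fin m) × Finset (Fin n)) (x : α) :
    ProdValid F' s (prodStep Γ' δ' F' Γ δ s t x) :=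
  fun p hp e => mem_prodStep_snd.2 (Or.inr ⟨rfl, p, hp, e⟩)

theorem ProdValid.foldl {Γ' Γ : Set α} {t : Option (Fin m) × Finset (Fin n)}
    (ht : ProdValid F' s t) (w : List α) :
    ProdValid F' s (w.foldl (prodStep Γ' δ' F' Γ δ s) t) := by
  induction w generalizing t with
  | nil => exact ht
  | cons x w ih => exact ih (prodValid_prodStep t x)

/-- If the first factor contributes the empty word, its state is final, so validity puts `s` in the
set and `x` is read by the second automaton from there. -/
theorem cons_mem_prodLang {Γ' Γ : Set α} {t : Option (Fin m) × Finset (Fin n)}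
    (ht : ProdValid F' s t) {x : α} {y : List α} :
    x :: y ∈ prodLang Γ' δ' F' Γ δ F s t ↔
      y ∈ prodLang Γ' δ' F' Γ δ F s (prodStep Γ' δ' F' Γ δ s t x) := by
  rw [mem_prodLang, mem_prodLang, Language.mem_mul, Language.mem_mul]
  constructor
  · rintro (⟨u, hu, v, hv, e⟩ | ⟨q, hq, hy⟩)
    · cases u with
      | nil =>
        rw [List.nil_append] at e
        subst e
        have hs : s ∈ t.2 := by
          rcases t with ⟨_ | p, S⟩
          · exact absurd hu notMem_optLang_none
          · exact ht p hu.2 rfl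
        rw [mem_runLang, cons_mem_words_iff] at hv
        exact Or.inr ⟨_, mem_prodStep_snd.2 (Or.inl ⟨hv.1.1, s, hs, rfl⟩), hv.1.2, hv.2⟩
      | cons z u =>
        rw [List.cons_append, List.cons.injEq] at e
        obtain ⟨rfl, rfl⟩ := e
        exact Or.inl ⟨u, cons_mem_optLang.1 hu, v, hv, rfl⟩
    · rw [mem_runLang, cons_mem_words_iff] at hy
      exact Or.inr ⟨_, mem_prodStep_snd.2 (Or.inl ⟨hy.1.1, q, hq, rfl⟩), hy.1.2, hy.2⟩
  · rintro (⟨u, hu, v, hv, rfl⟩ | ⟨q, hq, hy⟩)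
    · exact Or.inl ⟨x :: u, cons_mem_optLang.2 hu, v, hv, rfl⟩
    · rcases mem_prodStep_snd.1 hq with ⟨hx, r, hr, rfl⟩ | ⟨rfl, p, hp, e⟩
      · exact Or.inr ⟨r, hr, by simp [hx, hy.1], hy.2⟩
      · refine Or.inl ⟨[x], cons_mem_optLang.2 ?_, y, hy, rfl⟩
        rw [e]
        exact ⟨nil_mem_words, hp⟩

theorem leftQuotient_prodLang {Γ' Γ : Set α} {t : Option (Fin m) × Finset (Fin n)}
    (ht : ProdValid F' s t) (w : List α) :
    (prodLang Γ' δ' F' Γ δ F s t).leftQuotient w =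
      prodLang Γ' δ' F' Γ δ F s (w.foldl (prodStep Γ' δ' F' Γ δ s) t) := by
  induction w generalizing t with
  | nil => rfl
  | cons x w ih =>
    rw [List.foldl_cons, ← ih (prodValid_prodStep t x)]
    ext y
    rw [Language.mem_leftQuotient, Language.mem_leftQuotient, List.cons_append,
      cons_mem_prodLang ht]

open Classical in
/-- The initial state of the automaton for the product. -/
noncomputable def prodStart (F' : Set (Fin m)) (s' : Fin m) (s : Fin n) :
    Option (Fin m) × Finset (Fin n) :=
  (some s', if s' ∈ F' then {s} else ∅)

theorem prodValid_prodStart : ProdValid F' s (prodStart F' s' s) := by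
  rintro p hp e
  rw [prodStart, Option.some.injEq] at e
  subst e
  simp [prodStart, hp]

theorem leftQuotient_mul (P' : Presents L' δ' F' s') (P : Presents L δ F s) (w : List α) :
    (L' * L).leftQuotient w = prodLang (alphabet L') δ' F' (alphabet L) δ F s
      (w.foldl (prodStep (alphabet L') δ' F' (alphabet L) δ s) (prodStart F' s' s)) := by
  rw [← leftQuotient_prodLang prodValid_prodStart]
  congr 1
  ext y
  rw [mem_prodLang]
  have e : optLang (alphabet L') δ' F' (prodStart F' s' s).1 * runLang (alphabet L) δ F s =
      L' * L := by
    rw [prodStart, optLang_some, ← P'.eq, ← P.eq]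
  rw [e]
  refine ⟨Or.inl, ?_⟩
  rintro (h | ⟨q, hq, hy⟩)
  · exact h
  · rw [prodStart] at hq
    by_cases hs : s' ∈ F'
    · rw [if_pos hs, Finset.mem_singleton] at hq
      subst hq
      rw [← P.eq] at hy
      exact ⟨[], P'.mem_iff.2 ⟨nil_mem_words, hs⟩, y, hy, rfl⟩
    · rw [if_neg hs] at hq
      simp at hq

open Classical in
theorem card_filter_prodValid (f : Fin m) (s : Fin n) :
    ((Finset.univ : Finset (Option (Fin m) × Finset (Fin n))).filter
      fun t => ProdValid {f} s t).card = m * 2 ^ n + 2 ^ (n - 1) := by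
  have e : (Finset.univ : Finset (Option (Fin m) × Finset (Fin n))).filter
      (fun t => ProdValid {f} s t) = ((Finset.univ.erase (some f)) ×ˢ Finset.univ) ∪
        ((Finset.univ.erase s).powerset.image fun S => (some f, insert s S)) := by
    ext ⟨o, S⟩
    simp only [ProdValid, Finset.mem_filter, Finset.mem_univ, true_and, Set.mem_singleton_iff,
      forall_eq, Finset.mem_union, Finset.mem_product, Finset.mem_erase, and_true,
      Finset.mem_image, Finset.mem_powerset, Prod.mk.injEq]
    constructor
    · intro h
      by_cases ho : o = some f
      · exact Or.inr ⟨S.erase s, Finset.erase_subset_erase _ (Finset.subset_univ _), ho.symm,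
          Finset.insert_erase (h ho)⟩
      · exact Or.inl ho
    · rintro (h | ⟨S, -, rfl, rfl⟩)
      · exact fun h' => absurd h' h
      · simp
  rw [e, Finset.card_union_of_disjoint, Finset.card_product, Finset.card_image_of_injOn,
    Finset.card_powerset, Finset.card_erase_of_mem, Finset.card_erase_of_mem]
  · simp
  · simp
  · simp
  · intro S hS T hT e
    simp only [Finset.coe_powerset, Set.mem_preimage, Set.mem_powerset_iff, Finset.coe_subset] at hS hT
    have hS' : s ∉ S := fun h => by simpa using hS h
    have hT' : s ∉ T := fun h => by simpa using hT h
    rw [← Finset.erase_insert hS', ← Finset.erase_insert hT']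
    exact congrArg (fun X => Finset.erase X s) (Prod.mk.inj e).2
  · rw [Finset.disjoint_left]
    rintro _ hS hS'
    obtain ⟨S, -, rfl⟩ := Finset.mem_image.1 hS'
    simp at hS

/-- One final state `f` of the first factor suffices for the count, because further final states
only restrict the configurations. It exists since two inequivalent states cannot both have empty
language. -/
theorem complexity_mul_le (hm : 2 ≤ m) (P' : Presents L' δ' F' s') (P : Presents L δ F s) :
    complexity (L' * L) ≤ ((m * 2 ^ n + 2 ^ (n - 1) : ℕ) : ℕ∞) := by
  classical
  have : Nontrivial (Fin m) := Fin.nontrivial_iff_two_le.2 hm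
  obtain ⟨f, hf⟩ := P'.final_nonempty
  rw [← card_filter_prodValid f s]
  refine complexity_le_of_finset _ (prodLang (alphabet L') δ' F' (alphabet L) δ F s)
    fun w _ => ⟨_, ?_, leftQuotient_mul P' P w⟩
  simp only [Finset.mem_filter, Finset.mem_univ, true_and]
  rintro p rfl e
  exact prodValid_prodStart.foldl w p hf e

end Boolean


/-! ### The witness automata, their dialects, and generation of all transformations. -/

section Witness

variable {n : ℕ}

theorem val_finRotate (q : Fin n) :
    (finRotate n q).val = if q.val + 1 = n then 0 else q.val + 1 := by
  cases n with
  | zero => exact q.elim0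
  | succ n =>
    rw [coe_finRotate]
    simp only [Fin.ext_iff, Fin.val_last, Nat.add_right_cancel_iff]

theorem val_finRotate_symm (q : Fin n) :
    ((finRotate n).symm q).val = if q.val = 0 then n - 1 else q.val - 1 := by
  have h := val_finRotate ((finRotate n).symm q)
  rw [Equiv.apply_symm_apply] at h
  have h1 := ((finRotate n).symm q).isLt
  have h2 := q.isLt
  split_ifs at h ⊢ <;> omega

/-- The state `0`. -/
def zeroState (hn : 3 ≤ n) : Fin n := ⟨0, by omega⟩

/-- The state `1`. -/
def oneState (hn : 3 ≤ n) : Fin n := ⟨1, by omega⟩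

/-- The state `n - 1`. -/
def lastState (hn : 3 ≤ n) : Fin n := ⟨n - 1, by omega⟩

@[simp] theorem val_zeroState (hn : 3 ≤ n) : (zeroState hn).val = 0 := rfl
@[simp] theorem val_oneState (hn : 3 ≤ n) : (oneState hn).val = 1 := rfl
@[simp] theorem val_lastState (hn : 3 ≤ n) : (lastState hn).val = n - 1 := rfl

/-- The transposition of the states `0` and `1`. -/
def swapState (hn : 3 ≤ n) : Equiv.Perm (Fin n) := Equiv.swap (zeroState hn) (oneState hn)

theorem val_swapState (hn : 3 ≤ n) (q : Fin n) :
    (swapState hn q).val = if q.val = 0 then 1 else if q.val = 1 then 0 else q.val := by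
  rw [swapState, Equiv.swap_apply_def]
  simp only [Fin.ext_iff, val_zeroState, val_oneState]
  split_ifs <;> rfl

@[simp]
theorem swapState_swapState (hn : 3 ≤ n) (q : Fin n) : swapState hn (swapState hn q) = q :=
  Equiv.swap_apply_self _ _ _

theorem swapState_of_two_le (hn : 3 ≤ n) {q : Fin n} (h : 2 ≤ q.val) : swapState hn q = q := by
  apply Fin.ext
  rw [val_swapState]
  split_ifs <;> omega

theorem lastState_ne_zeroState (hn : 3 ≤ n) : lastState hn ≠ zeroState hn := by
  simp only [ne_eq, Fin.ext_iff, val_lastState, val_zeroState]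
  omega

section Rotation

variable {α : Type*} {Γ : Set α} {δ : Fin n → α → Fin n} {x : α}

theorem foldl_replicate_rotate (hδ : ∀ q, δ q x = finRotate n q) {p q : Fin n} {k : ℕ}
    (h : p.val + k = q.val) : (List.replicate k x).foldl δ p = q := by
  induction k generalizing p with
  | zero => exact Fin.ext h
  | succ k ih =>
    rw [List.replicate_succ, List.foldl_cons, hδ]
    refine ih ?_
    have := q.isLt
    rw [val_finRotate, if_neg (by omega)]
    omega

theorem foldl_replicate_wrap (hn : 0 < n) (hδ : ∀ q, δ q x = finRotate n q) (p : Fin n) :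
    (List.replicate (n - p.val) x).foldl δ p = ⟨0, hn⟩ := by
  have hp := p.isLt
  have e : n - p.val = (n - 1 - p.val) + 1 := by omega
  have h1 : (List.replicate (n - 1 - p.val) x).foldl δ p = ⟨n - 1, by omega⟩ :=
    foldl_replicate_rotate hδ (by simp only; omega)
  rw [e, List.replicate_add, List.foldl_append, h1]
  apply Fin.ext
  simp only [List.replicate_one, List.foldl_cons, List.foldl_nil, hδ, val_finRotate]
  rw [if_pos (by omega)]

theorem exists_foldl_replicate (hδ : ∀ q, δ q x = finRotate n q) (p q : Fin n) :
    ∃ k, (List.replicate k x).foldl δ p = q := by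
  refine ⟨n - p.val + q.val, ?_⟩
  rw [List.replicate_add, List.foldl_append, foldl_replicate_wrap (Fin.pos p) hδ]
  exact foldl_replicate_rotate hδ (by simp)

theorem foldl_injective (h : ∀ y ∈ Γ, Function.Injective fun q => δ q y) {w : List α}
    (hw : w ∈ words Γ) : Function.Injective fun q => w.foldl δ q := by
  induction w with
  | nil => exact Function.injective_id
  | cons y w ih =>
    rw [cons_mem_words_iff] at hw
    exact (ih hw.2).comp (h y hw.1)

theorem foldl_replicate_injective (hδ : ∀ q, δ q x = finRotate n q) (k : ℕ) :
    Function.Injective fun q => (List.replicate k x).foldl δ q := by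
  refine foldl_injective (Γ := {x}) ?_ (replicate_mem_words (Set.mem_singleton x) k)
  rintro _ rfl
  simp only [hδ]
  exact (finRotate n).injective

theorem stronglyConnected_of_rotate (hx : x ∈ Γ) (hδ : ∀ q, δ q x = finRotate n q) :
    StronglyConnected Γ δ := fun p q => by
  obtain ⟨k, hk⟩ := exists_foldl_replicate hδ p q
  exact ⟨_, replicate_mem_words hx k, hk⟩

/-- The power of the cycle that takes `p` to the only final state takes no other state there. -/
theorem runLang_injective_of_rotate (hx : x ∈ Γ) (hδ : ∀ q, δ q x = finRotate n q) (f : Fin n) :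
    Function.Injective (runLang Γ δ {f}) := by
  intro p q h
  obtain ⟨k, hk⟩ := exists_foldl_replicate hδ p f
  have h1 : List.replicate k x ∈ runLang Γ δ {f} p := ⟨replicate_mem_words hx k, hk⟩
  rw [h] at h1
  exact foldl_replicate_injective hδ k (hk.trans h1.2.symm)

/-- A single letter acting as the full cycle makes the automaton minimal, whatever the other letters
do; this covers all dialects at once. -/
theorem presents_runLang (hx : x ∈ Γ) (hδ : ∀ q, δ q x = finRotate n q) (f s : Fin n) :
    alphabet (runLang Γ δ {f} s) = Γ ∧ Presents (runLang Γ δ {f} s) δ {f} s := by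
  have hc := stronglyConnected_of_rotate hx hδ
  have hΓ := hc.alphabet_runLang (Set.singleton_nonempty f) s
  refine ⟨hΓ, ⟨by rw [hΓ], ?_, ?_⟩⟩
  · rw [hΓ]
    exact hc s
  · rw [hΓ]
    exact runLang_injective_of_rotate hx hδ f

end Rotation

/-- The map `ρ` inverts `π` where `π` is defined, so the original automaton reads the dialect
through `ρ`, over the letters in the range of `π`. -/
theorem dialect_accepts {α β σ : Type*} {π : α → Option β} {ρ : β → α}
    (h : ∀ x y, π x = some y → ρ y = x) (M : DFA α σ) :
    dialect π M.accepts =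
      runLang {y | π (ρ y) = some y} (fun q y => M.step q (ρ y)) M.accept M.start := by
  have hmap : ∀ w : List β, w.foldl (fun q y => M.step q (ρ y)) M.start = M.eval (w.map ρ) := by
    intro w
    rw [DFA.eval, DFA.evalFrom, List.foldl_map]
  ext w
  rw [mem_runLang, hmap]
  change (∃ u ∈ M.accepts, List.Forall₂ (fun x y => π x = some y) u w) ↔ _
  constructor
  · rintro ⟨u, hu, huw⟩
    have : u = w.map ρ ∧ w ∈ words {y | π (ρ y) = some y} := by
      clear hu
      induction huw with
      | nil => simp
      | cons hxy _ ih =>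
        have := h _ _ hxy
        subst this
        simp [← ih.1, ih.2, hxy]
    exact ⟨this.2, this.1 ▸ hu⟩
  · rintro ⟨hw, hF⟩
    refine ⟨w.map ρ, hF, ?_⟩
    clear hF
    induction w with
    | nil => simp
    | cons y w ih =>
      rw [cons_mem_words_iff] at hw
      rw [List.map_cons]
      exact List.Forall₂.cons hw.1 (ih hw.2)

/-- The action of the letters in the dialects `L_n(a,b,c,d)`, `L_n(a,b,c)`, `L_n(a,b)`, `L_n(a)`. -/
def stepABCD (hn : 3 ≤ n) (q : Fin n) : Letter → Fin n := (witnessDFA n hn).step q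

/-- The map of letters `a ↦ x, b ↦ y, c ↦ z, d ↦ t`. -/
def renameLetter (x y z t : Letter) : Letter → Letter
  | .a => x
  | .b => y
  | .c => z
  | .d => t

/-- The action of the letters in the dialect `L_n(a,b,-,c)`. -/
def stepABC (hn : 3 ≤ n) (q : Fin n) : Letter → Fin n
  | .a => finRotate n q
  | .b => swapState hn q
  | _ => q

/-- The action of the letters in the dialects `L_n(b,a,-,d)` and `L_n(b,a)`. -/
def stepBAD (hn : 3 ≤ n) (q : Fin n) : Letter → Fin n
  | .b => finRotate n q
  | .a => swapState hn q
  | _ => q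

theorem witness_abcd (hn : 3 ≤ n) : witness n hn (some .a) (some .b) (some .c) (some .d) =
    runLang Set.univ (stepABCD hn) {lastState hn} (zeroState hn) := by
  rw [witness, dialect_accepts (ρ := id) (by rintro (_ | _ | _ | _) _ h <;> cases h <;> rfl)]
  congr 1
  ext x
  cases x <;> simp [letterMap]

theorem witness_abc (hn : 3 ≤ n) : witness n hn (some .a) (some .b) (some .c) none =
    runLang {.a, .b, .c} (stepABCD hn) {lastState hn} (zeroState hn) := by
  rw [witness, dialect_accepts (ρ := id) (by rintro (_ | _ | _ | _) _ h <;> cases h <;> rfl)]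
  congr 1
  ext x
  cases x <;> simp [letterMap]

theorem witness_ab (hn : 3 ≤ n) : witness n hn (some .a) (some .b) none none =
    runLang {.a, .b} (stepABCD hn) {lastState hn} (zeroState hn) := by
  rw [witness, dialect_accepts (ρ := id) (by rintro (_ | _ | _ | _) _ h <;> cases h <;> rfl)]
  congr 1
  ext x
  cases x <;> simp [letterMap]

theorem witness_a (hn : 3 ≤ n) : witness n hn (some .a) none none none =
    runLang {.a} (stepABCD hn) {lastState hn} (zeroState hn) := by
  rw [witness, dialect_accepts (ρ := id) (by rintro (_ | _ | _ | _) _ h <;> cases h <;> rfl)]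
  congr 1
  ext x
  cases x <;> simp [letterMap]

theorem witness_ab_c (hn : 3 ≤ n) : witness n hn (some .a) (some .b) none (some .c) =
    runLang {.a, .b, .c} (stepABC hn) {lastState hn} (zeroState hn) := by
  rw [witness, dialect_accepts (ρ := renameLetter .a .b .d .d)
    (by rintro (_ | _ | _ | _) _ h <;> cases h <;> rfl)]
  congr 1
  · ext x
    cases x <;> simp [letterMap, renameLetter]
  · ext q x
    cases x <;> rfl

theorem witness_ba_d (hn : 3 ≤ n) : witness n hn (some .b) (some .a) none (some .d) =
    runLang {.a, .b, .d} (stepBAD hn) {lastState hn} (zeroState hn) := by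
  rw [witness, dialect_accepts (ρ := renameLetter .b .a .d .d)
    (by rintro (_ | _ | _ | _) _ h <;> cases h <;> rfl)]
  congr 1
  · ext x
    cases x <;> simp [letterMap, renameLetter]
  · ext q x
    cases x <;> rfl

theorem witness_ba (hn : 3 ≤ n) : witness n hn (some .b) (some .a) none none =
    runLang {.a, .b} (stepBAD hn) {lastState hn} (zeroState hn) := by
  rw [witness, dialect_accepts (ρ := renameLetter .b .a .d .d)
    (by rintro (_ | _ | _ | _) _ h <;> cases h <;> rfl)]
  congr 1
  · ext x
    cases x <;> simp [letterMap, renameLetter]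
  · ext q x
    cases x <;> rfl

theorem stepABCD_a (hn : 3 ≤ n) (q : Fin n) : stepABCD hn q .a = finRotate n q := rfl

theorem stepABCD_b (hn : 3 ≤ n) (q : Fin n) : stepABCD hn q .b = swapState hn q := rfl

theorem stepABCD_c (hn : 3 ≤ n) (q : Fin n) :
    stepABCD hn q .c = if q = lastState hn then zeroState hn else q := rfl

theorem accepts_witnessDFA (hn : 3 ≤ n) : (witnessDFA n hn).accepts =
    runLang Set.univ (stepABCD hn) {lastState hn} (zeroState hn) := by
  ext w
  exact (and_iff_right fun _ _ => Set.mem_univ _).symm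

theorem isMinimal_witnessDFA (hn : 3 ≤ n) : IsMinimal (witnessDFA n hn) := by
  refine ⟨fun q => ?_, fun p q h => ?_⟩
  · obtain ⟨w, -, hw⟩ := stronglyConnected_of_rotate (Set.mem_univ Letter.a) (stepABCD_a hn)
      (zeroState hn) q
    exact ⟨w, hw⟩
  · refine runLang_injective_of_rotate (Set.mem_univ Letter.a) (stepABCD_a hn) (lastState hn) ?_
    have e : ∀ q, runLang Set.univ (stepABCD hn) {lastState hn} q =
        (witnessDFA n hn).acceptsFrom q := fun q => by
      ext w
      exact and_iff_right fun _ _ => Set.mem_univ _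
    rw [e, e, h]

/-! ### Generation of all transformations -/

theorem exists_word_perm (hn : 3 ≤ n) {α : Type*} {Γ : Set α} {δ : Fin n → α → Fin n} {a b : α}
    (ha : a ∈ Γ) (hb : b ∈ Γ) (hδa : ∀ q, δ q a = finRotate n q)
    (hδb : ∀ q, δ q b = swapState hn q) (σ : Equiv.Perm (Fin n)) :
    ∃ w ∈ words Γ, ∀ q, w.foldl δ q = σ q := by
  have h01 : finRotate n (zeroState hn) = oneState hn := by
    apply Fin.ext
    rw [val_finRotate, val_zeroState, if_neg (by omega)]
    rfl
  have htop := Equiv.Perm.closure_cycle_adjacent_swap (isCycle_finRotate_of_le (n := n) (by omega))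
    (support_finRotate_of_le (by omega)) (zeroState hn)
  rw [h01] at htop
  have hσ : σ ∈ Submonoid.closure {finRotate n, swapState hn} := by
    -- Words only give products without inverses, which suffices in a finite group.
    rw [← Subgroup.closure_toSubmonoid_of_finite]
    change σ ∈ Subgroup.closure {finRotate n, Equiv.swap (zeroState hn) (oneState hn)}
    rw [htop]
    trivial
  induction hσ using Submonoid.closure_induction with
  | mem σ h =>
    rcases h with rfl | rfl
    · exact ⟨[a], by simpa using ha, hδa⟩
    · exact ⟨[b], by simpa using hb, hδb⟩
  | one => exact ⟨[], by simp, fun _ => rfl⟩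
  | mul σ τ _ _ hσ hτ =>
    obtain ⟨u, hu, eu⟩ := hσ
    obtain ⟨v, hv, ev⟩ := hτ
    exact ⟨v ++ u, by simp [hu, hv], by simp [eu, ev]⟩

/-- Conjugating `c` by permutations yields every map that moves one state `k` to another state `r`
and fixes the rest. A non-injective `f` is such a map after a function with larger image, so
induction on the defect of the image ends at permutations. -/
theorem full_of_letters (hn : 3 ≤ n) {α : Type*} {Γ : Set α} {δ : Fin n → α → Fin n} {a b c : α}
    (ha : a ∈ Γ) (hb : b ∈ Γ) (hc : c ∈ Γ) (hδa : ∀ q, δ q a = finRotate n q)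
    (hδb : ∀ q, δ q b = swapState hn q)
    (hδc : ∀ q, δ q c = if q = lastState hn then zeroState hn else q) : Full Γ δ := by
  have hperm := exists_word_perm hn ha hb hδa hδb
  have hupd : ∀ k r : Fin n, k ≠ r →
      ∃ w ∈ words Γ, ∀ q, w.foldl δ q = Function.update id k r q := by
    intro k r hkr
    -- A permutation with `k ↦ n - 1` and `r ↦ 0`: the second transposition corrects the image of
    -- `r` without disturbing the last state.
    let σ : Equiv.Perm (Fin n) :=
      Equiv.swap (Equiv.swap k (lastState hn) r) (zeroState hn) * Equiv.swap k (lastState hn)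
    have hr : lastState hn ≠ Equiv.swap k (lastState hn) r := by
      intro h
      exact hkr ((Equiv.swap k (lastState hn)).injective ((Equiv.swap_apply_left _ _).trans h))
    have hσk : σ k = lastState hn := by
      simp [σ, Equiv.swap_apply_of_ne_of_ne hr (lastState_ne_zeroState hn)]
    have hσr : σ r = zeroState hn := by simp [σ]
    obtain ⟨u, hu, eu⟩ := hperm σ
    obtain ⟨v, hv, ev⟩ := hperm σ.symm
    refine ⟨u ++ c :: v, by simp [hu, hv, hc], fun q => ?_⟩
    rw [List.foldl_append, List.foldl_cons, eu, hδc, ev]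
    by_cases hq : q = k
    · subst hq
      rw [if_pos hσk, Function.update_self, ← hσr, Equiv.symm_apply_apply]
    · rw [if_neg, Function.update_of_ne hq, Equiv.symm_apply_apply, id]
      rw [← hσk]
      exact fun h => hq (σ.injective h)
  intro f
  induction h : n - (Finset.univ.image f).card using Nat.strong_induction_on generalizing f with
  | _ d ih =>
  by_cases hf : Function.Injective f
  · exact hperm (Equiv.ofBijective f (Finite.injective_iff_bijective.1 hf))
  · obtain ⟨k, hk⟩ : ∃ k, ∀ q, f q ≠ k := by
      have : ¬Function.Surjective f := fun hs => hf (Finite.injective_iff_surjective.2 hs)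
      simpa [Function.Surjective] using this
    rw [Function.Injective] at hf
    push Not at hf
    obtain ⟨i, j, hij, hne⟩ := hf
    -- Redirecting `i` to the missed value `k` loses nothing, since `f i` is still attained at `j`;
    -- moving `k` to `f i` afterwards restores `f`.
    have hsub : insert k (Finset.univ.image f) ⊆ Finset.univ.image (Function.update f i k) := by
      intro y hy
      rw [Finset.mem_insert, Finset.mem_image] at hy
      rw [Finset.mem_image]
      rcases hy with rfl | ⟨q, -, rfl⟩
      · exact ⟨i, Finset.mem_univ _, Function.update_self _ _ _⟩
      · by_cases hq : q = i
        · subst hq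
          exact ⟨j, Finset.mem_univ _, by rw [Function.update_of_ne hne.symm, hij]⟩
        · exact ⟨q, Finset.mem_univ _, Function.update_of_ne hq _ _⟩
    have hcard := Finset.card_le_card hsub
    rw [Finset.card_insert_of_notMem (by simpa using hk)] at hcard
    have hle : (Finset.univ.image (Function.update f i k)).card ≤ n := by
      simpa using Finset.card_le_univ (Finset.univ.image (Function.update f i k))
    obtain ⟨u, hu, eu⟩ := ih _ (by omega) (Function.update f i k) rfl
    obtain ⟨v, hv, ev⟩ := hupd k (f i) (hk i).symm
    refine ⟨u ++ v, by simp [hu, hv], fun q => ?_⟩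
    rw [List.foldl_append, eu, ev]
    by_cases hq : q = i
    · subst hq
      rw [Function.update_self, Function.update_self]
    · rw [Function.update_of_ne hq, Function.update_of_ne (hk q), id]

theorem stepABCD_not_constant (hn : 3 ≤ n) (x : Letter) :
    ∃ p q, stepABCD hn p x ≠ stepABCD hn q x := by
  have h01 : zeroState hn ≠ oneState hn := by simp [Fin.ext_iff]
  refine ⟨zeroState hn, oneState hn, ?_⟩
  cases x with
  | a => exact fun h => h01 ((finRotate n).injective h)
  | b => exact fun h => h01 ((swapState hn).injective h)
  | c =>
    rw [stepABCD_c, stepABCD_c, if_neg (lastState_ne_zeroState hn).symm, if_neg]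
    · exact h01
    · simp only [Fin.ext_iff, val_lastState, val_oneState]
      omega
  | d => exact h01

end Witness


/-! ### Lower bound for the star. -/

section StarWitness

variable {n : ℕ} {α : Type*} {δ : Fin n → α → Fin n} {a b : α}

theorem mem_starStep_perm {x : α} {σ : Equiv.Perm (Fin n)} (hδ : ∀ q, δ q x = σ q)
    {f s r : Fin n} {S : Finset (Fin n)} :
    r ∈ starStep δ {f} s S x ↔ σ.symm r ∈ S ∨ r = s ∧ σ.symm f ∈ S := by
  have h : ∀ r, (∃ q ∈ S, δ q x = r) ↔ σ.symm r ∈ S := fun r => by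
    simp only [hδ]
    constructor
    · rintro ⟨q, hq, rfl⟩
      simpa using hq
    · exact fun h => ⟨_, h, by simp⟩
  rw [mem_starStep, h]
  simp only [Set.mem_singleton_iff, h]

/-- As long as the cycle does not wrap around, the tracked state has positive index after each
letter, so the forced insertion of `0` never interferes with it. -/
theorem mem_foldl_starStep_replicate (hδ : ∀ q, δ q a = finRotate n q) (hn : 0 < n) {f : Fin n}
    {k : ℕ} {S : Finset (Fin n)} {q r : Fin n} (h : q.val + k = r.val) :
    r ∈ (List.replicate k a).foldl (starStep δ {f} ⟨0, hn⟩) S ↔ q ∈ S := by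
  induction k generalizing S q with
  | zero =>
    rw [Fin.ext (h : q.val = r.val)]
    rfl
  | succ k ih =>
    have hr := r.isLt
    have hv : (finRotate n q).val = q.val + 1 := by
      rw [val_finRotate, if_neg (by omega)]
    rw [List.replicate_succ, List.foldl_cons, ih (q := finRotate n q) (by omega),
      mem_starStep_perm hδ, Equiv.symm_apply_apply]
    refine or_iff_left fun h0 => ?_
    have := congrArg Fin.val h0.1
    simp only at this
    omega

theorem starStep_swap_zero (hn : 3 ≤ n) (hδb : ∀ q, δ q b = swapState hn q) :
    starStep δ {lastState hn} (zeroState hn) {zeroState hn} b = {oneState hn} := by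
  have hl : (swapState hn).symm (lastState hn) = lastState hn := by
    rw [Equiv.symm_apply_eq, swapState_of_two_le]
    rw [val_lastState]
    omega
  ext r
  rw [mem_starStep_perm hδb, hl]
  simp only [Finset.mem_singleton, lastState_ne_zeroState, and_false, or_false]
  rw [Equiv.symm_apply_eq, swapState, Equiv.swap_apply_left]

/-- Sets grow only when the cycle brings a state to `n - 1`, which adds `0`. Every set is traced
back through `a` and `b` to one with fewer elements, or with equally many elements and a smaller
sum. -/
theorem exists_word_starStep (hn : 3 ≤ n) {Γ : Set α} (ha : a ∈ Γ) (hb : b ∈ Γ)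
    (hδa : ∀ q, δ q a = finRotate n q) (hδb : ∀ q, δ q b = swapState hn q)
    (S : Finset (Fin n)) (hS : S.Nonempty) (hv : lastState hn ∈ S → zeroState hn ∈ S) :
    ∃ w ∈ words Γ, w ≠ [] ∧
      w.foldl (starStep δ {lastState hn} (zeroState hn)) {zeroState hn} = S := by
  have hlast : ∀ q : Fin n, finRotate n q = zeroState hn ↔ q = lastState hn := by
    intro q
    rw [Fin.ext_iff, Fin.ext_iff, val_finRotate, val_zeroState, val_lastState]
    have := q.isLt
    split_ifs with h
    · exact iff_of_true rfl (by omega)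
    · exact iff_of_false id (by omega)
  have hswap_last : (swapState hn).symm (lastState hn) = lastState hn := by
    rw [Equiv.symm_apply_eq, swapState_of_two_le]
    rw [val_lastState]
    omega
  have hsymm : (swapState hn).symm = swapState hn := Equiv.symm_swap _ _
  have hl1 : lastState hn ≠ oneState hn := by
    simp only [ne_eq, Fin.ext_iff, val_lastState, val_oneState]
    omega
  have step : ∀ {T S : Finset (Fin n)} {x : α}, x ∈ Γ →
      starStep δ {lastState hn} (zeroState hn) T x = S →
      (∃ w ∈ words Γ, w ≠ [] ∧
        w.foldl (starStep δ {lastState hn} (zeroState hn)) {zeroState hn} = T) →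
      ∃ w ∈ words Γ, w ≠ [] ∧
        w.foldl (starStep δ {lastState hn} (zeroState hn)) {zeroState hn} = S := by
    rintro T S x hx rfl ⟨w, hw, -, rfl⟩
    exact ⟨w ++ [x], by simp [hw, hx], by simp, by simp⟩
  have mem_pre : ∀ (σ : Equiv.Perm (Fin n)) (S : Finset (Fin n)) (q : Fin n),
      q ∈ S.map σ.symm.toEmbedding ↔ σ q ∈ S := by
    intro σ S q
    simp
  induction hc : S.card using Nat.strong_induction_on generalizing S with
  | _ c ihc =>
  -- Rotate `S` without `0` backwards: this smaller set omits `n - 1`, and `a` takes it back while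
  -- the arrival at `n - 1` supplies the missing `0`.
  have reach_last : ∀ S : Finset (Fin n), S.card = c → lastState hn ∈ S → zeroState hn ∈ S →
      ∃ w ∈ words Γ, w ≠ [] ∧
        w.foldl (starStep δ {lastState hn} (zeroState hn)) {zeroState hn} = S := by
    intro S hc hl h0
    have hcard : (S.erase (zeroState hn)).card < c := by
      rw [← hc]
      exact Finset.card_erase_lt_of_mem h0
    have hne : (S.erase (zeroState hn)).Nonempty :=
      ⟨lastState hn, Finset.mem_erase.2 ⟨lastState_ne_zeroState hn, hl⟩⟩
    refine step ha ?_ (ihc _ hcard ((S.erase (zeroState hn)).map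
      (finRotate n).symm.toEmbedding) (hne.map) ?_ (Finset.card_map _))
    · ext r
      rw [mem_starStep_perm hδa, mem_pre, mem_pre, Equiv.apply_symm_apply, Equiv.apply_symm_apply,
        Finset.mem_erase, Finset.mem_erase]
      have := lastState_ne_zeroState hn
      by_cases hr : r = zeroState hn
      · subst hr
        simp [h0, hl, this]
      · simp [hr]
    · rw [mem_pre, (hlast _).2 rfl]
      simp
  induction hs : ∑ q ∈ S, q.val using Nat.strong_induction_on generalizing S with
  | _ t iht =>
  by_cases hl : lastState hn ∈ S
  · exact reach_last S hc hl (hv hl)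
  by_cases h0 : zeroState hn ∈ S
  · by_cases h1 : oneState hn ∈ S
    · refine step ha ?_ (reach_last (S.map (finRotate n).symm.toEmbedding)
        ((Finset.card_map _).trans hc) ?_ ?_)
      · ext r
        rw [mem_starStep_perm hδa, mem_pre, mem_pre, Equiv.apply_symm_apply,
          Equiv.apply_symm_apply]
        simp [hl]
      · rw [mem_pre, (hlast _).2 rfl]
        exact h0
      · rw [mem_pre]
        convert h1
        apply Fin.ext
        rw [val_finRotate, val_zeroState, if_neg (by omega)]
        rfl
    · by_cases hS0 : S = {zeroState hn}
      · subst hS0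
        -- The word must be non-empty, because the quotient by the empty word is the star itself.
        refine ⟨[b, b], by simp [hb], by simp, ?_⟩
        have h10 : swapState hn (oneState hn) = zeroState hn := Equiv.swap_apply_right _ _
        rw [List.foldl_cons, List.foldl_cons, List.foldl_nil, starStep_swap_zero hn hδb]
        ext r
        rw [mem_starStep_perm hδb, hswap_last, hsymm]
        simp only [Finset.mem_singleton, hl1, and_false, or_false]
        rw [← Equiv.eq_symm_apply, hsymm, h10]
      -- Tracing back `b` and then `a` sends `0` to `1` and back to `0`, and lowers every other
      -- element by one.
      · refine step hb ?_ (step (T := (S.map (swapState hn).symm.toEmbedding).map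
          (finRotate n).symm.toEmbedding) (S := S.map (swapState hn).symm.toEmbedding) ha ?_
          (iht _ ?_ _ (hS.map.map) ?_ ((Finset.card_map _).trans ((Finset.card_map _).trans hc))
            rfl))
        · ext r
          rw [mem_starStep_perm hδb, mem_pre, mem_pre, Equiv.apply_symm_apply,
            Equiv.apply_symm_apply]
          simp [hl]
        · ext r
          simp only [mem_starStep_perm hδa, mem_pre, Equiv.apply_symm_apply]
          refine or_iff_left fun h => hl ?_
          have h2 := h.2
          rwa [← hsymm, hswap_last] at h2
        · rw [← hs, Finset.sum_map, Finset.sum_map]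
          have hval : ∀ q ∈ S, ((finRotate n).symm ((swapState hn).symm q)).val = q.val - 1 := by
            intro q hq
            have h1 : q.val ≠ 1 := fun h => h1 (by rwa [← (Fin.ext h : q = oneState hn)])
            have h2 : q.val ≠ n - 1 := fun h => hl (by rwa [← (Fin.ext h : q = lastState hn)])
            rw [val_finRotate_symm, hsymm, val_swapState]
            by_cases hq0 : q.val = 0
            · simp [hq0]
            · simp [hq0, h1]
          refine Finset.sum_lt_sum (fun q hq => (hval q hq).trans_le (Nat.sub_le _ _)) ?_
          obtain ⟨q, hq, hq0⟩ : ∃ q ∈ S, q ≠ zeroState hn := by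
            by_contra! h
            exact hS0 (Finset.eq_singleton_iff_nonempty_unique_mem.2 ⟨hS, h⟩)
          refine ⟨q, hq, (hval q hq).trans_lt ?_⟩
          have : q.val ≠ 0 := fun h => hq0 (Fin.ext h)
          omega
        · rw [mem_pre, mem_pre, (hlast _).2 rfl]
          intro h
          refine absurd ?_ h1
          convert h
          apply Fin.ext
          rw [val_swapState, val_zeroState, if_pos rfl]
          rfl
  · refine step ha ?_ (iht _ ?_ (S.map (finRotate n).symm.toEmbedding) hS.map ?_
      ((Finset.card_map _).trans hc) rfl)
    · ext r
      rw [mem_starStep_perm hδa, mem_pre, mem_pre, Equiv.apply_symm_apply,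
        Equiv.apply_symm_apply]
      simp [hl]
    · rw [← hs, Finset.sum_map]
      have hval : ∀ q ∈ S, ((finRotate n).symm q).val < q.val := by
        intro q hq
        have : q.val ≠ 0 := fun h => h0 (by rwa [← (Fin.ext h : q = zeroState hn)])
        rw [val_finRotate_symm, if_neg this]
        omega
      exact Finset.sum_lt_sum_of_nonempty hS hval
    · rw [mem_pre, (hlast _).2 rfl]
      exact fun h => absurd h h0

theorem nil_mem_starLang_iff {Γ : Set α} {F : Set (Fin n)} {s : Fin n} {S : Finset (Fin n)} :
    [] ∈ starLang Γ δ F s S ↔ ∃ q ∈ S, q ∈ F := by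
  rw [mem_starLang]
  constructor
  · rintro ⟨q, hq, u, v, e, hu, -⟩
    obtain ⟨rfl, rfl⟩ := List.append_eq_nil_iff.1 e.symm
    exact ⟨q, hq, hu.2⟩
  · rintro ⟨q, hq, hF⟩
    exact ⟨q, hq, [], [], rfl, ⟨nil_mem_words, hF⟩, Language.nil_mem_kstar _⟩

theorem le_complexity_kstar (hn : 3 ≤ n) {L : Language α}
    (P : Presents L δ {lastState hn} (zeroState hn)) (ha : a ∈ alphabet L) (hb : b ∈ alphabet L)
    (hδa : ∀ q, δ q a = finRotate n q) (hδb : ∀ q, δ q b = swapState hn q) :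
    ((2 ^ (n - 1) + 2 ^ (n - 2) : ℕ) : ℕ∞) ≤ complexity L∗ := by
  have hvalid : ∀ S : Finset (Fin n), (lastState hn ∈ S → zeroState hn ∈ S) → S ≠ ∅ →
      StarValid {lastState hn} (zeroState hn) S := fun S h h0 =>
    ⟨Finset.nonempty_iff_ne_empty.2 h0, by rintro ⟨q, hq, rfl⟩; exact h hq⟩
  have hstar : ∀ S : Finset (Fin n), (lastState hn ∈ S → zeroState hn ∈ S) → S ≠ ∅ →
      L∗ ≠ starLang (alphabet L) δ {lastState hn} (zeroState hn) S := by
    intro S h h0 e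
    have hl : lastState hn ∈ S := by
      have := Language.nil_mem_kstar L
      rw [e, nil_mem_starLang_iff] at this
      simpa using this
    -- Containing the empty word forces the final state into `S`; `b` fixes that state, so `[b]`
    -- would be accepted from `S`. But `b` takes `0` to `1`, which is not final.
    have hbS : [b] ∈ L∗ := by
      rw [e, cons_mem_starLang (hvalid S h h0) hb, nil_mem_starLang_iff]
      refine ⟨lastState hn, ?_, rfl⟩
      rw [mem_starStep_perm hδb]
      refine Or.inl ?_
      rwa [swapState, Equiv.symm_swap, ← swapState, swapState_of_two_le]
      rw [val_lastState]
      omega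
    rw [P.eq, cons_mem_kstar_iff_starLang, cons_mem_starLang starValid_singleton hb,
      nil_mem_starLang_iff, starStep_swap_zero hn hδb] at hbS
    obtain ⟨_, hq, rfl⟩ := hbS
    have := congrArg Fin.val (Finset.mem_singleton.1 hq)
    rw [val_lastState, val_oneState] at this
    omega
  have hinj : ∀ S T : Finset (Fin n), (lastState hn ∈ S → zeroState hn ∈ S) → S ≠ ∅ →
      (lastState hn ∈ T → zeroState hn ∈ T) → T ≠ ∅ →
      starLang (alphabet L) δ {lastState hn} (zeroState hn) S =
        starLang (alphabet L) δ {lastState hn} (zeroState hn) T → S ⊆ T := by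
    intro S T hS hS0 hT hT0 e q hq
    have hq' := q.isLt
    have hk : q.val + (n - 1 - q.val) = (lastState hn).val := by
      rw [val_lastState]
      omega
    have hw : List.replicate (n - 1 - q.val) a ++ [] ∈
        starLang (alphabet L) δ {lastState hn} (zeroState hn) S := by
      rw [append_mem_starLang (hvalid S hS hS0) (replicate_mem_words ha _), nil_mem_starLang_iff]
      exact ⟨lastState hn, (mem_foldl_starStep_replicate hδa _ hk).2 hq, rfl⟩
    rw [e, append_mem_starLang (hvalid T hT hT0) (replicate_mem_words ha _),
      nil_mem_starLang_iff] at hw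
    obtain ⟨_, hr, rfl⟩ := hw
    exact (mem_foldl_starStep_replicate hδa _ hk).1 hr
  rw [← card_filter_imp (lastState_ne_zeroState hn)]
  refine le_complexity_of_finset _ (fun S => if S = ∅ then L∗ else
    starLang (alphabet L) δ {lastState hn} (zeroState hn) S) ?_ ?_
  · intro S hS T hT e
    simp only [Finset.coe_filter, Finset.mem_univ, true_and, Set.mem_ofPred_eq] at hS hT
    by_cases hS0 : S = ∅ <;> by_cases hT0 : T = ∅ <;> simp only [hS0, hT0, if_true, if_false] at e
    · rw [hS0, hT0]
    · exact absurd e (hstar T hT hT0)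
    · exact absurd e.symm (hstar S hS hS0)
    · exact (hinj S T hS hS0 hT hT0 e).antisymm (hinj T S hT hT0 hS hS0 e.symm)
  · intro S hS
    simp only [Finset.mem_filter, Finset.mem_univ, true_and] at hS
    rw [alphabet_kstar]
    by_cases hS0 : S = ∅
    · exact ⟨[], nil_mem_words, by simp [hS0]⟩
    · obtain ⟨w, hw, h0, e⟩ := exists_word_starStep hn ha hb hδa hδb S
        (Finset.nonempty_iff_ne_empty.2 hS0) hS
      refine ⟨w, hw, ?_⟩
      rw [P.leftQuotient_kstar hw h0, e, if_neg hS0]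

end StarWitness


/-! ### Lower bound for the product. -/

section ProductWitness

variable {m n : ℕ}

theorem finRotate_zeroState (hn : 3 ≤ n) : finRotate n (zeroState hn) = oneState hn := by
  apply Fin.ext
  rw [val_finRotate, val_zeroState, if_neg (by omega)]
  rfl

theorem finRotate_lastState (hn : 3 ≤ n) : finRotate n (lastState hn) = zeroState hn := by
  apply Fin.ext
  rw [val_finRotate, val_lastState, if_pos (by omega)]
  rfl

theorem finRotate_of_val {p q : Fin n} (h : p.val + 1 = q.val) :
    finRotate n p = q := by
  apply Fin.ext
  have := q.isLt
  rw [val_finRotate, if_neg (by omega), h]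

theorem swapState_zeroState (hn : 3 ≤ n) : swapState hn (zeroState hn) = oneState hn :=
  Equiv.swap_apply_left _ _

theorem swapState_oneState (hn : 3 ≤ n) : swapState hn (oneState hn) = zeroState hn :=
  Equiv.swap_apply_right _ _

theorem lastState_ne_oneState (hn : 3 ≤ n) : lastState hn ≠ oneState hn := by
  simp only [ne_eq, Fin.ext_iff, val_lastState, val_oneState]
  omega

/-- The transitions of the automaton for the product of `L_m(a,b,-,c)` and `L_n(b,a,-,d)`. -/
noncomputable abbrev witnessProdStep (hm : 3 ≤ m) (hn : 3 ≤ n) :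
    Option (Fin m) × Finset (Fin n) → Letter → Option (Fin m) × Finset (Fin n) :=
  prodStep {.a, .b, .c} (stepABC hm) {lastState hm} {.a, .b, .d} (stepBAD hn) (zeroState hn)

theorem witnessProdStep_a (hm : 3 ≤ m) (hn : 3 ≤ n) {p : Fin m}
    (hp : finRotate m p ≠ lastState hm) (S : Finset (Fin n)) :
    witnessProdStep hm hn (some p, S) .a = (some (finRotate m p), S.image (swapState hn)) := by
  simp [witnessProdStep, prodStep, optStep, stepABC, stepBAD, hp, -finRotate_apply]

theorem witnessProdStep_a_last (hm : 3 ≤ m) (hn : 3 ≤ n) {p : Fin m}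
    (hp : finRotate m p = lastState hm) (S : Finset (Fin n)) :
    witnessProdStep hm hn (some p, S) .a =
      (some (lastState hm), insert (zeroState hn) (S.image (swapState hn))) := by
  simp [witnessProdStep, prodStep, optStep, stepABC, stepBAD, hp, -finRotate_apply]

theorem witnessProdStep_b (hm : 3 ≤ m) (hn : 3 ≤ n) {p : Fin m}
    (hp : swapState hm p ≠ lastState hm) (S : Finset (Fin n)) :
    witnessProdStep hm hn (some p, S) .b = (some (swapState hm p), S.image (finRotate n)) := by
  simp [witnessProdStep, prodStep, optStep, stepABC, stepBAD, hp, -finRotate_apply]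

theorem witnessProdStep_d (hm : 3 ≤ m) (hn : 3 ≤ n) (t : Option (Fin m) × Finset (Fin n)) :
    witnessProdStep hm hn t .d = (none, t.2) := by
  simp [witnessProdStep, prodStep, optStep, stepBAD]

/-- The states of the automaton for the product that can be reached from its initial state. -/
def ProdReachable (hm : 3 ≤ m) (hn : 3 ≤ n) (t : Option (Fin m) × Finset (Fin n)) : Prop :=
  ∃ w : List Letter, w.foldl (witnessProdStep hm hn) (some (zeroState hm), ∅) = t

theorem ProdReachable.step {hm : 3 ≤ m} {hn : 3 ≤ n} {t t' : Option (Fin m) × Finset (Fin n)}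
    (h : ProdReachable hm hn t) (x : Letter) (e : witnessProdStep hm hn t x = t') :
    ProdReachable hm hn t' := by
  obtain ⟨w, rfl⟩ := h
  exact ⟨w ++ [x], by simp [← e]⟩

theorem ProdReachable.rotate {hm : 3 ≤ m} {hn : 3 ≤ n} {S : Finset (Fin n)}
    (h : ProdReachable hm hn (some (zeroState hm), S)) (p : Fin m) (hp : p ≠ lastState hm) :
    ProdReachable hm hn (some p, S.image (swapState hn ^ p.val)) := by
  obtain ⟨k, hk⟩ := p
  induction k with
  | zero =>
    rw [pow_zero, Equiv.Perm.coe_one, Finset.image_id]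
    exact h
  | succ k ih =>
    have hk' : k + 1 ≠ m - 1 := fun e => hp (Fin.ext e)
    have ih := ih (by omega) (by
      simp only [ne_eq, Fin.ext_iff, val_lastState]
      omega)
    have e : finRotate m ⟨k, by omega⟩ = ⟨k + 1, hk⟩ := finRotate_of_val rfl
    refine ih.step .a ?_
    rw [witnessProdStep_a hm hn (by rwa [e]), e, Finset.image_image, pow_succ']
    rfl

/-- The word `a ^ m` takes the first factor once around its cycle. At its final state `0` enters the
set, and the last `a` swaps it to `1`. -/
theorem ProdReachable.around {hm : 3 ≤ m} {hn : 3 ≤ n} {S : Finset (Fin n)}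
    (h : ProdReachable hm hn (some (zeroState hm), S)) :
    ProdReachable hm hn
      (some (zeroState hm), insert (oneState hn) (S.image (swapState hn ^ m))) := by
  have h1 := h.rotate ⟨m - 2, by omega⟩ (by
    simp only [ne_eq, Fin.ext_iff, val_lastState]
    omega)
  have e1 : finRotate m ⟨m - 2, by omega⟩ = lastState hm := by
    refine finRotate_of_val ?_
    rw [val_lastState]
    simp only
    omega
  have h2 := h1.step .a (witnessProdStep_a_last hm hn e1 _)
  have e2 := finRotate_lastState hm
  refine h2.step .a ?_
  rw [witnessProdStep_a hm hn (by rw [e2]; exact (lastState_ne_zeroState hm).symm), e2,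
    Finset.image_insert, swapState_zeroState, Finset.image_image, Finset.image_image]
  congr 3
  ext q
  simp only [Function.comp_apply, ← Equiv.Perm.mul_apply, ← pow_succ']
  have : m - 2 + 1 + 1 = m := by omega
  rw [this]

/-- The permutations of the states of the second factor that words can induce while they fix the
state `0` of the first factor. -/
def prodStabilizer (hm : 3 ≤ m) (hn : 3 ≤ n) : Submonoid (Equiv.Perm (Fin n)) where
  carrier := {σ | ∀ S, ProdReachable hm hn (some (zeroState hm), S) →
    ProdReachable hm hn (some (zeroState hm), S.image σ)}
  one_mem' S h := by simpa using h
  mul_mem' := by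
    intro σ τ hσ hτ S h
    have := hσ _ (hτ S h)
    rwa [Finset.image_image] at this

theorem inv_mem_submonoid_of_finite {G : Type*} [Group G] [Finite G] {M : Submonoid G} {x : G}
    (h : x ∈ M) : x⁻¹ ∈ M := by
  have e : x⁻¹ = x ^ (orderOf x - 1) := by
    apply inv_eq_of_mul_eq_one_right
    rw [mul_pow_sub_one (orderOf_pos x).ne', pow_orderOf_eq_one]
  rw [e]
  exact pow_mem h _

theorem rotate_mul_swap_mem_prodStabilizer (hm : 3 ≤ m) (hn : 3 ≤ n) :
    finRotate n * swapState hn ∈ prodStabilizer hm hn := by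
  intro S h
  have h1 := h.step .a (witnessProdStep_a hm hn (by
    rw [finRotate_zeroState]
    exact (lastState_ne_oneState hm).symm) S)
  rw [finRotate_zeroState] at h1
  have h2 := h1.step .b (witnessProdStep_b hm hn (by
    rw [swapState_oneState]
    exact (lastState_ne_zeroState hm).symm) _)
  rwa [swapState_oneState, Finset.image_image] at h2

theorem rotate_mul_rotate_mem_prodStabilizer (hm : 3 ≤ m) (hn : 3 ≤ n) :
    finRotate n * finRotate n ∈ prodStabilizer hm hn := by
  intro S h
  have h1 := h.step .b (witnessProdStep_b hm hn (by
    rw [swapState_zeroState]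
    exact (lastState_ne_oneState hm).symm) S)
  rw [swapState_zeroState] at h1
  have h2 := h1.step .b (witnessProdStep_b hm hn (by
    rw [swapState_oneState]
    exact (lastState_ne_zeroState hm).symm) _)
  rwa [swapState_oneState, Finset.image_image] at h2

/-- This permutation fixes `1` and runs through the other states in the cycle `0, 2, 3, …, n - 1`.
-/
theorem exists_pow_rotate_mul_swap (hn : 3 ≤ n) {e : Fin n} (he : e ≠ oneState hn) :
    ∃ j, ((finRotate n * swapState hn) ^ j) e = lastState hn := by
  have hbig : ∀ k (e : Fin n), 2 ≤ e.val → e.val + k = n - 1 →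
      ((finRotate n * swapState hn) ^ k) e = lastState hn := by
    intro k
    induction k with
    | zero => exact fun e _ h => Fin.ext h
    | succ k ih =>
      intro e h2 hk
      have hv : (finRotate n e).val = e.val + 1 := by
        rw [val_finRotate, if_neg (by omega)]
      rw [pow_succ, Equiv.Perm.mul_apply, Equiv.Perm.mul_apply, swapState_of_two_le hn h2]
      exact ih _ (by omega) (by omega)
  have hlt := e.isLt
  by_cases h2 : 2 ≤ e.val
  · exact ⟨n - 1 - e.val, hbig _ e h2 (by omega)⟩
  · have h1 : e.val ≠ 1 := fun h => he (Fin.ext h)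
    have h0 : e = zeroState hn := Fin.ext (by rw [val_zeroState]; omega)
    subst h0
    have hv : finRotate n (oneState hn) = ⟨2, by omega⟩ := finRotate_of_val rfl
    refine ⟨n - 1 - 2 + 1, ?_⟩
    rw [pow_succ, Equiv.Perm.mul_apply, Equiv.Perm.mul_apply, swapState_zeroState, hv]
    exact hbig _ _ le_rfl (by simp only; omega)

/-- Induction on the size: if `1` is in `T`, a turn around the cycle produces it from a set with one
element less. Otherwise a permutation `ρ` induced by words in `ab` and `bb`, which fix state `0` of
the first factor, brings some element to `1`; its inverse is a power of it and leads back to `T`. -/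
theorem prodReachable_zero (hm : 3 ≤ m) (hn : 3 ≤ n) (T : Finset (Fin n)) :
    ProdReachable hm hn (some (zeroState hm), T) := by
  induction hc : T.card using Nat.strong_induction_on generalizing T with
  | _ c ih =>
  have hone : ∀ T : Finset (Fin n), T.card = c → oneState hn ∈ T →
      ProdReachable hm hn (some (zeroState hm), T) := by
    intro T hc h1
    have hlt : ((T.erase (oneState hn)).image (swapState hn ^ m).symm).card < c := by
      rw [Finset.card_image_of_injective _ (Equiv.injective _), ← hc]
      exact Finset.card_erase_lt_of_mem h1
    have := (ih _ hlt _ rfl).around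
    rwa [Finset.image_image, Equiv.self_comp_symm, Finset.image_id, Finset.insert_erase h1] at this
  by_cases h1 : oneState hn ∈ T
  · exact hone T hc h1
  rcases T.eq_empty_or_nonempty with rfl | ⟨e, he⟩
  · exact ⟨[], rfl⟩
  obtain ⟨j, hj⟩ := exists_pow_rotate_mul_swap hn (e := e) fun h => h1 (h ▸ he)
  have hmem := mul_mem (rotate_mul_rotate_mem_prodStabilizer hm hn)
    (pow_mem (rotate_mul_swap_mem_prodStabilizer hm hn) j)
  set ρ := finRotate n * finRotate n * (finRotate n * swapState hn) ^ j with hρ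
  have hρe : ρ e = oneState hn := by
    rw [hρ, Equiv.Perm.mul_apply, hj, Equiv.Perm.mul_apply, finRotate_lastState,
      finRotate_zeroState]
  have := hone (T.image ρ) (by rw [Finset.card_image_of_injective _ ρ.injective, hc])
    (Finset.mem_image.2 ⟨e, he, hρe⟩)
  have h := inv_mem_submonoid_of_finite hmem _ this
  rw [Finset.image_image] at h
  convert h
  rw [← Equiv.Perm.coe_mul, inv_mul_cancel, Equiv.Perm.coe_one, Finset.image_id]

theorem prodReachable_of_prodValid (hm : 3 ≤ m) (hn : 3 ≤ n)
    (t : Option (Fin m) × Finset (Fin n))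
    (ht : ProdValid {lastState hm} (zeroState hn) t) : ProdReachable hm hn t := by
  obtain ⟨_ | p, T⟩ := t
  · exact (prodReachable_zero hm hn T).step .d (witnessProdStep_d hm hn _)
  have hpred : ∀ p : Fin m, p ≠ lastState hm → ProdReachable hm hn (some p, T) := by
    intro p hp
    have := (prodReachable_zero hm hn (T.image (swapState hn ^ p.val).symm)).rotate p hp
    rwa [Finset.image_image, Equiv.self_comp_symm, Finset.image_id] at this
  by_cases hp : p = lastState hm
  · subst hp
    have h0 : zeroState hn ∈ T := ht _ rfl rfl
    have hne : (⟨m - 2, by omega⟩ : Fin m) ≠ lastState hm := by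
      simp only [ne_eq, Fin.ext_iff, val_lastState]
      omega
    have e1 : finRotate m ⟨m - 2, by omega⟩ = lastState hm := by
      refine finRotate_of_val ?_
      rw [val_lastState]
      simp only
      omega
    have := (prodReachable_zero hm hn
      ((T.image (swapState hn)).image (swapState hn ^ (m - 2)).symm)).rotate _ hne
    rw [Finset.image_image, Equiv.self_comp_symm, Finset.image_id] at this
    refine this.step .a ?_
    rw [witnessProdStep_a_last hm hn e1, Finset.image_image]
    have e2 : (swapState hn : Fin n → Fin n) ∘ swapState hn = id := by
      funext q
      simp
    rw [e2, Finset.image_id, Finset.insert_eq_of_mem h0]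
  · exact hpred p hp

/-- The language of a state of the automaton for the product of `L_m(a,b,-,c)` and
`L_n(b,a,-,d)`. -/
def witnessProdLang (hm : 3 ≤ m) (hn : 3 ≤ n) :
    Option (Fin m) × Finset (Fin n) → Language Letter :=
  prodLang {.a, .b, .c} (stepABC hm) {lastState hm} {.a, .b, .d} (stepBAD hn) {lastState hn}
    (zeroState hn)

/-- The letter `d` removes the first factor and leaves the set untouched; a power of the cycle `b`
then tests membership of a single state. -/
theorem snd_subset_of_witnessProdLang_eq (hm : 3 ≤ m) (hn : 3 ≤ n)
    {t t' : Option (Fin m) × Finset (Fin n)}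
    (ht : ProdValid {lastState hm} (zeroState hn) t)
    (ht' : ProdValid {lastState hm} (zeroState hn) t')
    (h : witnessProdLang hm hn t = witnessProdLang hm hn t') : t.2 ⊆ t'.2 := by
  have key : ∀ (t : Option (Fin m) × Finset (Fin n)),
      ProdValid {lastState hm} (zeroState hn) t → ∀ w, .d :: w ∈ witnessProdLang hm hn t ↔
        ∃ q ∈ t.2, w ∈ runLang {.a, .b, .d} (stepBAD hn) {lastState hn} q := by
    intro t ht w
    rw [witnessProdLang, cons_mem_prodLang ht, mem_prodLang]
    change w ∈ optLang _ _ _ (witnessProdStep hm hn t .d).1 * _ ∨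
      (∃ q ∈ (witnessProdStep hm hn t .d).2, _) ↔ _
    rw [witnessProdStep_d]
    refine or_iff_right ?_
    rintro ⟨u, hu, -⟩
    exact hu
  intro q hq
  have hrot : ∀ q : Fin n, stepBAD hn q .b = finRotate n q := fun _ => rfl
  obtain ⟨k, hk⟩ := exists_foldl_replicate hrot q (lastState hn)
  have h1 : .d :: List.replicate k .b ∈ witnessProdLang hm hn t :=
    (key t ht _).2 ⟨q, hq, replicate_mem_words (by simp) k, hk⟩
  rw [h, key t' ht'] at h1
  obtain ⟨q', hq', -, hF⟩ := h1
  rwa [← foldl_replicate_injective hrot k (hF.trans hk.symm : _)]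

theorem witnessProdLang_injOn (hm : 3 ≤ m) (hn : 3 ≤ n) :
    Set.InjOn (witnessProdLang hm hn) {t | ProdValid {lastState hm} (zeroState hn) t} := by
  have hsnd : ∀ t t', ProdValid {lastState hm} (zeroState hn) t →
      ProdValid {lastState hm} (zeroState hn) t' →
      witnessProdLang hm hn t = witnessProdLang hm hn t' → t.2 = t'.2 := fun t t' ht ht' h =>
    (snd_subset_of_witnessProdLang_eq hm hn ht ht' h).antisymm
      (snd_subset_of_witnessProdLang_eq hm hn ht' ht h.symm)
  have hfst : ∀ (w : List Letter) (t : Option (Fin m) × Finset (Fin n)),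
      (w.foldl (witnessProdStep hm hn) t).1 =
        w.foldl (optStep {.a, .b, .c} (stepABC hm)) t.1 := by
    intro w
    induction w with
    | nil => exact fun _ => rfl
    | cons x w ih => exact fun t => ih _
  -- The letter `c` erases the old set and fixes the first component, so `0` appears precisely if
  -- that component is final. Preceded by a power of `a`, this identifies the first component.
  have hc : ∀ t : Option (Fin m) × Finset (Fin n), zeroState hn ∈ (witnessProdStep hm hn t .c).2 ↔
      t.1 = some (lastState hm) := by
    intro t
    rw [mem_prodStep_snd]
    simp [optStep, stepABC]
  have key : ∀ t t', ProdValid {lastState hm} (zeroState hn) t →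
      ProdValid {lastState hm} (zeroState hn) t' →
      witnessProdLang hm hn t = witnessProdLang hm hn t' → ∀ p, t.1 = some p → t'.1 = some p := by
    intro t t' ht ht' h p hp
    have hrot : ∀ q : Fin m, stepABC hm q .a = finRotate m q := fun _ => rfl
    obtain ⟨k, hk⟩ := exists_foldl_replicate hrot p (lastState hm)
    have hw : List.replicate k Letter.a ∈ words {.a, .b, .c} := replicate_mem_words (by simp) k
    have e := congrArg (fun K => Language.leftQuotient K (List.replicate k Letter.a ++ [Letter.c])) h
    simp only [witnessProdLang] at e
    rw [leftQuotient_prodLang ht, leftQuotient_prodLang ht'] at e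
    have e2 := hsnd _ _ (ht.foldl _) (ht'.foldl _) e
    have h1 : zeroState hn ∈ ((List.replicate k Letter.a ++ [Letter.c]).foldl
        (witnessProdStep hm hn) t).2 := by
      rw [List.foldl_append, List.foldl_cons, List.foldl_nil, hc, hfst, hp,
        foldl_optStep_some hw, hk]
    rw [witnessProdStep, e2, ← witnessProdStep, List.foldl_append, List.foldl_cons, List.foldl_nil,
      hc, hfst] at h1
    cases hp' : t'.1 with
    | none =>
      rw [hp', foldl_optStep_none] at h1
      exact absurd h1 (by simp)
    | some p' =>
      rw [hp', foldl_optStep_some hw, ← hk, Option.some.injEq] at h1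
      rw [foldl_replicate_injective hrot k h1]
  intro t ht t' ht' h
  refine Prod.ext ?_ (hsnd t t' ht ht' h)
  cases hp : t.1 with
  | some p => exact (key t t' ht ht' h p hp).symm
  | none =>
    cases hp' : t'.1 with
    | none => rfl
    | some p =>
      have := key t' t ht' ht h.symm p hp'
      rw [hp] at this
      exact absurd this (by simp)

theorem alphabet_mul {α : Type*} {K L : Language α} (hK : ∃ w, w ∈ K) (hL : ∃ w, w ∈ L) :
    alphabet (K * L) = alphabet K ∪ alphabet L := by
  obtain ⟨k, hk⟩ := hK
  obtain ⟨l, hl⟩ := hL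
  refine (alphabet_subset ?_).antisymm (Set.union_subset ?_ ?_)
  · rintro _ ⟨u, hu, v, hv, rfl⟩
    exact append_mem_words (words_mono Set.subset_union_left (mem_words_alphabet hu))
      (words_mono Set.subset_union_right (mem_words_alphabet hv))
  · rintro x ⟨u, v, h⟩
    exact ⟨u, v ++ l, by simpa using Language.append_mem_mul h hl⟩
  · rintro x ⟨u, v, h⟩
    exact ⟨k ++ u, v, by simpa using Language.append_mem_mul hk h⟩

theorem Presents.nonempty {α : Type*} {L : Language α} {δ : Fin n → α → Fin n} {f s : Fin n}
    (P : Presents L δ {f} s) : ∃ w, w ∈ L := by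
  obtain ⟨w, hw, e⟩ := P.reach f
  exact ⟨w, P.mem_iff.2 ⟨hw, e⟩⟩

theorem le_complexity_mul (hm : 3 ≤ m) (hn : 3 ≤ n) :
    ((m * 2 ^ n + 2 ^ (n - 1) : ℕ) : ℕ∞) ≤
      complexity (runLang {.a, .b, .c} (stepABC hm) {lastState hm} (zeroState hm) *
        runLang {.a, .b, .d} (stepBAD hn) {lastState hn} (zeroState hn)) := by
  classical
  obtain ⟨hΓ', P'⟩ := presents_runLang (Γ := {.a, .b, .c}) (δ := stepABC hm) (x := .a) (by simp)
    (fun _ => rfl) (lastState hm) (zeroState hm)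
  obtain ⟨hΓ, P⟩ := presents_runLang (Γ := {.a, .b, .d}) (δ := stepBAD hn) (x := .b) (by simp)
    (fun _ => rfl) (lastState hn) (zeroState hn)
  rw [← card_filter_prodValid (lastState hm) (zeroState hn)]
  refine le_complexity_of_finset _ (witnessProdLang hm hn) ?_ fun t ht => ?_
  · refine (witnessProdLang_injOn hm hn).mono ?_
    intro t ht
    simpa using ht
  · obtain ⟨w, hw⟩ := prodReachable_of_prodValid hm hn t (by simpa using ht)
    refine ⟨w, ?_, ?_⟩
    · rw [alphabet_mul P'.nonempty P.nonempty, hΓ', hΓ]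
      intro x _
      cases x <;> simp
    · rw [leftQuotient_mul P' P, hΓ', hΓ]
      have h0 : prodStart {lastState hm} (zeroState hm) (zeroState hn) =
          (some (zeroState hm), ∅) := by
        rw [prodStart, if_neg]
        exact (lastState_ne_zeroState hm).symm
      rw [h0, ← hw]
      rfl

end ProductWitness


/-! ### Lower bounds for boolean operations. -/

section BooleanWitness

variable {m n : ℕ} {α : Type*} {L' L : Language α} {δ' : Fin m → α → Fin m}
  {δ : Fin n → α → Fin n} {F' : Set (Fin m)} {F : Set (Fin n)} {s' : Fin m} {s : Fin n} {a b c d : α}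

/-- Two automata in which `a` and `b` act as the cycle and the transposition, with their roles
interchanged, can be moved independently. -/
theorem exists_word_pair (hm : 3 ≤ m) (hn : 3 ≤ n) (ha' : ∀ q, δ' q a = finRotate m q)
    (hb' : ∀ q, δ' q b = swapState hm q) (ha : ∀ q, δ q a = swapState hn q)
    (hb : ∀ q, δ q b = finRotate n q) (p p₁ : Fin m) (q q₁ : Fin n) :
    ∃ w ∈ words {a, b}, w.foldl δ' p = p₁ ∧ w.foldl δ q = q₁ := by
  let R : Fin m → Fin n → Fin m → Fin n → Prop := fun p q p₁ q₁ =>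
    ∃ w ∈ words {a, b}, w.foldl δ' p = p₁ ∧ w.foldl δ q = q₁
  have trans : ∀ {p q p₁ q₁ p₂ q₂}, R p q p₁ q₁ → R p₁ q₁ p₂ q₂ → R p q p₂ q₂ := by
    rintro p q _ _ _ _ ⟨u, hu, rfl, rfl⟩ ⟨v, hv, rfl, rfl⟩
    exact ⟨u ++ v, by simp [hu, hv], by simp, by simp⟩
  have stepA : ∀ p q, R p q (finRotate m p) (swapState hn q) := fun p q =>
    ⟨[a], by simp, ha' p, ha q⟩
  have stepB : ∀ p q, R p q (swapState hm p) (finRotate n q) := fun p q =>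
    ⟨[b], by simp, hb' p, hb q⟩
  -- States from `2` on are fixed by the transposition, so one component can rest there while the
  -- cycle moves the other. The pair of last states serves as a hub for all moves.
  have fixA : ∀ {q : Fin n}, 2 ≤ q.val → ∀ p p₁, R p q p₁ q := by
    intro q hq p p₁
    obtain ⟨k, hk⟩ := exists_foldl_replicate ha' p p₁
    refine ⟨_, replicate_mem_words (by simp) k, hk, ?_⟩
    clear hk
    induction k with
    | zero => rfl
    | succ k ih => rw [List.replicate_succ, List.foldl_cons, ha, swapState_of_two_le hn hq, ih]
  have fixB : ∀ {p : Fin m}, 2 ≤ p.val → ∀ q q₁, R p q p q₁ := by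
    intro p hp q q₁
    obtain ⟨k, hk⟩ := exists_foldl_replicate hb q q₁
    refine ⟨_, replicate_mem_words (by simp) k, ?_, hk⟩
    clear hk
    induction k with
    | zero => rfl
    | succ k ih => rw [List.replicate_succ, List.foldl_cons, hb', swapState_of_two_le hm hp, ih]
  have lm : 2 ≤ (lastState hm).val := by
    rw [val_lastState]
    omega
  have ln : 2 ≤ (lastState hn).val := by
    rw [val_lastState]
    omega
  have small : ∀ {k : ℕ} (hk : 3 ≤ k) (p : Fin k), 2 ≤ p.val ∨ p = zeroState hk ∨ p = oneState hk := by
    intro k hk p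
    rcases Nat.lt_or_ge p.val 2 with h | h
    · right
      rw [Fin.ext_iff, Fin.ext_iff, val_zeroState, val_oneState]
      omega
    · exact Or.inl h
  have toHub2 : ∀ {p : Fin m}, 2 ≤ p.val → ∀ q, R p q (lastState hm) (lastState hn) := fun hp q =>
    trans (fixB hp q (lastState hn)) (fixA ln _ _)
  have toHub1 : ∀ q, R (oneState hm) q (lastState hm) (lastState hn) := by
    intro q
    refine trans (stepA _ _) (toHub2 ?_ _)
    rw [val_finRotate, val_oneState, if_neg (by omega)]
  have toHub : ∀ p q, R p q (lastState hm) (lastState hn) := by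
    intro p q
    rcases small hm p with hp | rfl | rfl
    · exact toHub2 hp q
    · refine trans (stepA _ _) ?_
      rw [finRotate_zeroState]
      exact toHub1 _
    · exact toHub1 q
  have fromHubP : ∀ {p : Fin m}, 2 ≤ p.val → ∀ q, R (lastState hm) (lastState hn) p q :=
    fun hp q => trans (fixA ln _ _) (fixB hp _ q)
  have fromHubQ : ∀ {q : Fin n}, 2 ≤ q.val → ∀ p, R (lastState hm) (lastState hn) p q :=
    fun hq p => trans (fixB lm _ _) (fixA hq _ p)
  -- The last `a` moves the first component from `n - 1` of its cycle to `0`; its transposition in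
  -- the second component is compensated in advance.
  have from0 : ∀ q, R (lastState hm) (lastState hn) (zeroState hm) q := by
    intro q
    refine trans (fromHubP lm (swapState hn q)) ?_
    have := stepA (lastState hm) (swapState hn q)
    rwa [finRotate_lastState, swapState_swapState] at this
  have fromHub : ∀ p q, R (lastState hm) (lastState hn) p q := by
    intro p q
    rcases small hm p with hp | rfl | rfl
    · exact fromHubP hp q
    · exact from0 q
    · refine trans (from0 (swapState hn q)) ?_
      have := stepA (zeroState hm) (swapState hn q)
      rwa [finRotate_zeroState, swapState_swapState] at this
  exact trans (toHub p q) (fromHub p₁ q₁)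

/-- A word that takes `p` and `q` to the two final states singles out the pair, since shared letters
act injectively on both sides. The same steering shows that every shared letter occurs in the
intersection. -/
theorem le_complexity_inf (P' : Presents L' δ' F' s') (P : Presents L δ F s)
    (h : ∀ p q p₁ q₁, ∃ w ∈ words (alphabet L' ∩ alphabet L), w.foldl δ' p = p₁ ∧ w.foldl δ q = q₁)
    {f' : Fin m} {f : Fin n} (hF' : F' = {f'}) (hF : F = {f})
    (hinj' : ∀ x ∈ alphabet L' ∩ alphabet L, Function.Injective fun q => δ' q x)
    (hinj : ∀ x ∈ alphabet L' ∩ alphabet L, Function.Injective fun q => δ q x) :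
    ((m * n : ℕ) : ℕ∞) ≤ complexity (L' ⊓ L) := by
  subst hF' hF
  have hl : ∀ {w : List α}, w ∈ words (alphabet L' ∩ alphabet L) → w ∈ words (alphabet L') :=
    words_mono Set.inter_subset_left
  have hr : ∀ {w : List α}, w ∈ words (alphabet L' ∩ alphabet L) → w ∈ words (alphabet L) :=
    words_mono Set.inter_subset_right
  have hΓ : alphabet L' ∩ alphabet L ⊆ alphabet (L' ⊓ L) := by
    intro x hx
    obtain ⟨w, hw, e', e⟩ := h (δ' s' x) (δ s x) f' f
    exact ⟨[], w, P'.mem_iff.2 ⟨by simp [hx.1, hl hw], e'⟩, P.mem_iff.2 ⟨by simp [hx.2, hr hw], e⟩⟩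
  have := le_complexity (L := L' ⊓ L) (fun t : Fin m × Fin n =>
      runLang (alphabet L') δ' {f'} t.1 ⊓ runLang (alphabet L) δ {f} t.2) (fun t u e => by
      obtain ⟨w, hw, e1, e2⟩ := h t.1 t.2 f' f
      have hmem : w ∈ runLang (alphabet L') δ' {f'} t.1 ⊓ runLang (alphabet L) δ {f} t.2 :=
        ⟨⟨hl hw, e1⟩, hr hw, e2⟩
      simp only at e
      rw [e] at hmem
      exact Prod.ext (foldl_injective hinj' hw (e1.trans hmem.1.2.symm))
        (foldl_injective hinj hw (e2.trans hmem.2.2.symm))) (fun t => by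
      obtain ⟨w, hw, e1, e2⟩ := h s' s t.1 t.2
      refine ⟨w, words_mono hΓ hw, ?_⟩
      change L'.leftQuotient w ⊓ L.leftQuotient w = _
      rw [P'.leftQuotient (hl hw), P.leftQuotient (hr hw), e1, e2])
  simpa using this

/-- Any letter of `L'` can be followed by `c` and completed to a word of `L'`; because of `c` this
word is not in `L`. -/
theorem alphabet_sdiff (P' : Presents L' δ' F' s') (hF' : F'.Nonempty)
    (hc' : StronglyConnected (alphabet L') δ') (hcL' : c ∈ alphabet L') (hcL : c ∉ alphabet L) :
    alphabet (L' \ L) = alphabet L' := by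
  refine (alphabet_mono fun w hw => hw.1).antisymm fun x hx => ?_
  obtain ⟨f, hf⟩ := hF'
  obtain ⟨w, hw, e⟩ := hc' (δ' (δ' s' x) c) f
  refine ⟨[], c :: w, P'.mem_iff.2 ⟨by simp [hx, hcL', hw], ?_⟩, fun h => hcL ?_⟩
  · simpa [e] using hf
  · exact ⟨[x], w, h⟩

/-- Reading `c` removes the subtracted language and exposes the first component. With equal first
components, a word leading both sides to their final states is missing only if the second component
is the intended one. -/
theorem le_complexity_sdiff (P' : Presents L' δ' F' s') (P : Presents L δ F s)
    (h : ∀ p q p₁ q₁, ∃ w ∈ words (alphabet L' ∩ alphabet L), w.foldl δ' p = p₁ ∧ w.foldl δ q = q₁)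
    {f' : Fin m} {f : Fin n} (hF' : F' = {f'}) (hF : F = {f})
    (hinj : ∀ x ∈ alphabet L' ∩ alphabet L, Function.Injective fun q => δ q x)
    (hcL' : c ∈ alphabet L') (hcL : c ∉ alphabet L) (hδc : ∀ q, δ' q c = q) :
    ((m * n + m : ℕ) : ℕ∞) ≤ complexity (L' \ L) := by
  subst hF' hF
  have hl : ∀ {w : List α}, w ∈ words (alphabet L' ∩ alphabet L) → w ∈ words (alphabet L') :=
    words_mono Set.inter_subset_left
  have hr : ∀ {w : List α}, w ∈ words (alphabet L' ∩ alphabet L) → w ∈ words (alphabet L) :=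
    words_mono Set.inter_subset_right
  have hc' : StronglyConnected (alphabet L') δ' := fun p q => by
    obtain ⟨w, hw, e, -⟩ := h p s q s
    exact ⟨w, hl hw, e⟩
  have hΓ := alphabet_sdiff (L := L) P' ⟨f', rfl⟩ hc' hcL' hcL
  let g : Fin m × Option (Fin n) → Language α := fun t =>
    runLang (alphabet L') δ' {f'} t.1 \ optLang (alphabet L) δ {f} t.2
  have hquot : ∀ t, (g t).leftQuotient [c] = runLang (alphabet L') δ' {f'} t.1 := by
    intro t
    change (runLang (alphabet L') δ' {f'} t.1).leftQuotient [c] \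
      (optLang (alphabet L) δ {f} t.2).leftQuotient [c] = _
    rw [leftQuotient_runLang (by simpa using hcL'), leftQuotient_optLang,
      foldl_optStep_eq_none (by simpa using hcL)]
    change runLang (alphabet L') δ' {f'} (δ' t.1 c) \ ⊥ = _
    rw [hδc, sdiff_bot]
  have key : ∀ p q o, g (p, some q) = g (p, o) → o = some q := by
    intro p q o e
    obtain ⟨w, hw, e1, e2⟩ := h p q f' f
    have hnot : w ∉ g (p, some q) := fun hmem => hmem.2 ⟨hr hw, e2⟩
    rw [e] at hnot
    have : w ∈ optLang (alphabet L) δ {f} o := by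
      by_contra ho
      exact hnot ⟨⟨hl hw, e1⟩, ho⟩
    cases o with
    | none => exact absurd this notMem_optLang_none
    | some q' => rw [foldl_injective hinj hw (e2.trans (this.2 : _ = _).symm)]
  have := le_complexity (L := L' \ L) g (fun t u e => by
      have h1 : t.1 = u.1 := P'.inj (by rw [← hquot t, ← hquot u, e])
      obtain ⟨p, o⟩ := t
      obtain ⟨p', o'⟩ := u
      simp only at h1
      subst h1
      cases o with
      | some q => rw [key _ _ _ e]
      | none =>
        cases o' with
        | none => rfl
        | some q => rw [key _ _ _ e.symm]) (fun t => by
      obtain ⟨w, hw, e1, e2⟩ := h s' s t.1 (t.2.getD s)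
      rw [hΓ]
      obtain ⟨p, _ | q⟩ := t
      · refine ⟨w ++ [c], by simp [hl hw, hcL'], ?_⟩
        change L'.leftQuotient (w ++ [c]) \ L.leftQuotient (w ++ [c]) = _
        rw [P'.leftQuotient (by simp [hl hw, hcL']), P.leftQuotient_eq_optLang,
          foldl_optStep_eq_none (by simp [hcL]), List.foldl_append, e1, List.foldl_cons,
          List.foldl_nil, hδc]
      · refine ⟨w, hl hw, ?_⟩
        change L'.leftQuotient w \ L.leftQuotient w = _
        rw [P'.leftQuotient (hl hw), P.leftQuotient (hr hw), e1, e2]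
        rfl)
  refine le_trans (le_of_eq ?_) this
  simp only [ENat.card_eq_coe_fintype_card, Fintype.card_prod, Fintype.card_option,
    Fintype.card_fin]
  congr 1

/-- Lower bound for the operations `∘` with `K ∘ ∅ = K` and `∅ ∘ K = K`. -/
theorem le_complexity_of_unital (op : Language α → Language α → Language α)
    (hop : ∀ K' K w, (op K' K).leftQuotient w = op (K'.leftQuotient w) (K.leftQuotient w))
    (hop_right : ∀ K, op K 0 = K) (hop_left : ∀ K, op 0 K = K)
    (hΓ : alphabet L' ∪ alphabet L ⊆ alphabet (op L' L))
    (P' : Presents L' δ' F' s') (P : Presents L δ F s) (hF' : F'.Nonempty) (hF : F.Nonempty)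
    (h : ∀ p q p₁ q₁, ∃ w ∈ words (alphabet L' ∩ alphabet L), w.foldl δ' p = p₁ ∧ w.foldl δ q = q₁)
    (hcL' : c ∈ alphabet L') (hcL : c ∉ alphabet L) (hδc : ∀ q, δ' q c = q)
    (hdL : d ∈ alphabet L) (hdL' : d ∉ alphabet L') (hδd : ∀ q, δ q d = q) :
    ((m * n + m + n + 1 : ℕ) : ℕ∞) ≤ complexity (op L' L) := by
  obtain ⟨f', hf'⟩ := hF'
  obtain ⟨f, hf⟩ := hF
  have hl : ∀ {w : List α}, w ∈ words (alphabet L' ∩ alphabet L) → w ∈ words (alphabet L') :=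
    words_mono Set.inter_subset_left
  have hr : ∀ {w : List α}, w ∈ words (alphabet L' ∩ alphabet L) → w ∈ words (alphabet L) :=
    words_mono Set.inter_subset_right
  have hinj' := P'.optLang_injective fun q => by
    obtain ⟨w, hw, e, -⟩ := h q s f' s
    exact ⟨w, hl hw, e ▸ hf'⟩
  have hinj := P.optLang_injective fun q => by
    obtain ⟨w, hw, -, e⟩ := h s' q s' f
    exact ⟨w, hr hw, e ▸ hf⟩
  let g : Option (Fin m) × Option (Fin n) → Language α := fun t =>
    op (optLang (alphabet L') δ' F' t.1) (optLang (alphabet L) δ F t.2)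
  have id' : ∀ o : Option (Fin m), optStep (alphabet L') δ' o c = o := by
    rintro (_ | q) <;> simp [optStep, hcL', hδc]
  have id : ∀ o : Option (Fin n), optStep (alphabet L) δ o d = o := by
    rintro (_ | q) <;> simp [optStep, hdL, hδd]
  have kill : ∀ o : Option (Fin n), optStep (alphabet L) δ o c = none := by
    simp [optStep, hcL]
  have kill' : ∀ o : Option (Fin m), optStep (alphabet L') δ' o d = none := by
    simp [optStep, hdL']
  have hquot : ∀ t w, (g t).leftQuotient w = g (w.foldl (optStep (alphabet L') δ') t.1,
      w.foldl (optStep (alphabet L) δ) t.2) := by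
    intro t w
    simp only [g]
    rw [hop, leftQuotient_optLang, leftQuotient_optLang]
  have hg : ∀ t u, g t = g u → t = u := by
    intro t u e
    -- Each private letter reduces the operation to one operand, so `c` exposes the first component
    -- and `d` the second.
    have h1 : (g t).leftQuotient [c] = (g u).leftQuotient [c] := by rw [e]
    have h2 : (g t).leftQuotient [d] = (g u).leftQuotient [d] := by rw [e]
    simp only [hquot, List.foldl_cons, List.foldl_nil, id, id', kill, kill', g] at h1 h2
    refine Prod.ext (hinj' ?_) (hinj ?_)
    · exact (hop_right _).symm.trans (h1.trans (hop_right _))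
    · exact (hop_left _).symm.trans (h2.trans (hop_left _))
  have hstart : op L' L = g (some s', some s) := by
    simp only [g, optLang_some]
    rw [← P'.eq, ← P.eq]
  have hreach : ∀ t : Option (Fin m) × Option (Fin n), ∃ w ∈ words (alphabet L' ∪ alphabet L),
      (w.foldl (optStep (alphabet L') δ') (some s'),
        w.foldl (optStep (alphabet L) δ) (some s)) = t := by
    rintro ⟨o', o⟩
    -- Where a sink is wanted the target state is arbitrary, as the component is killed afterwards
    -- by `c` or `d`.
    obtain ⟨w, hw, e1, e2⟩ := h s' s (o'.getD s') (o.getD s)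
    have hw' := words_mono (Set.subset_union_left (t := alphabet L)) (hl hw)
    have hc1 : c ∈ alphabet L' ∪ alphabet L := Or.inl hcL'
    have hd1 : d ∈ alphabet L' ∪ alphabet L := Or.inr hdL
    rcases o' with _ | p <;> rcases o with _ | q
    · exact ⟨w ++ [c, d], by simp [hw', hc1, hd1], by simp [kill, kill']⟩
    · refine ⟨w ++ [d], by simp [hw', hd1], ?_⟩
      rw [List.foldl_append, List.foldl_append, foldl_optStep_some (hr hw), e2]
      simp [kill', id]
    · refine ⟨w ++ [c], by simp [hw', hc1], ?_⟩
      rw [List.foldl_append, List.foldl_append, foldl_optStep_some (hl hw), e1]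
      simp [kill, id']
    · refine ⟨w, hw', ?_⟩
      rw [foldl_optStep_some (hl hw), foldl_optStep_some (hr hw), e1, e2]
      rfl
  have := le_complexity (L := op L' L) g hg (fun t => by
    obtain ⟨w, hw, e⟩ := hreach t
    refine ⟨w, words_mono hΓ hw, ?_⟩
    rw [hstart, hquot, e])
  refine le_trans (le_of_eq ?_) this
  simp only [ENat.card_eq_coe_fintype_card, Fintype.card_prod, Fintype.card_option,
    Fintype.card_fin]
  congr 1
  ring

end BooleanWitness

/-! ### Presentations of the dialects and conclusion. -/

section Main

variable {n : ℕ}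

theorem presents_witness_ab_c (hn : 3 ≤ n) :
    alphabet (witness n hn (some .a) (some .b) none (some .c)) = {.a, .b, .c} ∧
      Presents (witness n hn (some .a) (some .b) none (some .c)) (stepABC hn) {lastState hn}
        (zeroState hn) := by
  rw [witness_ab_c]
  exact presents_runLang (x := .a) (by simp) (fun _ => rfl) _ _

theorem presents_witness_ba_d (hn : 3 ≤ n) :
    alphabet (witness n hn (some .b) (some .a) none (some .d)) = {.a, .b, .d} ∧
      Presents (witness n hn (some .b) (some .a) none (some .d)) (stepBAD hn) {lastState hn}
        (zeroState hn) := by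
  rw [witness_ba_d]
  exact presents_runLang (x := .b) (by simp) (fun _ => rfl) _ _

theorem presents_witness_ba (hn : 3 ≤ n) :
    alphabet (witness n hn (some .b) (some .a) none none) = {.a, .b} ∧
      Presents (witness n hn (some .b) (some .a) none none) (stepBAD hn) {lastState hn}
        (zeroState hn) := by
  rw [witness_ba]
  exact presents_runLang (x := .b) (by simp) (fun _ => rfl) _ _

theorem presents_witness_abcd (hn : 3 ≤ n) :
    alphabet (witness n hn (some .a) (some .b) (some .c) (some .d)) = Set.univ ∧
      Presents (witness n hn (some .a) (some .b) (some .c) (some .d)) (stepABCD hn) {lastState hn}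
        (zeroState hn) := by
  rw [witness_abcd]
  exact presents_runLang (x := .a) (by simp) (stepABCD_a hn) _ _

theorem presents_witness_abc (hn : 3 ≤ n) :
    alphabet (witness n hn (some .a) (some .b) (some .c) none) = {.a, .b, .c} ∧
      Presents (witness n hn (some .a) (some .b) (some .c) none) (stepABCD hn) {lastState hn}
        (zeroState hn) := by
  rw [witness_abc]
  exact presents_runLang (x := .a) (by simp) (stepABCD_a hn) _ _

theorem presents_witness_ab (hn : 3 ≤ n) :
    alphabet (witness n hn (some .a) (some .b) none none) = {.a, .b} ∧
      Presents (witness n hn (some .a) (some .b) none none) (stepABCD hn) {lastState hn}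
        (zeroState hn) := by
  rw [witness_ab]
  exact presents_runLang (x := .a) (by simp) (stepABCD_a hn) _ _

theorem presents_witness_a (hn : 3 ≤ n) :
    alphabet (witness n hn (some .a) none none none) = {.a} ∧
      Presents (witness n hn (some .a) none none none) (stepABCD hn) {lastState hn}
        (zeroState hn) := by
  rw [witness_a]
  exact presents_runLang (x := .a) (by simp) (stepABCD_a hn) _ _

theorem unary_bounds_attained (hn : 3 ≤ n) {L : Language Letter}
    (P : Presents L (stepABCD hn) {lastState hn} (zeroState hn))
    (hΓ : {.a, .b, .c} ⊆ alphabet L) :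
    ENat.card (SyntacticSemigroup L) = ((n ^ n : ℕ) : ℕ∞) ∧
      complexity L.reverse = ((2 ^ n : ℕ) : ℕ∞) ∧
      (atoms L).encard = ((2 ^ n : ℕ) : ℕ∞) ∧
      ∀ S ⊆ quotients L, atomOf L S ∈ atoms L ∧
        complexity (atomOf L S) = ((atomBound n S.ncard : ℕ) : ℕ∞) := by
  have : Nontrivial (Fin n) := Fin.nontrivial_iff_two_le.2 (by omega)
  have h : Full (alphabet L) (stepABCD hn) :=
    full_of_letters hn (hΓ (by simp)) (hΓ (by simp)) (hΓ (by simp))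
      (stepABCD_a hn) (stepABCD_b hn) (stepABCD_c hn)
  exact ⟨P.card_syntacticSemigroup h, P.complexity_reverse h, P.encard_atoms h, fun S hS =>
    ⟨P.atomOf_mem_atoms h S, P.complexity_atomOf h (fun x _ => stepABCD_not_constant hn x) hS⟩⟩

theorem complexity_kstar_eq (hn : 3 ≤ n) {L : Language Letter}
    (P : Presents L (stepABCD hn) {lastState hn} (zeroState hn))
    (hΓ : {.a, .b} ⊆ alphabet L) :
    complexity L∗ = ((2 ^ (n - 1) + 2 ^ (n - 2) : ℕ) : ℕ∞) :=
  le_antisymm (P.complexity_kstar_le hn)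
    (le_complexity_kstar hn P (hΓ (by simp)) (hΓ (by simp)) (stepABCD_a hn) (stepABCD_b hn))

theorem exists_word_pair_of_subset {m : ℕ} (hm : 3 ≤ m) (hn : 3 ≤ n) {Γ : Set Letter}
    (hΓ : {.a, .b} ⊆ Γ) {δ' : Fin m → Letter → Fin m}
    (ha : ∀ q, δ' q .a = finRotate m q) (hb : ∀ q, δ' q .b = swapState hm q)
    (p : Fin m) (q : Fin n) (p₁ : Fin m) (q₁ : Fin n) :
    ∃ w ∈ words Γ, w.foldl δ' p = p₁ ∧ w.foldl (stepBAD hn) q = q₁ := by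
  obtain ⟨w, hw, h⟩ := exists_word_pair hm hn ha hb (δ := stepBAD hn) (fun _ => rfl)
    (fun _ => rfl) p p₁ q q₁
  exact ⟨w, words_mono hΓ hw, h⟩

theorem stepABC_injective (hn : 3 ≤ n) (x : Letter) :
    Function.Injective fun q => stepABC hn q x := by
  cases x
  · exact (finRotate n).injective
  · exact (swapState hn).injective
  · exact Function.injective_id
  · exact Function.injective_id

theorem stepBAD_injective (hn : 3 ≤ n) (x : Letter) :
    Function.Injective fun q => stepBAD hn q x := by
  cases x
  · exact (swapState hn).injective
  · exact (finRotate n).injective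
  · exact Function.injective_id
  · exact Function.injective_id

end Main

end MostComplex

open MostComplex
theorem theorem3 :
    -- the DFA is minimal and its language has complexity `n`
    (∀ (n : ℕ) (hn : 3 ≤ n),
      IsMinimal (witnessDFA n hn) ∧ complexity (witnessDFA n hn).accepts = (n : ℕ∞)) ∧
    -- the stream and all the dialects used below are regular languages of complexity `n`
    (∀ (n : ℕ) (hn : 3 ≤ n), ∀ L ∈
      ({witness n hn (some .a) (some .b) (some .c) (some .d),
        witness n hn (some .a) (some .b) (some .c) none,
        witness n hn (some .a) (some .b) none (some .c),
        witness n hn (some .b) (some .a) none (some .d),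
        witness n hn (some .a) (some .b) none none,
        witness n hn (some .b) (some .a) none none,
        witness n hn (some .a) none none none} : Set (Language Letter)),
      L.IsRegular ∧ complexity L = (n : ℕ∞)) ∧
    -- syntactic semigroup, reversal, number of atoms, complexity of atoms
    (∀ (n : ℕ) (hn : 3 ≤ n), ∀ L ∈
      ({witness n hn (some .a) (some .b) (some .c) none,
        witness n hn (some .a) (some .b) (some .c) (some .d)} : Set (Language Letter)),
      ENat.card (SyntacticSemigroup L) = ((n ^ n : ℕ) : ℕ∞) ∧
      complexity L.reverse = ((2 ^ n : ℕ) : ℕ∞) ∧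
      (atoms L).encard = ((2 ^ n : ℕ) : ℕ∞) ∧
      ∀ S ⊆ quotients L, atomOf L S ∈ atoms L ∧
        complexity (atomOf L S) = ((atomBound n S.ncard : ℕ) : ℕ∞)) ∧
    -- quotients
    (∀ (n : ℕ) (hn : 3 ≤ n), ∀ L ∈
      ({witness n hn (some .a) none none none,
        witness n hn (some .a) (some .b) (some .c) (some .d)} : Set (Language Letter)),
      ∀ K ∈ quotients L, complexity K = (n : ℕ∞)) ∧
    -- star
    (∀ (n : ℕ) (hn : 3 ≤ n), ∀ L ∈
      ({witness n hn (some .a) (some .b) none none,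
        witness n hn (some .a) (some .b) (some .c) (some .d)} : Set (Language Letter)),
      complexity L∗ = ((2 ^ (n - 1) + 2 ^ (n - 2) : ℕ) : ℕ∞)) ∧
    -- product and boolean operations
    (∀ (m n : ℕ) (hm : 3 ≤ m) (hn : 3 ≤ n),
      complexity (witness m hm (some .a) (some .b) none (some .c) *
          witness n hn (some .b) (some .a) none (some .d))
        = ((m * 2 ^ n + 2 ^ (n - 1) : ℕ) : ℕ∞) ∧
      complexity (witness m hm (some .a) (some .b) none (some .c) ⊔
          witness n hn (some .b) (some .a) none (some .d))
        = ((m * n + m + n + 1 : ℕ) : ℕ∞) ∧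
      complexity (symmDiff (witness m hm (some .a) (some .b) none (some .c))
          (witness n hn (some .b) (some .a) none (some .d)))
        = ((m * n + m + n + 1 : ℕ) : ℕ∞) ∧
      complexity (witness m hm (some .a) (some .b) none (some .c) \
          witness n hn (some .b) (some .a) none none)
        = ((m * n + m : ℕ) : ℕ∞) ∧
      complexity (witness m hm (some .a) (some .b) none (some .c) \
          witness n hn (some .b) (some .a) none (some .d))
        = ((m * n + m : ℕ) : ℕ∞) ∧
      complexity (witness m hm (some .a) (some .b) none none ⊓
          witness n hn (some .b) (some .a) none none)
        = ((m * n : ℕ) : ℕ∞) ∧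
      complexity (witness m hm (some .a) (some .b) none (some .c) ⊓
          witness n hn (some .b) (some .a) none (some .d))
        = ((m * n : ℕ) : ℕ∞)) ∧
    -- the unary bounds are maximal for regular languages
    (∀ (α : Type*) [Finite α] (n : ℕ), 3 ≤ n → ∀ L : Language α, L.IsRegular →
      complexity L = (n : ℕ∞) →
      ENat.card (SyntacticSemigroup L) ≤ ((n ^ n : ℕ) : ℕ∞) ∧
      (∀ K ∈ quotients L, complexity K ≤ (n : ℕ∞)) ∧
      complexity L.reverse ≤ ((2 ^ n : ℕ) : ℕ∞) ∧
      (atoms L).encard ≤ ((2 ^ n : ℕ) : ℕ∞) ∧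
      (∀ S ⊆ quotients L, atomOf L S ∈ atoms L →
        complexity (atomOf L S) ≤ ((atomBound n S.ncard : ℕ) : ℕ∞)) ∧
      complexity L∗ ≤ ((2 ^ (n - 1) + 2 ^ (n - 2) : ℕ) : ℕ∞)) ∧
    -- the binary bounds are maximal for regular languages
    (∀ (α : Type*) [Finite α] (m n : ℕ), 3 ≤ m → 3 ≤ n → ∀ L' L : Language α,
      L'.IsRegular → L.IsRegular → complexity L' = (m : ℕ∞) → complexity L = (n : ℕ∞) →
      complexity (L' * L) ≤ ((m * 2 ^ n + 2 ^ (n - 1) : ℕ) : ℕ∞) ∧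
      complexity (L' ⊔ L) ≤ ((m * n + m + n + 1 : ℕ) : ℕ∞) ∧
      complexity (symmDiff L' L) ≤ ((m * n + m + n + 1 : ℕ) : ℕ∞) ∧
      complexity (L' \ L) ≤ ((m * n + m : ℕ) : ℕ∞) ∧
      complexity (L' ⊓ L) ≤ ((m * n : ℕ) : ℕ∞)) ∧
    -- four letters are necessary to meet the bounds for all `m, n`
    (∀ (α : Type*) [Finite α] (n : ℕ), 3 ≤ n → ∀ L' L : Language α,
      L'.IsRegular → L.IsRegular → complexity L' = (n : ℕ∞) → complexity L = (n : ℕ∞) →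
      complexity (L' ⊔ L) = ((n * n + n + n + 1 : ℕ) : ℕ∞) →
      4 ≤ (alphabet L' ∪ alphabet L).encard) := by
  refine ⟨fun n hn => ⟨isMinimal_witnessDFA hn, ?_⟩, fun n hn L hL => ?_, fun n hn L hL => ?_,
    fun n hn L hL K hK => ?_, fun n hn L hL => ?_, fun m n hm hn => ?_,
    fun α _ n hn L _ hc => ?_, fun α _ m n hm hn L' L _ _ hc' hc => ?_,
    fun α _ n hn L' L _ _ hc' hc h => ?_⟩
  · rw [accepts_witnessDFA, ← witness_abcd]
    exact (presents_witness_abcd hn).2.complexity_eq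
  · rcases hL with rfl | rfl | rfl | rfl | rfl | rfl | rfl
    · exact ⟨(presents_witness_abcd hn).2.isRegular, (presents_witness_abcd hn).2.complexity_eq⟩
    · exact ⟨(presents_witness_abc hn).2.isRegular, (presents_witness_abc hn).2.complexity_eq⟩
    · exact ⟨(presents_witness_ab_c hn).2.isRegular, (presents_witness_ab_c hn).2.complexity_eq⟩
    · exact ⟨(presents_witness_ba_d hn).2.isRegular, (presents_witness_ba_d hn).2.complexity_eq⟩
    · exact ⟨(presents_witness_ab hn).2.isRegular, (presents_witness_ab hn).2.complexity_eq⟩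
    · exact ⟨(presents_witness_ba hn).2.isRegular, (presents_witness_ba hn).2.complexity_eq⟩
    · exact ⟨(presents_witness_a hn).2.isRegular, (presents_witness_a hn).2.complexity_eq⟩
  · rcases hL with rfl | rfl
    · obtain ⟨hΓ, P⟩ := presents_witness_abc hn
      exact unary_bounds_attained hn P hΓ.ge
    · obtain ⟨hΓ, P⟩ := presents_witness_abcd hn
      exact unary_bounds_attained hn P (by simp [hΓ])
  · rcases hL with rfl | rfl
    · obtain ⟨hΓ, P⟩ := presents_witness_a hn
      exact P.complexity_quotient (stronglyConnected_of_rotate (by simp [hΓ]) (stepABCD_a hn))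
        ⟨_, rfl⟩ hK
    · obtain ⟨hΓ, P⟩ := presents_witness_abcd hn
      exact P.complexity_quotient (stronglyConnected_of_rotate (x := .a) (by simp [hΓ])
        (stepABCD_a hn)) ⟨_, rfl⟩ hK
  · rcases hL with rfl | rfl
    · obtain ⟨hΓ, P⟩ := presents_witness_ab hn
      exact complexity_kstar_eq hn P hΓ.ge
    · obtain ⟨hΓ, P⟩ := presents_witness_abcd hn
      exact complexity_kstar_eq hn P (by simp [hΓ])
  · obtain ⟨hΓ', P'⟩ := presents_witness_ab_c hm
    obtain ⟨hΓ, P⟩ := presents_witness_ba_d hn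
    obtain ⟨hΓ₁', P₁'⟩ := presents_witness_ab hm
    obtain ⟨hΓ₁, P₁⟩ := presents_witness_ba hn
    set K' := witness m hm (some .a) (some .b) none (some .c)
    set K := witness n hn (some .b) (some .a) none (some .d)
    have hcK' : Letter.c ∈ alphabet K' := by simp [hΓ']
    have hcK : Letter.c ∉ alphabet K := by simp [hΓ]
    have hdK' : Letter.d ∉ alphabet K' := by simp [hΓ']
    have hdK : Letter.d ∈ alphabet K := by simp [hΓ]
    have hsub : ({.a, .b} : Set Letter) ⊆ alphabet K' ∩ alphabet K := by
      rw [hΓ', hΓ]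
      rintro x (rfl | rfl) <;> simp
    have hpair := exists_word_pair_of_subset hm hn hsub (δ' := stepABC hm) (fun _ => rfl)
      (fun _ => rfl)
    refine ⟨le_antisymm (complexity_mul_le (by omega) P' P) ?_,
      le_antisymm (complexity_sup_le P' P) ?_, le_antisymm (complexity_symmDiff_le P' P) ?_,
      le_antisymm (complexity_sdiff_le P' P₁) ?_, le_antisymm (complexity_sdiff_le P' P) ?_,
      le_antisymm (complexity_inf_le P₁' P₁) ?_, le_antisymm (complexity_inf_le P' P) ?_⟩
    · have := le_complexity_mul hm hn
      rwa [← witness_ab_c, ← witness_ba_d] at this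
    · exact le_complexity_of_unital (fun X Y => X ⊔ Y) (fun _ _ _ => rfl) (fun X => sup_bot_eq X)
        (fun X => bot_sup_eq X) (alphabet_sup K' K).ge P' P ⟨_, rfl⟩ ⟨_, rfl⟩ hpair
        hcK' hcK (fun _ => rfl) hdK hdK' (fun _ => rfl)
    · refine le_complexity_of_unital (fun X Y => symmDiff X Y) (fun _ _ _ => rfl)
        (fun X => symmDiff_bot X) (fun X => bot_symmDiff X) (Set.union_subset ?_ ?_) P' P
        ⟨_, rfl⟩ ⟨_, rfl⟩ hpair hcK' hcK (fun _ => rfl) hdK hdK' (fun _ => rfl)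
      -- No letter is lost by cancellation: the symmetric difference contains both differences, and
      -- each of them already uses the full alphabet of its first operand.
      · rw [← alphabet_sdiff P' ⟨_, rfl⟩ (stronglyConnected_of_rotate (hsub (by simp)).1
          (fun _ => rfl : ∀ q, stepABC hm q .a = finRotate m q)) hcK' hcK]
        exact alphabet_mono fun w hw => Or.inl hw
      · rw [← alphabet_sdiff P ⟨_, rfl⟩ (stronglyConnected_of_rotate (hsub (by simp)).2
          (fun _ => rfl : ∀ q, stepBAD hn q .b = finRotate n q)) hdK hdK']
        exact alphabet_mono fun w hw => Or.inr hw
    · refine le_complexity_sdiff P' P₁ (exists_word_pair_of_subset hm hn ?_ (fun _ => rfl)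
        (fun _ => rfl)) rfl rfl (fun x _ => stepBAD_injective hn x) hcK' (by simp [hΓ₁])
        (fun _ => rfl)
      rw [hΓ', hΓ₁]
      rintro x (rfl | rfl) <;> simp
    · exact le_complexity_sdiff P' P hpair rfl rfl (fun x _ => stepBAD_injective hn x) hcK' hcK
        (fun _ => rfl)
    · refine le_complexity_inf P₁' P₁ (exists_word_pair_of_subset hm hn ?_ (stepABCD_a hm)
        (stepABCD_b hm)) rfl rfl ?_ (fun x _ => stepBAD_injective hn x)
      · rw [hΓ₁', hΓ₁, Set.inter_self]
      · rw [hΓ₁', hΓ₁, Set.inter_self]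
        rintro x (rfl | rfl)
        · exact (finRotate m).injective
        · exact (swapState hm).injective
    · exact le_complexity_inf P' P hpair rfl rfl (fun x _ => stepABC_injective hm x)
        (fun x _ => stepBAD_injective hn x)
  · obtain ⟨δ, F, s, P⟩ := exists_presents hc
    exact ⟨P.card_syntacticSemigroup_le, fun K hK => P.complexity_quotient_le hK,
      P.complexity_reverse_le, P.encard_atoms_le,
      fun S hS _ => P.complexity_atomOf_le (by omega) hS, P.complexity_kstar_le hn⟩
  · obtain ⟨δ', F', s', P'⟩ := exists_presents hc'
    obtain ⟨δ, F, s, P⟩ := exists_presents hc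
    exact ⟨complexity_mul_le (by omega) P' P, complexity_sup_le P' P, complexity_symmDiff_le P' P,
      complexity_sdiff_le P' P, complexity_inf_le P' P⟩
  · obtain ⟨δ', F', s', P'⟩ := exists_presents hc'
    obtain ⟨δ, F, s, P⟩ := exists_presents hc
    exact four_le_encard_alphabet (by omega) P' P h
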